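/- **Setting.** Let $d,d_x,d_y,p\ge 1$ be integers, let $\mathcal X\subseteq\mathbb R^{d_x}$ and $\mathcal Y\subseteq\mathbb R^{d_y}$ be Borel sets, and let $\Theta\subset\mathbb R^d$ be a bounded open set. Let $P(x,dx')$ be a Markov transition kernel on $\mathcal X$ and let $Q(x,dy)$ be a conditional probability measure on $\mathcal Y$ given $x\in\mathcal X$. Let $\{(X_n,Y_n)\}_{n\ge0}$ be an $\mathcal X\times\mathcal Y$-valued process on a probability space such that, almost surely, for all $n\ge 0$ and all Borel $B\subseteq\mathcal X\times\mathcal Y$, $$P\big((X_{n+1},Y_{n+1})\in B\,\big|\,X_{0:n},Y_{0:n}\big)=\iint I_B(x,y)\,Q(x,dy)\,P(X_n,dx)$$ (the law of $(X_0,Y_0)$ is arbitrary). Let $\mu,\nu$ be measures on $\mathcal X,\mathcal Y$, and for $\theta\in\Theta$ let $p_\theta(x'|x)\ge0$ and $q_\theta(y|x)\ge0$ be measurable functions with $\int p_\theta(x'|x)\,\mu(dx')=\int q_\theta(y|x)\,\nu(dy)=1$ for all $x$, which are $p$-times differentiable in $\theta\in\Theta$ for all $x,x'\in\mathcal X$,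 $y\in\mathcal Y$. Put $r_\theta(y,x'|x)=q_\theta(y|x')\,p_\theta(x'|x)$. For a multi-index $\alpha\in\mathbb N_0^d$, $|\alpha|$ is the sum of its components and $\partial_\theta^\alpha$ is the corresponding partial derivative. For a probability measure $\lambda$ on $\mathcal X$ and $n\ge1$ put $$q_\theta^n(y_{1:n}|\lambda)=\int\!\cdots\!\int\!\int\Big(\prod_{k=1}^n r_\theta(y_k,x_k|x_{k-1})\Big)\mu(dx_n)\cdots\mu(dx_1)\,\lambda(dx_0),\qquad l_n(\theta,\lambda)=E\Big(\frac1n\log q_\theta^n(Y_{1:n}|\lambda)\Big).$$ **Theorem 2.1.** Assume the following, where $\psi$ and $\varphi$ are measurable. 1. (Mixing) There are $\varepsilon\in(0,1)$ and, for each $\theta\in\Theta$, $y\in\mathcal Y$, a measure $\mu_\theta(dx|y)$ on $\mathcal X$ with $0<\mu_\theta(\mathcal X|y)<\infty$, such that $\varepsilon\mu_\theta(B|y)\le\int_B r_\theta(y,x'|x)\,\mu(dx')\le\varepsilon^{-1}\mu_\theta(B|y)$ for all $x\in\mathcal X$ and Borel $B\subseteq\mathcal X$. 2. (Score bounds) There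 is $\psi:\mathcal Y\to[1,\infty)$ such that $|\partial_\theta^\alpha r_\theta(y,x'|x)|\le\psi(y)^{|\alpha|}\,r_\theta(y,x'|x)$ for all $\theta\in\Theta$, $x,x'\in\mathcal X$, $y\in\mathcal Y$ and all multi-indices $\alpha$ with $1\le|\alpha|\le p$. 3. (Domination) There is $\phi:\mathcal Y\times\mathcal X\to[1,\infty)$ such that $r_\theta(y,x'|x)\le\phi(y,x')$ and $\int\phi(y,x'')\,\mu(dx'')<\infty$ for all $\theta\in\Theta$, $x,x'\in\mathcal X$, $y\in\mathcal Y$. 4. (Geometric ergodicity) There are a probability measure $\pi$ on $\mathcal X$, $\delta\in(0,1)$ and $K_0\in[1,\infty)$ such that $|P^n(x,B)-\pi(B)|\le K_0\delta^n$ for all $x\in\mathcal X$, Borel $B\subseteq\mathcal X$ and $n\ge0$. 5. (Log-growth) There is $\varphi:\mathcal Y\to[1,\infty)$ such that $|\log\mu_\theta(\mathcal X|y)|\le\varphi(y)$ for all $\theta\in\Theta$, $y\in\mathcal Y$, with $\mu_\theta(\cdot|y)$ from 1. 6. (Moments) There is $M_0\in[1,\infty)$ such that $\int\varphi(y)\psi(y)^u\,Q(x,dy)\le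 M_0$ and $\int\psi(y)^v\,Q(x,dy)\le M_0$ for all $x\in\mathcal X$, where $u=p(p+1)$, $v=2p(p+1)$ and $\psi$ is the function from 2. Then for all $\theta\in\Theta$, all probability measures $\lambda$ on $\mathcal X$ and all $n\ge1$, the average log-likelihood $l_n(\theta,\lambda)$ is well defined, that is, $0<q_\theta^n(y_{1:n}|\lambda)<\infty$ for all $y_{1:n}\in\mathcal Y^n$ and $\frac1n\log q^n_\theta(Y_{1:n}|\lambda)$ is integrable. Moreover, there exists a function $l:\Theta\to\mathbb R$ which is $p$-times differentiable on $\Theta$ and satisfies $l(\theta)=\lim_{n\to\infty}l_n(\theta,\lambda)$ for all $\theta\in\Theta$ and all probability measures $\lambda$ on $\mathcal X$. -/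

import Mathlib

open MeasureTheory ProbabilityTheory Filter Topology
open scoped ENNReal

namespace SSM

/-- The Euclidean space `ℝ^k`. -/
abbrev Euc (k : ℕ) : Type := EuclideanSpace ℝ (Fin k)

/-! ### Differentiability and multi-index partial derivatives -/

/-- `f` is `p`-times (Fréchet) differentiable on the open set `Θ ⊆ ℝ^d`: for each `k < p` the
`k`-th derivative of `f` exists and is differentiable at every point of `Θ`.
Continuity of the `p`-th derivative is not required. -/
def TimesDifferentiableOn {d : ℕ} (p : ℕ) (f : Euc d → ℝ) (Θ : Set (Euc d)) : Prop :=
  ∀ k < p, ∀ θ ∈ Θ, DifferentiableAt ℝ (iteratedFDeriv ℝ k f) θ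

/-- The first order partial derivative `∂f/∂θ_i`. -/
noncomputable def partialDeriv {d : ℕ} (i : Fin d) (f : Euc d → ℝ) : Euc d → ℝ :=
  fun θ => lineDeriv ℝ f θ (EuclideanSpace.single i 1)

/-- The multi-index derivative `∂^α f = ∂^{|α|} f / (∂θ_1^{α_1} ⋯ ∂θ_d^{α_d})`. -/
noncomputable def multiDeriv {d : ℕ} (α : Fin d → ℕ) (f : Euc d → ℝ) : Euc d → ℝ :=
  (List.finRange d).foldr (fun i g => (partialDeriv i)^[α i] g) f

section Model

variable {𝒳 𝒴 : Type*} [MeasurableSpace 𝒳] [MeasurableSpace 𝒴]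

/-! ### The true state-space model and the parametric family -/

/-- `(X_n, Y_n)_{n ≥ 0}` is a state-space model with state transition kernel `P(x,dx')` and
observation kernel `Q(x,dy)`: for every measurable `B ⊆ 𝒳 × 𝒴` and `n ≥ 0`, almost surely
`Pr((X_{n+1}, Y_{n+1}) ∈ B | X_{0:n}, Y_{0:n}) = ∫∫ 1_B(x,y) Q(x,dy) P(X_n,dx)`.
The law of `(X_0, Y_0)` is arbitrary. -/
structure IsStateSpaceModel {Ω : Type*} [MeasurableSpace Ω] (Pr : Measure Ω)
    (P : Kernel 𝒳 𝒳) (Q : Kernel 𝒳 𝒴) (X : ℕ → Ω → 𝒳) (Y : ℕ → Ω → 𝒴) : Prop where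
  measurable_state : ∀ n, Measurable (X n)
  measurable_obs : ∀ n, Measurable (Y n)
  markov : ∀ n : ℕ, ∀ B : Set (𝒳 × 𝒴), MeasurableSet B →
    Pr⟦(fun ω => (X (n + 1) ω, Y (n + 1) ω)) ⁻¹' B |
        MeasurableSpace.comap (fun ω (k : Fin (n + 1)) => (X k ω, Y k ω)) inferInstance⟧
      =ᵐ[Pr] fun ω => (∫⁻ x, Q x {y | (x, y) ∈ B} ∂(P (X n ω))).toReal

/-- The standing conditions on the parametric family. Here `pden θ x x'` is `p_θ(x'|x)` and
`qden θ x y` is `q_θ(y|x)`: nonnegative, (jointly) measurable, integrating to one, and `p`-times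
differentiable in the parameter. -/
structure IsParametricFamily {d : ℕ} (p : ℕ) (Θ : Set (Euc d)) (μ : Measure 𝒳) (ν : Measure 𝒴)
    (pden : Euc d → 𝒳 → 𝒳 → ℝ) (qden : Euc d → 𝒳 → 𝒴 → ℝ) : Prop where
  measurable_pden : ∀ θ ∈ Θ, Measurable (Function.uncurry (pden θ))
  measurable_qden : ∀ θ ∈ Θ, Measurable (Function.uncurry (qden θ))
  pden_nonneg : ∀ θ ∈ Θ, ∀ x x', 0 ≤ pden θ x x'
  qden_nonneg : ∀ θ ∈ Θ, ∀ x y, 0 ≤ qden θ x y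
  lintegral_pden : ∀ θ ∈ Θ, ∀ x, ∫⁻ x', ENNReal.ofReal (pden θ x x') ∂μ = 1
  lintegral_qden : ∀ θ ∈ Θ, ∀ x, ∫⁻ y, ENNReal.ofReal (qden θ x y) ∂ν = 1
  diff_pden : ∀ x x', TimesDifferentiableOn p (fun θ => pden θ x x') Θ
  diff_qden : ∀ x y, TimesDifferentiableOn p (fun θ => qden θ x y) Θ

/-- `rden pden qden θ y x' x` is `r_θ(y,x'|x) = q_θ(y|x') p_θ(x'|x)`. -/
def rden {d : ℕ} (pden : Euc d → 𝒳 → 𝒳 → ℝ) (qden : Euc d → 𝒳 → 𝒴 → ℝ)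
    (θ : Euc d) (y : 𝒴) (x' x : 𝒳) : ℝ :=
  qden θ x' y * pden θ x x'

/-! ### The assumptions. In all of them `r θ y x' x` is `r_θ(y,x'|x)`. -/

/-- Strong mixing: `0 < μ_θ(𝒳|y) < ∞` and
`ε μ_θ(B|y) ≤ ∫_B r_θ(y,x'|x) μ(dx') ≤ μ_θ(B|y) / ε`. -/
structure StrongMixing {d : ℕ} (Θ : Set (Euc d)) (μ : Measure 𝒳)
    (r : Euc d → 𝒴 → 𝒳 → 𝒳 → ℝ) (ε : ℝ) (μθ : Euc d → 𝒴 → Measure 𝒳) : Prop where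
  eps_pos : 0 < ε
  eps_lt_one : ε < 1
  mass_pos : ∀ θ ∈ Θ, ∀ y, 0 < μθ θ y Set.univ
  mass_lt_top : ∀ θ ∈ Θ, ∀ y, μθ θ y Set.univ < ∞
  lower : ∀ θ ∈ Θ, ∀ y x, ∀ B : Set 𝒳, MeasurableSet B →
    ENNReal.ofReal ε * μθ θ y B ≤ ∫⁻ x' in B, ENNReal.ofReal (r θ y x' x) ∂μ
  upper : ∀ θ ∈ Θ, ∀ y x, ∀ B : Set 𝒳, MeasurableSet B →
    ∫⁻ x' in B, ENNReal.ofReal (r θ y x' x) ∂μ ≤ μθ θ y B / ENNReal.ofReal ε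

/-- Score bounds: `|∂_θ^α r_θ(y,x'|x)| ≤ ψ(y)^{|α|} r_θ(y,x'|x)` for `1 ≤ |α| ≤ p`. -/
structure ScoreBound {d : ℕ} (p : ℕ) (Θ : Set (Euc d))
    (r : Euc d → 𝒴 → 𝒳 → 𝒳 → ℝ) (ψ : 𝒴 → ℝ) : Prop where
  measurable : Measurable ψ
  one_le : ∀ y, 1 ≤ ψ y
  bound : ∀ θ ∈ Θ, ∀ x x' y, ∀ α : Fin d → ℕ, α ≠ 0 → ∑ i, α i ≤ p →
    |multiDeriv α (fun t => r t y x' x) θ| ≤ ψ y ^ (∑ i, α i) * r θ y x' x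

/-- Domination: `r_θ(y,x'|x) ≤ φ(y,x')` and `∫ φ(y,x'') μ(dx'') < ∞`. -/
structure Dominated {d : ℕ} (Θ : Set (Euc d)) (μ : Measure 𝒳)
    (r : Euc d → 𝒴 → 𝒳 → 𝒳 → ℝ) (φ : 𝒴 → 𝒳 → ℝ) : Prop where
  one_le : ∀ y x', 1 ≤ φ y x'
  integrable : ∀ y, Integrable (φ y) μ
  bound : ∀ θ ∈ Θ, ∀ x x' y, r θ y x' x ≤ φ y x'

/-- Geometric ergodicity of the hidden chain: `|P^n(x,B) - π(B)| ≤ K₀ δ^n`. -/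
structure GeometricallyErgodic (P : Kernel 𝒳 𝒳) (π : Measure 𝒳) (δ K₀ : ℝ) : Prop where
  isProbabilityMeasure : IsProbabilityMeasure π
  delta_pos : 0 < δ
  delta_lt_one : δ < 1
  one_le : 1 ≤ K₀
  bound : ∀ x, ∀ B : Set 𝒳, MeasurableSet B → ∀ n : ℕ,
    |((P ^ n) x).real B - π.real B| ≤ K₀ * δ ^ n

/-- Logarithmic growth: `|log μ_θ(𝒳|y)| ≤ φ(y)`. -/
structure LogMassBound {d : ℕ} (Θ : Set (Euc d)) (μθ : Euc d → 𝒴 → Measure 𝒳)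
    (φ : 𝒴 → ℝ) : Prop where
  measurable : Measurable φ
  one_le : ∀ y, 1 ≤ φ y
  bound : ∀ θ ∈ Θ, ∀ y, |Real.log ((μθ θ y).real Set.univ)| ≤ φ y

/-- Moment bounds: `∫ φ(y) ψ(y)^u Q(x,dy) ≤ M₀` and `∫ ψ(y)^v Q(x,dy) ≤ M₀` for all `x`,
where `u = p(p+1)` and `v = 2p(p+1)`. -/
structure MomentBound (p : ℕ) (Q : Kernel 𝒳 𝒴) (φ ψ : 𝒴 → ℝ) (M₀ : ℝ) : Prop where
  one_le : 1 ≤ M₀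
  bound_u : ∀ x, ∫⁻ y, ENNReal.ofReal (φ y * ψ y ^ (p * (p + 1))) ∂(Q x) ≤ ENNReal.ofReal M₀
  bound_v : ∀ x, ∫⁻ y, ENNReal.ofReal (ψ y ^ (2 * p * (p + 1))) ∂(Q x) ≤ ENNReal.ofReal M₀

/-! ### The likelihood -/

/-- The iterated integral `∫ ⋯ ∫ g(x_1,…,x_n) μ(dx_n) ⋯ μ(dx_1)`. -/
noncomputable def iterIntegral (μ : Measure 𝒳) : (n : ℕ) → ((Fin n → 𝒳) → ℝ≥0∞) → ℝ≥0∞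
  | 0, g => g Fin.elim0
  | n + 1, g => ∫⁻ x, iterIntegral μ n (fun xs => g (Fin.cons x xs)) ∂μ

/-- The likelihood
`q_θ^n(y_{1:n}|lam) = ∫ ⋯ ∫∫ (∏_{k=1}^n r_θ(y_k,x_k|x_{k-1})) μ(dx_n) ⋯ μ(dx_1) lam(dx_0)`
as an element of `[0,∞]`, for `r y x' x` standing for `r_θ(y,x'|x)`. The observation `y_k` is
`y (k-1)`, and `(Fin.cons x₀ xs) k.succ`, `(Fin.cons x₀ xs) k.castSucc` are consecutive states of
the path `x_0, x_1, …, x_n`. -/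
noncomputable def likelihood (μ : Measure 𝒳) (r : 𝒴 → 𝒳 → 𝒳 → ℝ) (lam : Measure 𝒳)
    (n : ℕ) (y : Fin n → 𝒴) : ℝ≥0∞ :=
  ∫⁻ x₀, iterIntegral μ n (fun xs => ∏ k : Fin n,
    ENNReal.ofReal (r (y k) ((Fin.cons x₀ xs : Fin (n + 1) → 𝒳) k.succ)
      ((Fin.cons x₀ xs : Fin (n + 1) → 𝒳) k.castSucc))) ∂lam

/-- The normalized log-likelihood `(1/n) log q_θ^n(Y_{1:n}|lam)` as a random variable. -/
noncomputable def normLogLikelihood {Ω : Type*} (μ : Measure 𝒳) (r : 𝒴 → 𝒳 → 𝒳 → ℝ)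
    (Y : ℕ → Ω → 𝒴) (lam : Measure 𝒳) (n : ℕ) (ω : Ω) : ℝ :=
  1 / (n : ℝ) * Real.log (likelihood μ r lam n (fun k => Y (k + 1) ω)).toReal

/-- The average log-likelihood `l_n(θ,lam) = E((1/n) log q_θ^n(Y_{1:n}|lam))`. -/
noncomputable def avgLogLikelihood {Ω : Type*} [MeasurableSpace Ω] (Pr : Measure Ω)
    (μ : Measure 𝒳) (r : 𝒴 → 𝒳 → 𝒳 → ℝ) (Y : ℕ → Ω → 𝒴) (lam : Measure 𝒳) (n : ℕ) : ℝ :=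
  ∫ ω, normLogLikelihood μ r Y lam n ω ∂Pr

end Model

end SSM

/-! Write `condLik` for the likelihood of a string of observations started from a fixed state.
Strong mixing makes `r θ y x' x` comparable in `x` up to a factor `κ = ε⁻²`. Only the first factor
of the likelihood depends on the initial state, so `condLik` is comparable in that state with the
same `κ`, whatever the length. Hence every initial law gives the same log-likelihood up to `log κ`,
which disappears after division by `n`. From a fixed state the log-likelihood telescopes into
increments `log predLik`, so by Cesàro it suffices that the expected increments converge. For
differentiability of the limit, all their parameter derivatives up to order `p` must converge
uniformly on `Θ` (`wordDiffOn_of_tendstoUniformlyOn`).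

The analytic core is forgetting. By `predLik_cons`, `predLik (y :: ys) b x` is the average of
`predLik ys b` against the posterior density `postKer` of the next state. This density has the
Doeblin constant `κ⁻²`, so averaging contracts oscillations in the state. Differentiating the
recursion by Leibniz gives one term with an undifferentiated kernel, which contracts, and terms with
a differentiated kernel. Since the kernel integrates to one for every parameter, its derivatives
integrate to zero, so these terms see only the oscillation of lower derivatives of `predLik`.
Weighting order `|w|` by a large constant to the power `|w|` makes them cost at most half of the
Doeblin gap (`growthConst_step`), and every derivative forgets the initial state geometrically
(`wordDeriv_predLik_osc_le`). Dropping the first observation therefore changes derivatives of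
`predLik`, and of its logarithm, by a geometrically small amount
(`wordDeriv_log_predLik_cons_sub_le`). The prefactor is a power at most `p` of the sum of scores,
whose expectation grows polynomially.

Ergodicity of the hidden chain controls the other change, a shift of the observation window by one
time unit (`abs_expectation_shift_le`). To compare increments `n + 1` and `n`, about half of the
observations are forgotten in each, and the two windows left, of equal length, differ by a shift
starting at time about `n / 2`. The bound is polynomial times geometric, hence summable, which gives
the uniform convergence (`exists_summable_expectation_bound`).

Derivatives are indexed by words of coordinates rather than multi-indices, so that the Leibniz rule
is a plain sum over splits of a word. A bound `a ^ |w| * F` is then stable under products, where the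
rates `a` add, and under quotients, up to a constant. -/

namespace SSM

/-! ### Combinatorics of the Leibniz rule. -/

section Splits

/-- The ways of distributing the letters of a word over an ordered pair of subwords. -/
def splits {α : Type*} : List α → List (List α × List α)
  | [] => [([], [])]
  | i :: w => (splits w).map (fun q => (i :: q.1, q.2)) ++ (splits w).map (fun q => (q.1, i :: q.2))

/-- The members of `splits w` whose first component is nonempty. -/
def properSplits {α : Type*} : List α → List (List α × List α)
  | [] => []
  | i :: w =>
    (splits w).map (fun q => (i :: q.1, q.2)) ++ (properSplits w).map (fun q => (q.1, i :: q.2))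

variable {α : Type*}

/-- In the Leibniz rule the split set apart is the term in which the first factor is not
differentiated; it is treated differently from all the others. -/
theorem sum_splits (w : List α) (F : List α × List α → ℝ) :
    ((splits w).map F).sum = F ([], w) + ((properSplits w).map F).sum := by
  induction w generalizing F with
  | nil => simp [splits, properSplits]
  | cons i w ih =>
    simp only [splits, properSplits, List.map_append, List.map_map, List.sum_append]
    rw [ih (F ∘ fun q => (q.1, i :: q.2))]
    simp only [Function.comp_apply]
    ring

theorem length_of_mem_splits {w : List α} {q : List α × List α} (hq : q ∈ splits w) :
    q.1.length + q.2.length = w.length := by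
  induction w generalizing q with
  | nil => simp_all [splits]
  | cons i w ih =>
    simp only [splits, List.mem_append, List.mem_map] at hq
    rcases hq with ⟨q, h, rfl⟩ | ⟨q, h, rfl⟩ <;> have := ih h <;> simp only [List.length_cons] <;>
      omega

theorem mem_splits_of_mem_properSplits {w : List α} {q : List α × List α}
    (hq : q ∈ properSplits w) : q ∈ splits w := by
  induction w generalizing q with
  | nil => simp [properSplits] at hq
  | cons i w ih =>
    simp only [properSplits, splits, List.mem_append, List.mem_map] at hq ⊢
    rcases hq with h | ⟨q, h, rfl⟩
    · exact Or.inl h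
    · exact Or.inr ⟨q, ih h, rfl⟩

theorem fst_ne_nil_of_mem_properSplits {w : List α} {q : List α × List α}
    (hq : q ∈ properSplits w) : q.1 ≠ [] := by
  induction w generalizing q with
  | nil => simp [properSplits] at hq
  | cons i w ih =>
    simp only [properSplits, List.mem_append, List.mem_map] at hq
    rcases hq with ⟨q, h, rfl⟩ | ⟨q, h, rfl⟩
    · simp
    · exact ih (q := q) h

/-- Each letter goes to one side or the other, so this is the binomial theorem counted over subsets.
Through it the rates of geometric derivative bounds add under products. -/
theorem sum_splits_pow (w : List α) (a b : ℝ) :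
    ((splits w).map fun q : List α × List α => a ^ q.1.length * b ^ q.2.length).sum = (a + b) ^ w.length := by
  induction w with
  | nil => simp [splits]
  | cons i w ih =>
    simp only [splits, List.map_append, List.map_map, List.sum_append, List.length_cons]
    have h1 : ((fun q : List α × List α => a ^ q.1.length * b ^ q.2.length) ∘
        fun q : List α × List α => (i :: q.1, q.2)) = fun q => a * (a ^ q.1.length * b ^ q.2.length) := by
      funext q; simp [pow_succ]; ring
    have h2 : ((fun q : List α × List α => a ^ q.1.length * b ^ q.2.length) ∘
        fun q : List α × List α => (q.1, i :: q.2)) = fun q => b * (a ^ q.1.length * b ^ q.2.length) := by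
      funext q; simp [pow_succ]; ring
    rw [h1, h2, List.sum_map_mul_left, List.sum_map_mul_left, ih]
    ring

theorem abs_sum_map_le {β : Type*} (l : List β) (F B : β → ℝ) (h : ∀ q ∈ l, |F q| ≤ B q) :
    |(l.map F).sum| ≤ (l.map B).sum := by
  induction l with
  | nil => simp
  | cons a l ih =>
    simp only [List.map_cons, List.sum_cons]
    refine (abs_add_le _ _).trans (add_le_add (h a (by simp)) (ih fun q hq => h q (by simp [hq])))

end Splits

/-! ### Calculus of iterated partial derivatives along words. -/

section WordDeriv

variable {d : ℕ}

/-- The iterated partial derivative along a word of coordinates, the last letter acting first. -/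
noncomputable def wordDeriv (w : List (Fin d)) (f : Euc d → ℝ) : Euc d → ℝ :=
  w.foldr partialDeriv f

/-- All partial derivatives along words of length less than `n` are differentiable on `Θ`. -/
def WordDiffOn (n : ℕ) (f : Euc d → ℝ) (Θ : Set (Euc d)) : Prop :=
  ∀ w : List (Fin d), w.length < n → ∀ θ ∈ Θ, DifferentiableAt ℝ (wordDeriv w f) θ

@[simp] theorem wordDeriv_nil (f : Euc d → ℝ) : wordDeriv [] f = f := rfl

@[simp] theorem wordDeriv_cons (i : Fin d) (w : List (Fin d)) (f : Euc d → ℝ) :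
    wordDeriv (i :: w) f = partialDeriv i (wordDeriv w f) := rfl

theorem wordDeriv_append (w v : List (Fin d)) (f : Euc d → ℝ) :
    wordDeriv (w ++ v) f = wordDeriv w (wordDeriv v f) := by
  simp [wordDeriv]

theorem partialDeriv_eq_fderiv {f : Euc d → ℝ} {θ : Euc d} (h : DifferentiableAt ℝ f θ)
    (i : Fin d) : partialDeriv i f θ = fderiv ℝ f θ (EuclideanSpace.single i 1) :=
  h.lineDeriv_eq_fderiv

variable {Θ : Set (Euc d)} {f g : Euc d → ℝ} {n : ℕ}

theorem eventuallyEq_of_eqOn (hΘ : IsOpen Θ) (h : Set.EqOn f g Θ) {θ : Euc d} (hθ : θ ∈ Θ) :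
    f =ᶠ[𝓝 θ] g :=
  Filter.eventuallyEq_of_mem (hΘ.mem_nhds hθ) h

theorem partialDeriv_congr (hΘ : IsOpen Θ) (h : Set.EqOn f g Θ) (i : Fin d) :
    Set.EqOn (partialDeriv i f) (partialDeriv i g) Θ :=
  fun _ hθ => (eventuallyEq_of_eqOn hΘ h hθ).lineDeriv_eq

theorem wordDeriv_congr (hΘ : IsOpen Θ) (h : Set.EqOn f g Θ) (w : List (Fin d)) :
    Set.EqOn (wordDeriv w f) (wordDeriv w g) Θ := by
  induction w with
  | nil => exact h
  | cons i w ih => exact partialDeriv_congr hΘ ih i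

theorem WordDiffOn.congr (hf : WordDiffOn n f Θ) (hΘ : IsOpen Θ) (h : Set.EqOn f g Θ) :
    WordDiffOn n g Θ := fun w hw θ hθ =>
  (hf w hw θ hθ).congr_of_eventuallyEq
    (eventuallyEq_of_eqOn hΘ (wordDeriv_congr hΘ h w) hθ).symm

theorem WordDiffOn.mono {m : ℕ} (hf : WordDiffOn n f Θ) (h : m ≤ n) : WordDiffOn m f Θ :=
  fun w hw => hf w (hw.trans_le h)

theorem wordDiffOn_wordDeriv {m : ℕ} {w : List (Fin d)} (hf : WordDiffOn n f Θ)
    (h : w.length + m ≤ n) : WordDiffOn m (wordDeriv w f) Θ := by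
  intro v hv θ hθ
  rw [← wordDeriv_append]
  exact hf _ (by simp; omega) θ hθ

theorem WordDiffOn.differentiableAt (hf : WordDiffOn n f Θ) (hn : 0 < n) {θ : Euc d}
    (hθ : θ ∈ Θ) : DifferentiableAt ℝ f θ := hf [] hn θ hθ

theorem wordDiffOn_succ : WordDiffOn (n + 1) f Θ ↔
    (∀ θ ∈ Θ, DifferentiableAt ℝ f θ) ∧ ∀ i, WordDiffOn n (partialDeriv i f) Θ := by
  constructor
  · intro h
    exact ⟨fun θ hθ => h.differentiableAt (Nat.succ_pos _) hθ,
      fun i => wordDiffOn_wordDeriv h (w := [i]) (by simp; omega)⟩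
  · rintro ⟨h0, h1⟩ w hw θ hθ
    -- The last letter acts first, so the word is split at its end.
    rcases List.eq_nil_or_concat w with rfl | ⟨v, i, rfl⟩
    · exact h0 θ hθ
    · simp only [List.concat_eq_append, wordDeriv_append]
      exact h1 i v (by simpa using hw) θ hθ

theorem wordDeriv_const {w : List (Fin d)} (hw : w ≠ []) (c : ℝ) :
    wordDeriv w (fun _ : Euc d => c) = fun _ => 0 := by
  have h : ∀ (i : Fin d) (c : ℝ), partialDeriv i (fun _ : Euc d => c) = fun _ => 0 := by
    intro i c; funext θ
    rw [partialDeriv_eq_fderiv (by fun_prop)]; simp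
  induction w with
  | nil => exact absurd rfl hw
  | cons i w ih =>
    rcases eq_or_ne w [] with rfl | h'
    · simp [h]
    · rw [wordDeriv_cons, ih h', h]

theorem wordDiffOn_const (c : ℝ) : WordDiffOn n (fun _ : Euc d => c) Θ := by
  intro w _ θ _
  rcases eq_or_ne w [] with rfl | h
  · simp
  · rw [wordDeriv_const h]; fun_prop

theorem wordDeriv_sub (hΘ : IsOpen Θ) (hf : WordDiffOn n f Θ) (hg : WordDiffOn n g Θ)
    (w : List (Fin d)) (hw : w.length ≤ n) :
    Set.EqOn (wordDeriv w (fun t => f t - g t)) (fun t => wordDeriv w f t - wordDeriv w g t) Θ := by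
  induction w with
  | nil => intro t _; rfl
  | cons i w ih =>
    intro θ hθ
    rw [wordDeriv_cons, partialDeriv_congr hΘ (ih (by simp at hw; omega)) i hθ]
    have h1 := hf w (by simpa using hw) θ hθ
    have h2 := hg w (by simpa using hw) θ hθ
    rw [partialDeriv_eq_fderiv (h1.fun_sub h2), fderiv_fun_sub h1 h2]
    simp [partialDeriv_eq_fderiv h1, partialDeriv_eq_fderiv h2]

theorem WordDiffOn.sub (hΘ : IsOpen Θ) (hf : WordDiffOn n f Θ) (hg : WordDiffOn n g Θ) :
    WordDiffOn n (fun t => f t - g t) Θ := fun w hw θ hθ =>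
  ((hf w hw θ hθ).fun_sub (hg w hw θ hθ)).congr_of_eventuallyEq
    (eventuallyEq_of_eqOn hΘ (wordDeriv_sub hΘ hf hg w hw.le) hθ)

theorem hasFDerivAt_list_sum {β : Type*} (l : List β) (F : β → Euc d → ℝ) {θ : Euc d}
    (h : ∀ q ∈ l, DifferentiableAt ℝ (F q) θ) :
    HasFDerivAt (fun t => (l.map fun q => F q t).sum)
      ((l.map fun q => fderiv ℝ (F q) θ).sum) θ := by
  induction l with
  | nil => simpa using hasFDerivAt_const (0 : ℝ) θ
  | cons a l ih =>
    simp only [List.map_cons, List.sum_cons]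
    exact (h a (by simp)).hasFDerivAt.add (ih fun q hq => h q (by simp [hq]))

theorem partialDeriv_list_sum {β : Type*} (l : List β) (F : β → Euc d → ℝ) {θ : Euc d}
    (h : ∀ q ∈ l, DifferentiableAt ℝ (F q) θ) (i : Fin d) :
    partialDeriv i (fun t => (l.map fun q => F q t).sum) θ =
      (l.map fun q => partialDeriv i (F q) θ).sum := by
  have h1 := hasFDerivAt_list_sum l F h
  rw [partialDeriv_eq_fderiv h1.differentiableAt, h1.fderiv]
  clear h1
  induction l with
  | nil => simp
  | cons a l ih =>
    simp only [List.map_cons, List.sum_cons, add_apply]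
    rw [ih fun q hq => h q (by simp [hq]), partialDeriv_eq_fderiv (h a (by simp))]

theorem partialDeriv_mul {θ : Euc d} (hf : DifferentiableAt ℝ f θ) (hg : DifferentiableAt ℝ g θ)
    (i : Fin d) : partialDeriv i (fun t => f t * g t) θ =
      partialDeriv i f θ * g θ + f θ * partialDeriv i g θ := by
  rw [partialDeriv_eq_fderiv (hf.fun_mul hg), fderiv_fun_mul hf hg]
  simp [partialDeriv_eq_fderiv hf, partialDeriv_eq_fderiv hg]
  ring

/-- The Leibniz rule. -/
theorem wordDeriv_mul (hΘ : IsOpen Θ) (hf : WordDiffOn n f Θ) (hg : WordDiffOn n g Θ)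
    (w : List (Fin d)) (hw : w.length ≤ n) :
    Set.EqOn (wordDeriv w (fun t => f t * g t))
      (fun t => ((splits w).map fun q => wordDeriv q.1 f t * wordDeriv q.2 g t).sum) Θ := by
  induction w with
  | nil => intro t _; simp [splits]
  | cons i w ih =>
    intro θ hθ
    rw [wordDeriv_cons, partialDeriv_congr hΘ (ih (by simp at hw; omega)) i hθ]
    simp only [List.length_cons] at hw
    have hd1 : ∀ q ∈ splits w, DifferentiableAt ℝ (wordDeriv q.1 f) θ := fun q hq =>
      hf _ (by have := length_of_mem_splits hq; omega) θ hθ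
    have hd2 : ∀ q ∈ splits w, DifferentiableAt ℝ (wordDeriv q.2 g) θ := fun q hq =>
      hg _ (by have := length_of_mem_splits hq; omega) θ hθ
    rw [partialDeriv_list_sum (splits w) (fun q t => wordDeriv q.1 f t * wordDeriv q.2 g t)
      (fun q hq => (hd1 q hq).fun_mul (hd2 q hq))]
    simp only [splits, List.map_append, List.map_map, List.sum_append]
    rw [← List.sum_map_add]
    congr 1
    apply List.map_congr_left
    intro q hq
    rw [partialDeriv_mul (hd1 q hq) (hd2 q hq)]
    rfl

theorem WordDiffOn.mul (hΘ : IsOpen Θ) (hf : WordDiffOn n f Θ) (hg : WordDiffOn n g Θ) :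
    WordDiffOn n (fun t => f t * g t) Θ := by
  intro w hw θ hθ
  refine DifferentiableAt.congr_of_eventuallyEq ?_
    (eventuallyEq_of_eqOn hΘ (wordDeriv_mul hΘ hf hg w hw.le) hθ)
  refine (hasFDerivAt_list_sum (splits w) (fun q t => wordDeriv q.1 f t * wordDeriv q.2 g t)
    fun q hq => ?_).differentiableAt
  have := length_of_mem_splits hq
  exact (hf _ (by omega) θ hθ).fun_mul (hg _ (by omega) θ hθ)

/-- Induction on the order through `∂ᵢ f⁻¹ = -(∂ᵢ f) f⁻¹ f⁻¹`, whose right side involves `f⁻¹` only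
to one order less. -/
theorem WordDiffOn.inv (hΘ : IsOpen Θ) (hf : WordDiffOn n f Θ) (h0 : ∀ θ ∈ Θ, f θ ≠ 0) :
    WordDiffOn n (fun t => (f t)⁻¹) Θ := by
  induction n with
  | zero => intro w hw; simp at hw
  | succ n ih =>
    obtain ⟨h1, h2⟩ := wordDiffOn_succ.1 hf
    refine wordDiffOn_succ.2 ⟨fun θ hθ => (h1 θ hθ).fun_inv (h0 θ hθ), fun i => ?_⟩
    have h3 := ih (hf.mono (Nat.le_succ n))
    have h4 := (((wordDiffOn_const (-1)).mul hΘ (h2 i)).mul hΘ h3).mul hΘ h3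
    refine h4.congr hΘ fun θ hθ => ?_
    have h5 : HasFDerivAt (fun t => (f t)⁻¹) (-(f θ ^ 2)⁻¹ • fderiv ℝ f θ) θ :=
      (hasDerivAt_inv (h0 θ hθ)).comp_hasFDerivAt θ (h1 θ hθ).hasFDerivAt
    rw [partialDeriv_eq_fderiv h5.differentiableAt, h5.fderiv]
    simp [partialDeriv_eq_fderiv (h1 θ hθ)]
    ring

theorem partialDeriv_log {θ : Euc d} (hf : DifferentiableAt ℝ f θ) (h0 : f θ ≠ 0) (i : Fin d) :
    partialDeriv i (fun t => Real.log (f t)) θ = (f θ)⁻¹ * partialDeriv i f θ := by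
  have h5 := hf.hasFDerivAt.log h0
  rw [partialDeriv_eq_fderiv h5.differentiableAt, h5.fderiv]
  simp [partialDeriv_eq_fderiv hf]

theorem WordDiffOn.log (hΘ : IsOpen Θ) (hf : WordDiffOn n f Θ) (h0 : ∀ θ ∈ Θ, f θ ≠ 0) :
    WordDiffOn n (fun t => Real.log (f t)) Θ := by
  cases n with
  | zero => intro w hw; simp at hw
  | succ n =>
    obtain ⟨h1, h2⟩ := wordDiffOn_succ.1 hf
    refine wordDiffOn_succ.2 ⟨fun θ hθ => (h1 θ hθ).log (h0 θ hθ), fun i => ?_⟩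
    refine (((hf.inv hΘ h0).mono (Nat.le_succ n)).mul hΘ (h2 i)).congr hΘ fun θ hθ => ?_
    rw [partialDeriv_log (h1 θ hθ) (h0 θ hθ)]

theorem fderiv_eq_sum (L : Euc d →L[ℝ] ℝ) :
    L = ∑ i, L (EuclideanSpace.single i 1) • EuclideanSpace.proj i := by
  ext v
  conv_lhs => rw [← (EuclideanSpace.basisFun (Fin d) ℝ).sum_repr v]
  simp [mul_comm]

/-- Symmetry of second partial derivatives. -/
theorem partialDeriv_comm (hΘ : IsOpen Θ) (hf : WordDiffOn 2 f Θ) (i j : Fin d) :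
    Set.EqOn (partialDeriv i (partialDeriv j f)) (partialDeriv j (partialDeriv i f)) Θ := by
  intro θ hθ
  obtain ⟨h1, h2⟩ := wordDiffOn_succ.1 hf
  -- Continuity of second derivatives is not available. Since all first partial derivatives are
  -- differentiable, so is the differential, a finite combination of them, and this suffices for
  -- symmetry.
  have hF : DifferentiableAt ℝ (fderiv ℝ f) θ := by
    have : fderiv ℝ f =ᶠ[𝓝 θ] fun t => ∑ i, partialDeriv i f t • EuclideanSpace.proj i := by
      refine Filter.eventuallyEq_of_mem (hΘ.mem_nhds hθ) fun t ht => ?_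
      beta_reduce
      conv_lhs => rw [fderiv_eq_sum (fderiv ℝ f t)]
      simp [partialDeriv_eq_fderiv (h1 t ht)]
    refine DifferentiableAt.congr_of_eventuallyEq ?_ this
    refine DifferentiableAt.fun_sum fun i _ => ?_
    exact ((h2 i).differentiableAt one_pos hθ).smul_const _
  have hs := second_derivative_symmetric_of_eventually (𝕜 := ℝ)
    (Filter.eventually_of_mem (hΘ.mem_nhds hθ) fun t ht => (h1 t ht).hasFDerivAt) hF.hasFDerivAt
    (EuclideanSpace.single i 1) (EuclideanSpace.single j 1)
  have key : ∀ i j : Fin d, partialDeriv i (partialDeriv j f) θ =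
      fderiv ℝ (fderiv ℝ f) θ (EuclideanSpace.single i 1) (EuclideanSpace.single j 1) := by
    intro i j
    have e : Set.EqOn (partialDeriv j f)
        (fun t => fderiv ℝ f t (EuclideanSpace.single j 1)) Θ :=
      fun t ht => partialDeriv_eq_fderiv (h1 t ht) j
    rw [partialDeriv_congr hΘ e i hθ]
    have hh : HasFDerivAt (fun t => fderiv ℝ f t (EuclideanSpace.single j 1))
        ((fderiv ℝ (fderiv ℝ f) θ).flip (EuclideanSpace.single j 1)) θ := by
      simpa using hF.hasFDerivAt.clm_apply (hasFDerivAt_const (EuclideanSpace.single j (1:ℝ)) θ)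
    rw [partialDeriv_eq_fderiv hh.differentiableAt, hh.fderiv]
    rfl
  rw [key, key, hs]

theorem wordDeriv_perm (hΘ : IsOpen Θ) (hf : WordDiffOn n f Θ) {w v : List (Fin d)}
    (h : w.Perm v) (hw : w.length ≤ n) : Set.EqOn (wordDeriv w f) (wordDeriv v f) Θ := by
  induction h with
  | nil => intro _ _; rfl
  | cons i _ ih => exact partialDeriv_congr hΘ (ih (by simp at hw; omega)) i
  | swap i j l =>
    exact partialDeriv_comm hΘ (wordDiffOn_wordDeriv hf (w := l) (by simp only [List.length_cons] at hw; omega)) j i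
  | trans h1 _ ih1 ih2 => exact (ih1 hw).trans (ih2 (h1.length_eq ▸ hw))

theorem multiDeriv_eq_wordDeriv (α : Fin d → ℕ) (f : Euc d → ℝ) :
    multiDeriv α f =
      wordDeriv ((List.finRange d).flatMap fun i => List.replicate (α i) i) f := by
  have hr : ∀ (k : ℕ) (i : Fin d) (g : Euc d → ℝ),
      (partialDeriv i)^[k] g = wordDeriv (List.replicate k i) g := by
    intro k i g
    induction k with
    | zero => rfl
    | succ k ih => rw [Function.iterate_succ_apply', ih]; rfl
  unfold multiDeriv
  induction List.finRange d with
  | nil => rfl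
  | cons i l ih =>
    rw [List.foldr_cons, List.flatMap_cons, wordDeriv_append, ← ih, hr]

/-- The word and the sorted word with the same letter counts are permutations of each other, and
partial derivatives commute. This carries the score bound from multi-indices to arbitrary words. -/
theorem wordDeriv_eq_multiDeriv (hΘ : IsOpen Θ) (hf : WordDiffOn n f Θ) {w : List (Fin d)}
    (hw : w.length ≤ n) :
    Set.EqOn (wordDeriv w f) (multiDeriv (fun i => w.count i) f) Θ := by
  rw [multiDeriv_eq_wordDeriv]
  refine wordDeriv_perm hΘ hf ?_ hw
  rw [List.perm_iff_count]
  intro a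
  rw [List.count_flatMap]
  simp only [Function.comp_def, List.count_replicate]
  rw [← Fin.sum_univ_def]
  simp

end WordDeriv


/-! ### Equivalence of Fréchet and wordwise differentiability. -/

section TimesDifferentiable

variable {d : ℕ} {Θ : Set (Euc d)} {f : Euc d → ℝ}

/-- The outermost derivative is both the first letter of the word and the first argument of the
multilinear map, so the two recursions match. -/
theorem wordDeriv_ofFn_eq_iteratedFDeriv (hΘ : IsOpen Θ) (k : ℕ)
    (h : ∀ j < k, ∀ θ ∈ Θ, DifferentiableAt ℝ (iteratedFDeriv ℝ j f) θ) (c : Fin k → Fin d) :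
    Set.EqOn (wordDeriv (List.ofFn c) f)
      (fun θ => iteratedFDeriv ℝ k f θ fun j => EuclideanSpace.single (c j) 1) Θ := by
  induction k with
  | zero => intro θ _; simp
  | succ k ih =>
    intro θ hθ
    rw [List.ofFn_succ, wordDeriv_cons,
      partialDeriv_congr hΘ (ih (fun j hj => h j (by omega)) fun i => c i.succ) (c 0) hθ]
    beta_reduce
    rw [iteratedFDeriv_succ_apply_left]
    have hd := h k (Nat.lt_succ_self k) θ hθ
    have hh : HasFDerivAt
        (fun t => iteratedFDeriv ℝ k f t fun j => EuclideanSpace.single (c j.succ) (1 : ℝ))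
        ((ContinuousMultilinearMap.apply ℝ (fun _ : Fin k => Euc d) ℝ
          fun j => EuclideanSpace.single (c j.succ) (1 : ℝ)).comp
          (fderiv ℝ (iteratedFDeriv ℝ k f) θ)) θ :=
      (ContinuousMultilinearMap.apply ℝ (fun _ : Fin k => Euc d) ℝ
          fun j => EuclideanSpace.single (c j.succ) (1 : ℝ)).hasFDerivAt.comp θ hd.hasFDerivAt
    rw [partialDeriv_eq_fderiv hh.differentiableAt, hh.fderiv]
    rfl

theorem multilinear_eq_sum {k : ℕ} (M : ContinuousMultilinearMap ℝ (fun _ : Fin k => Euc d) ℝ) :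
    M = ∑ c : Fin k → Fin d, (M fun j => EuclideanSpace.single (c j) 1) •
      (ContinuousMultilinearMap.mkPiAlgebra ℝ (Fin k) ℝ).compContinuousLinearMap
        (fun j => (EuclideanSpace.proj (c j) : Euc d →L[ℝ] ℝ)) := by
  apply ContinuousMultilinearMap.toMultilinearMap_injective
  refine Module.Basis.ext_multilinear
    (fun _ => (EuclideanSpace.basisFun (Fin d) ℝ).toBasis) fun v => ?_
  simp only [OrthonormalBasis.coe_toBasis, EuclideanSpace.basisFun_apply,
    ContinuousMultilinearMap.coe_coe]
  rw [sum_apply, Finset.sum_eq_single v]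
  · simp
  · intro c _ hc
    obtain ⟨j, hj⟩ := Function.ne_iff.1 hc
    simp only [smul_apply,
      ContinuousMultilinearMap.compContinuousLinearMap_apply,
      ContinuousMultilinearMap.mkPiAlgebra_apply, smul_eq_mul, mul_eq_zero]
    right
    exact Finset.prod_eq_zero (Finset.mem_univ j) (by simp [hj])
  · simp

theorem TimesDifferentiableOn.wordDiffOn {p : ℕ} (hΘ : IsOpen Θ)
    (h : TimesDifferentiableOn p f Θ) : WordDiffOn p f Θ := by
  intro w hw θ hθ
  have e := wordDeriv_ofFn_eq_iteratedFDeriv hΘ w.length (fun j hj => h j (hj.trans hw)) w.get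
  rw [List.ofFn_get] at e
  refine DifferentiableAt.congr_of_eventuallyEq ?_ (eventuallyEq_of_eqOn hΘ e hθ)
  exact (ContinuousMultilinearMap.apply ℝ (fun _ : Fin w.length => Euc d) ℝ
    fun j => EuclideanSpace.single (w.get j) (1 : ℝ)).differentiableAt.comp θ (h _ hw θ hθ)

/-- In the basis expansion of the `k`-th derivative the coefficients are word derivatives, once the
lower orders are known to be differentiable; hence the strong induction. -/
theorem WordDiffOn.timesDifferentiableOn {p : ℕ} (hΘ : IsOpen Θ)
    (h : WordDiffOn p f Θ) : TimesDifferentiableOn p f Θ := by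
  intro k
  induction k using Nat.strong_induction_on with
  | _ k ih =>
    intro hk θ hθ
    have e := wordDeriv_ofFn_eq_iteratedFDeriv hΘ k (fun j hj => ih j hj (hj.trans hk))
    have : iteratedFDeriv ℝ k f =ᶠ[𝓝 θ] fun t => ∑ c : Fin k → Fin d,
        wordDeriv (List.ofFn c) f t •
        (ContinuousMultilinearMap.mkPiAlgebra ℝ (Fin k) ℝ).compContinuousLinearMap
        (fun j => (EuclideanSpace.proj (c j) : Euc d →L[ℝ] ℝ)) := by
      refine Filter.eventuallyEq_of_mem (hΘ.mem_nhds hθ) fun t ht => ?_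
      beta_reduce
      rw [multilinear_eq_sum (iteratedFDeriv ℝ k f t)]
      exact Finset.sum_congr rfl fun c _ => by rw [e c ht]
    refine DifferentiableAt.congr_of_eventuallyEq ?_ this
    refine DifferentiableAt.fun_sum fun c _ => ?_
    exact (h _ (by simpa using hk) θ hθ).smul_const _

end TimesDifferentiable

/-! ### Derivatives under integrals and under uniform limits. -/

section Analysis

variable {d : ℕ} {Θ : Set (Euc d)}

theorem norm_fderiv_le (L : Euc d →L[ℝ] ℝ) {B : ℝ}
    (h : ∀ i, |L (EuclideanSpace.single i 1)| ≤ B) : ‖L‖ ≤ d * B := by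
  rw [fderiv_eq_sum L]
  refine (norm_sum_le _ _).trans ?_
  have : ∀ i ∈ Finset.univ, ‖L (EuclideanSpace.single i 1) •
      (EuclideanSpace.proj i : Euc d →L[ℝ] ℝ)‖ ≤ B := by
    intro i _
    rw [norm_smul]
    have h1 : ‖(EuclideanSpace.proj i : Euc d →L[ℝ] ℝ)‖ ≤ 1 := by
      refine ContinuousLinearMap.opNorm_le_bound _ zero_le_one fun x => ?_
      rw [one_mul]
      exact PiLp.norm_apply_le x i
    calc _ ≤ B * 1 := mul_le_mul (h i) h1 (norm_nonneg _) ((abs_nonneg _).trans (h i))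
      _ = B := mul_one B
  refine (Finset.sum_le_sum this).trans ?_
  simp

/-- The partial derivative is a pointwise limit of difference quotients along the steps `1 / (n +
1)`, each of which is measurable. -/
theorem measurable_partialDeriv {α : Type*} [MeasurableSpace α]
    (hΘ : IsOpen Θ) {F : Euc d → α → ℝ} (hF : ∀ θ ∈ Θ, Measurable (F θ))
    (hd : ∀ a, ∀ θ ∈ Θ, DifferentiableAt ℝ (F · a) θ) (i : Fin d) {θ : Euc d} (hθ : θ ∈ Θ) :
    Measurable (fun a => partialDeriv i (F · a) θ) := by
  have hlim : Tendsto (fun n : ℕ => θ + ((n : ℝ) + 1)⁻¹ • EuclideanSpace.single i (1 : ℝ))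
      atTop (𝓝 θ) := by
    have h1 : Tendsto (fun n : ℕ => ((n : ℝ) + 1)⁻¹) atTop (𝓝 0) := by
      simpa using tendsto_one_div_add_atTop_nhds_zero_nat (𝕜 := ℝ)
    have := (h1.smul_const (EuclideanSpace.single i (1 : ℝ))).const_add θ
    simpa using this
  -- Measurability is known only for parameters in `Θ`; from `N` on the shifted points lie there.
  obtain ⟨N, hN⟩ := eventually_atTop.1 (hlim.eventually (hΘ.mem_nhds hθ))
  refine measurable_of_tendsto_metrizable
    (f := fun (n : ℕ) a => (((n + N : ℕ) : ℝ) + 1) *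
      (F (θ + (((n + N : ℕ) : ℝ) + 1)⁻¹ • EuclideanSpace.single i (1 : ℝ)) a - F θ a)) ?_ ?_
  · intro n
    exact ((hF _ (hN (n + N) (by omega))).sub (hF θ hθ)).const_mul _
  · refine tendsto_pi_nhds.2 fun a => ?_
    have h2 : HasLineDerivAt ℝ (F · a) (partialDeriv i (F · a) θ) θ
        (EuclideanSpace.single i 1) := ((hd a θ hθ).lineDifferentiableAt).hasLineDerivAt
    have h3 := h2.tendsto_slope_zero_right
    have h4 : Tendsto (fun n : ℕ => (((n + N : ℕ) : ℝ) + 1)⁻¹) atTop (𝓝[>] 0) := by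
      refine tendsto_nhdsWithin_iff.2 ⟨?_, Filter.Eventually.of_forall fun n => ?_⟩
      · have := (tendsto_add_atTop_iff_nat N).2 (tendsto_one_div_add_atTop_nhds_zero_nat (𝕜 := ℝ))
        simpa using this
      · simp only [Set.mem_Ioi]; positivity
    refine (h3.comp h4).congr fun n => ?_
    simp

theorem measurable_wordDeriv {α : Type*} [MeasurableSpace α]
    (hΘ : IsOpen Θ) {n : ℕ} {F : Euc d → α → ℝ} (hF : ∀ θ ∈ Θ, Measurable (F θ))
    (hd : ∀ a, WordDiffOn n (F · a) Θ) (w : List (Fin d)) (hw : w.length ≤ n) {θ : Euc d}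
    (hθ : θ ∈ Θ) : Measurable (fun a => wordDeriv w (F · a) θ) := by
  induction w generalizing θ with
  | nil => exact hF θ hθ
  | cons i w ih =>
    simp only [List.length_cons] at hw
    exact measurable_partialDeriv hΘ (F := fun θ a => wordDeriv w (F · a) θ)
      (fun t ht => ih (by omega) ht) (fun a => hd a w (by omega)) i hθ

/-- Differentiation under the integral sign, for iterated partial derivatives. -/
theorem wordDeriv_integral {α : Type*} [MeasurableSpace α] {m : Measure α} (hΘ : IsOpen Θ)
    {n : ℕ} {F : Euc d → α → ℝ} (hF : ∀ θ ∈ Θ, Measurable (F θ))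
    (hd : ∀ a, WordDiffOn n (F · a) Θ) {B : α → ℝ} (hB : Integrable B m)
    (hbound : ∀ w : List (Fin d), w.length ≤ n → ∀ θ ∈ Θ, ∀ a, |wordDeriv w (F · a) θ| ≤ B a) :
    WordDiffOn n (fun θ => ∫ a, F θ a ∂m) Θ ∧ ∀ w : List (Fin d), w.length ≤ n → ∀ θ ∈ Θ,
      Integrable (fun a => wordDeriv w (F · a) θ) m ∧
      wordDeriv w (fun θ => ∫ a, F θ a ∂m) θ = ∫ a, wordDeriv w (F · a) θ ∂m := by
  have hmeas := fun (w : List (Fin d)) (hw : w.length ≤ n) θ (hθ : θ ∈ Θ) =>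
    (measurable_wordDeriv hΘ hF hd w hw hθ).aestronglyMeasurable (μ := m)
  have hint : ∀ w : List (Fin d), w.length ≤ n → ∀ θ ∈ Θ,
      Integrable (fun a => wordDeriv w (F · a) θ) m := fun w hw θ hθ =>
    hB.mono' (hmeas w hw θ hθ) (Filter.Eventually.of_forall fun a => hbound w hw θ hθ a)
  have hder : ∀ w : List (Fin d), w.length < n → ∀ θ ∈ Θ,
      HasFDerivAt (fun θ => ∫ a, wordDeriv w (F · a) θ ∂m)
        (∫ a, fderiv ℝ (wordDeriv w (F · a)) θ ∂m) θ ∧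
        Integrable (fun a => fderiv ℝ (wordDeriv w (F · a)) θ) m := by
    intro w hw θ hθ
    -- The differential is measurable because its finitely many coordinates, the partial
    -- derivatives, are.
    have hfm : AEStronglyMeasurable (fun a => fderiv ℝ (wordDeriv w (F · a)) θ) m := by
      have : (fun a => fderiv ℝ (wordDeriv w (F · a)) θ) = fun a => ∑ i,
          wordDeriv (i :: w) (F · a) θ • (EuclideanSpace.proj i : Euc d →L[ℝ] ℝ) := by
        funext a
        rw [fderiv_eq_sum (fderiv ℝ (wordDeriv w (F · a)) θ)]
        exact Finset.sum_congr rfl fun i _ => by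
          rw [← partialDeriv_eq_fderiv (hd a w hw θ hθ)]; rfl
      rw [this]
      exact Finset.aestronglyMeasurable_fun_sum _ fun i _ =>
        (hmeas (i :: w) hw θ hθ).smul_const _
    have hfb : ∀ a, ∀ t ∈ Θ, ‖fderiv ℝ (wordDeriv w (F · a)) t‖ ≤ d * B a := fun a t ht =>
      norm_fderiv_le _ fun i => by
        rw [← partialDeriv_eq_fderiv (hd a w hw t ht)]
        exact hbound (i :: w) hw t ht a
    refine ⟨hasFDerivAt_integral_of_dominated_of_fderiv_le
      (F := fun θ a => wordDeriv w (F · a) θ)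
      (F' := fun θ a => fderiv ℝ (wordDeriv w (F · a)) θ) (hΘ.mem_nhds hθ)
      (Filter.eventually_of_mem (hΘ.mem_nhds hθ) fun t ht => hmeas w hw.le t ht)
      (hint w hw.le θ hθ) hfm (Filter.Eventually.of_forall hfb) (hB.const_mul _)
      (Filter.Eventually.of_forall fun a t ht => (hd a w hw t ht).hasFDerivAt), ?_⟩
    exact (hB.const_mul _).mono' hfm (Filter.Eventually.of_forall fun a => hfb a θ hθ)
  have heq : ∀ w : List (Fin d), w.length ≤ n →
      Set.EqOn (wordDeriv w (fun θ => ∫ a, F θ a ∂m))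
        (fun θ => ∫ a, wordDeriv w (F · a) θ ∂m) Θ := by
    intro w
    induction w with
    | nil => exact fun _ θ _ => rfl
    | cons i w ih =>
      intro hw θ hθ
      simp only [List.length_cons] at hw
      obtain ⟨h1, h2⟩ := hder w (by omega) θ hθ
      rw [wordDeriv_cons, partialDeriv_congr hΘ (ih (by omega)) i hθ,
        partialDeriv_eq_fderiv h1.differentiableAt, h1.fderiv,
        ContinuousLinearMap.integral_apply h2]
      refine integral_congr_ae (Filter.Eventually.of_forall fun a => ?_)
      exact (partialDeriv_eq_fderiv (hd a w (by omega) θ hθ) i).symm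
  refine ⟨fun w hw θ hθ => ?_, fun w hw θ hθ => ⟨hint w hw θ hθ, heq w hw hθ⟩⟩
  exact (hder w hw θ hθ).1.differentiableAt.congr_of_eventuallyEq
    (eventuallyEq_of_eqOn hΘ (heq w hw.le) hθ)

/-- A sequence whose iterated partial derivatives converge uniformly has a limit which is as
often differentiable as its members. -/
theorem wordDiffOn_of_tendstoUniformlyOn (hΘ : IsOpen Θ) {n : ℕ} {F : ℕ → Euc d → ℝ}
    {G : List (Fin d) → Euc d → ℝ} (hF : ∀ k, WordDiffOn n (F k) Θ)
    (h : ∀ w : List (Fin d), w.length ≤ n →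
      TendstoUniformlyOn (fun k => wordDeriv w (F k)) (G w) atTop Θ) :
    WordDiffOn n (G []) Θ := by
  have hder : ∀ w : List (Fin d), w.length < n → ∀ θ ∈ Θ,
      HasFDerivAt (G w) (∑ i, G (i :: w) θ • (EuclideanSpace.proj i : Euc d →L[ℝ] ℝ)) θ := by
    intro w hw θ hθ
    refine hasFDerivAt_of_tendstoUniformlyOn (f := fun k => wordDeriv w (F k))
      (f' := fun k t => ∑ i, wordDeriv (i :: w) (F k) t • (EuclideanSpace.proj i : Euc d →L[ℝ] ℝ))
      (g' := fun t => ∑ i, G (i :: w) t • (EuclideanSpace.proj i : Euc d →L[ℝ] ℝ))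
      (l := atTop) hΘ ?_ ?_ (fun t ht => (h w hw.le).tendsto_at ht) hθ
    · rw [Metric.tendstoUniformlyOn_iff]
      intro ε hε
      -- The operator norm is at most `d` times the largest coordinate; `d + 1` in the denominator
      -- makes the final inequality strict and covers `d = 0`.
      have h1 : ∀ i : Fin d, ∀ᶠ k in atTop, ∀ t ∈ Θ,
          dist (G (i :: w) t) (wordDeriv (i :: w) (F k) t) < ε / (d + 1) := fun i =>
        Metric.tendstoUniformlyOn_iff.1 (h (i :: w) hw) _ (by positivity)
      filter_upwards [eventually_all.2 h1] with k hk t ht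
      rw [dist_eq_norm, ← Finset.sum_sub_distrib]
      simp_rw [← sub_smul]
      have h2 := norm_fderiv_le (∑ i, (G (i :: w) t - wordDeriv (i :: w) (F k) t) •
        (EuclideanSpace.proj i : Euc d →L[ℝ] ℝ)) (B := ε / (d + 1)) fun j => by
          have := (hk j t ht).le
          rw [Real.dist_eq] at this
          simpa [sum_apply] using this
      refine h2.trans_lt ?_
      rw [mul_div_assoc', div_lt_iff₀ (by positivity)]
      nlinarith
    · intro k t ht
      have h1 := (hF k w hw t ht).hasFDerivAt
      rw [fderiv_eq_sum (fderiv ℝ _ t)] at h1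
      simpa only [wordDeriv_cons, partialDeriv_eq_fderiv (hF k w hw t ht)] using h1
  have heq : ∀ w : List (Fin d), w.length ≤ n → Set.EqOn (wordDeriv w (G [])) (G w) Θ := by
    intro w
    induction w with
    | nil => exact fun _ _ _ => rfl
    | cons i w ih =>
      intro hw θ hθ
      simp only [List.length_cons] at hw
      have h1 := hder w (by omega) θ hθ
      rw [wordDeriv_cons, partialDeriv_congr hΘ (ih (by omega)) i hθ,
        partialDeriv_eq_fderiv h1.differentiableAt, h1.fderiv]
      simp
  exact fun w hw θ hθ => (hder w hw θ hθ).differentiableAt.congr_of_eventuallyEq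
    (eventuallyEq_of_eqOn hΘ (heq w hw.le) hθ)

end Analysis

/-! ### Geometric derivative bounds for products and quotients. -/

section Bounds

variable {d : ℕ} {Θ : Set (Euc d)} {f g Q : Euc d → ℝ} {n : ℕ}

theorem abs_wordDeriv_mul_le (hΘ : IsOpen Θ) (hf : WordDiffOn n f Θ) (hg : WordDiffOn n g Θ)
    {θ : Euc d} (hθ : θ ∈ Θ) {a b F G : ℝ} (hF : 0 ≤ F) (ha : 0 ≤ a)
    (h1 : ∀ w : List (Fin d), w.length ≤ n → |wordDeriv w f θ| ≤ a ^ w.length * F)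
    (h2 : ∀ w : List (Fin d), w.length ≤ n → |wordDeriv w g θ| ≤ b ^ w.length * G)
    (w : List (Fin d)) (hw : w.length ≤ n) :
    |wordDeriv w (fun t => f t * g t) θ| ≤ (a + b) ^ w.length * (F * G) := by
  rw [wordDeriv_mul hΘ hf hg w hw hθ, ← sum_splits_pow, ← List.sum_map_mul_right]
  refine abs_sum_map_le _ _ _ fun q hq => ?_
  have hl := length_of_mem_splits hq
  rw [abs_mul]
  calc _ ≤ (a ^ q.1.length * F) * (b ^ q.2.length * G) :=
        mul_le_mul (h1 _ (by omega)) (h2 _ (by omega)) (abs_nonneg _) (by positivity)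
    _ = _ := by ring

/-- The sum over the proper splits of a word, estimated through its degree. -/
theorem sum_properSplits_le {α : Type*} (w : List α) {K : ℝ} (hK : 1 ≤ K) :
    ((properSplits w).map fun q : List α × List α => K ^ q.2.length).sum * K ≤
      2 ^ w.length * K ^ w.length := by
  rw [← List.sum_map_mul_right]
  have h1 : ((properSplits w).map fun q : List α × List α => K ^ q.2.length * K).sum ≤
      ((properSplits w).map fun q : List α × List α => 1 * K ^ w.length).sum := by
    refine List.sum_le_sum fun q hq => ?_
    have h2 := length_of_mem_splits (mem_splits_of_mem_properSplits hq)
    -- At least one letter lies in the first component, which pays for the additional factor `K`.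
    have h3 := List.length_pos_iff.2 (fst_ne_nil_of_mem_properSplits hq)
    rw [one_mul, ← pow_succ]
    exact pow_le_pow_right₀ hK (by omega)
  refine h1.trans ?_
  rw [List.sum_map_mul_right]
  refine mul_le_mul_of_nonneg_right ?_ (by positivity)
  -- The binomial identity at `1 + 1` counts the splits: there are `2 ^ w.length` of them.
  have h4 := sum_splits w (fun _ => (1 : ℝ))
  have h5 := sum_splits_pow w (1 : ℝ) 1
  simp only [one_pow, mul_one] at h5
  rw [h4] at h5
  have : (1 : ℝ) + 1 = 2 := by norm_num
  rw [this] at h5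
  linarith

/-- Bounds for the derivatives of a quotient `Q = g / f`. -/
theorem abs_wordDeriv_div_le (hΘ : IsOpen Θ) (hf : WordDiffOn n f Θ) (hQ : WordDiffOn n Q Θ)
    (hfQ : Set.EqOn (fun t => f t * Q t) g Θ)
    {θ : Euc d} (hθ : θ ∈ Θ) {a G : ℝ} (hf0 : 0 < f θ) (hG : 0 ≤ G) (ha : 0 ≤ a)
    (h1 : ∀ w : List (Fin d), w.length ≤ n → |wordDeriv w f θ| ≤ a ^ w.length * f θ)
    (h2 : ∀ w : List (Fin d), w.length ≤ n → |wordDeriv w g θ| ≤ a ^ w.length * G)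
    (w : List (Fin d)) (hw : w.length ≤ n) :
    |wordDeriv w Q θ| ≤ ((1 + 2 ^ n) * a) ^ w.length * (G / f θ) := by
  obtain ⟨k, hk⟩ : ∃ k, w.length = k := ⟨_, rfl⟩
  induction k using Nat.strong_induction_on generalizing w with
  | _ k ih =>
    -- Leibniz for `f * Q = g` is solved for the top derivative of `Q`. In units of `a ^ |w| * G`
    -- this costs `1` for `g` and at most `2 ^ n * D ^ (|w| - 1)` for the proper splits, so `D = 1 +
    -- 2 ^ n` closes the recursion when `w` is nonempty.
    set D : ℝ := 1 + 2 ^ n with hD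
    have hD1 : 1 ≤ D := by rw [hD]; linarith [show (0 : ℝ) ≤ 2 ^ n by positivity]
    have e := wordDeriv_mul hΘ hf hQ w hw hθ
    rw [wordDeriv_congr hΘ hfQ w hθ] at e
    beta_reduce at e
    rw [sum_splits] at e
    simp only [wordDeriv_nil] at e
    have hs : |((properSplits w).map fun q => wordDeriv q.1 f θ * wordDeriv q.2 Q θ).sum| ≤
        ((properSplits w).map fun q : List (Fin d) × List (Fin d) =>
          D ^ q.2.length * (a ^ w.length * G)).sum := by
      refine abs_sum_map_le _ _ _ fun q hq => ?_
      have h3 := length_of_mem_splits (mem_splits_of_mem_properSplits hq)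
      have h4 := List.length_pos_iff.2 (fst_ne_nil_of_mem_properSplits hq)
      rw [abs_mul]
      calc _ ≤ (a ^ q.1.length * f θ) * ((D * a) ^ q.2.length * (G / f θ)) :=
            mul_le_mul (h1 _ (by omega)) (ih q.2.length (by omega) _ (by omega) rfl)
              (abs_nonneg _) (by positivity)
        _ = D ^ q.2.length * (a ^ w.length * G) := by
            rw [← h3, mul_pow, pow_add]
            field_simp
    rw [List.sum_map_mul_right] at hs
    have h5 : f θ * |wordDeriv w Q θ| ≤ (1 + ((properSplits w).map
        fun q : List (Fin d) × List (Fin d) => D ^ q.2.length).sum) * (a ^ w.length * G) := by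
      rw [← abs_of_pos hf0, ← abs_mul, eq_sub_of_add_eq e.symm]
      refine (abs_sub _ _).trans ?_
      have := h2 w hw
      linarith
    have h6 : 1 + ((properSplits w).map
        fun q : List (Fin d) × List (Fin d) => D ^ q.2.length).sum ≤ D ^ w.length := by
      rcases w with _ | ⟨i, w⟩
      · simp [properSplits]
      · have h7 := sum_properSplits_le (i :: w) hD1
        have h8 : (2 : ℝ) ^ (i :: w).length ≤ 2 ^ n := pow_le_pow_right₀ (by norm_num) hw
        have h9 : (1 : ℝ) ≤ D ^ w.length := one_le_pow₀ hD1
        simp only [List.length_cons, pow_succ D] at h7 ⊢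
        have h10 : ((properSplits (i :: w)).map
          fun q : List (Fin d) × List (Fin d) => D ^ q.2.length).sum ≤ 2 ^ n * D ^ w.length := by
          refine le_of_mul_le_mul_right ?_ (by linarith : 0 < D)
          refine h7.trans ?_
          rw [← mul_assoc]
          exact mul_le_mul_of_nonneg_right (mul_le_mul_of_nonneg_right h8 (by positivity))
            (by linarith)
        rw [hD] at h10 ⊢
        rw [hD] at h9
        linarith
    rw [mul_pow, mul_div_assoc', le_div_iff₀ hf0, mul_comm]
    refine h5.trans ?_
    rw [mul_assoc]
    exact mul_le_mul_of_nonneg_right h6 (by positivity)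

end Bounds


/-! ### Conditional likelihoods, posterior kernels and predictive likelihoods. -/

section

variable {𝒳 𝒴 : Type*} [MeasurableSpace 𝒳] [MeasurableSpace 𝒴] {d : ℕ}

/-- The properties of the kernels `r_θ(y,x'|x)` from which the smoothness of the limiting average
log-likelihood is derived. -/
structure IsRegularFamily (p : ℕ) (Θ : Set (Euc d)) (μ : Measure 𝒳)
    (r : Euc d → 𝒴 → 𝒳 → 𝒳 → ℝ) (κ : ℝ) (ψ φ : 𝒴 → ℝ) (Φ : 𝒴 → 𝒳 → ℝ) : Prop where
  isOpen : IsOpen Θ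
  sfinite : SFinite μ
  measurable : ∀ θ ∈ Θ, Measurable fun z : 𝒴 × 𝒳 × 𝒳 => r θ z.1 z.2.1 z.2.2
  nonneg : ∀ θ ∈ Θ, ∀ y x' x, 0 ≤ r θ y x' x
  smooth : ∀ y x' x, WordDiffOn p (fun t => r t y x' x) Θ
  one_le_score : ∀ y, 1 ≤ ψ y
  score : ∀ θ ∈ Θ, ∀ y x' x, ∀ w : List (Fin d), w.length ≤ p →
    |wordDeriv w (fun t => r t y x' x) θ| ≤ ψ y ^ w.length * r θ y x' x
  dominated : ∀ θ ∈ Θ, ∀ y x' x, r θ y x' x ≤ Φ y x'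
  integrable : ∀ y, Integrable (Φ y) μ
  one_le : 1 ≤ κ
  mixing : ∀ θ ∈ Θ, ∀ y x z, ∀ᵐ x' ∂μ, r θ y x' x ≤ κ * r θ y x' z
  mass_lower : ∀ θ ∈ Θ, ∀ y x, Real.exp (-φ y) / κ ≤ ∫ x', r θ y x' x ∂μ
  mass_upper : ∀ θ ∈ Θ, ∀ y x, ∫ x', r θ y x' x ∂μ ≤ κ * Real.exp (φ y)

/-- The conditional likelihood of the observations `ys`, given the initial state. -/
noncomputable def condLik (μ : Measure 𝒳) (r : Euc d → 𝒴 → 𝒳 → 𝒳 → ℝ) (θ : Euc d) :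
    List 𝒴 → 𝒳 → ℝ
  | [], _ => 1
  | y :: ys, x => ∫ x', r θ y x' x * condLik μ r θ ys x' ∂μ

/-- The conditional density of the next state, given the current one and all observations. -/
noncomputable def postKer (μ : Measure 𝒳) (r : Euc d → 𝒴 → 𝒳 → 𝒳 → ℝ) (θ : Euc d)
    (y : 𝒴) (ys : List 𝒴) (x x' : 𝒳) : ℝ :=
  r θ y x' x * condLik μ r θ ys x' / condLik μ r θ (y :: ys) x

/-- The predictive likelihood of the observation `b`, given the earlier observations `ys` and the
initial state. -/
noncomputable def predLik (μ : Measure 𝒳) (r : Euc d → 𝒴 → 𝒳 → 𝒳 → ℝ) (θ : Euc d)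
    (ys : List 𝒴) (b : 𝒴) (x : 𝒳) : ℝ :=
  condLik μ r θ (ys ++ [b]) x / condLik μ r θ ys x

variable {p : ℕ} {Θ : Set (Euc d)} {μ : Measure 𝒳} {r : Euc d → 𝒴 → 𝒳 → 𝒳 → ℝ} {κ : ℝ}
  {ψ φ : 𝒴 → ℝ} {Φ : 𝒴 → 𝒳 → ℝ}

omit [MeasurableSpace 𝒴] in
theorem condLik_cons (θ : Euc d) (y : 𝒴) (ys : List 𝒴) (x : 𝒳) :
    condLik μ r θ (y :: ys) x = ∫ x', r θ y x' x * condLik μ r θ ys x' ∂μ := rfl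

namespace IsRegularFamily

/-- The observations are random variables here, so that measurability jointly in the sample point
and the state goes through the induction. Constants and coordinate maps are the cases used later. -/
theorem measurable_condLik_map (h : IsRegularFamily p Θ μ r κ ψ φ Φ) {θ : Euc d} (hθ : θ ∈ Θ)
    {Ω : Type*} [MeasurableSpace Ω] (Ys : List (Ω → 𝒴)) (hY : ∀ Y ∈ Ys, Measurable Y) :
    Measurable fun z : Ω × 𝒳 => condLik μ r θ (Ys.map fun Y => Y z.1) z.2 := by
  have := h.sfinite
  induction Ys with
  | nil => exact measurable_const
  | cons Y Ys ih =>
    have ih' := ih fun Z hZ => hY Z (by simp [hZ])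
    have hYm := hY Y (by simp)
    simp only [List.map_cons, condLik_cons]
    refine (StronglyMeasurable.integral_prod_right' (f := fun z : (Ω × 𝒳) × 𝒳 =>
      r θ (Y z.1.1) z.2 z.1.2 * condLik μ r θ (Ys.map fun Y => Y z.1.1) z.2) ?_).measurable
    refine Measurable.stronglyMeasurable (Measurable.mul ?_ ?_)
    · exact (h.measurable θ hθ).comp (g := fun z : 𝒴 × 𝒳 × 𝒳 => r θ z.1 z.2.1 z.2.2)
        (f := fun z : (Ω × 𝒳) × 𝒳 => (Y z.1.1, z.2, z.1.2)) (by fun_prop)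
    · exact ih'.comp (f := fun z : (Ω × 𝒳) × 𝒳 => (z.1.1, z.2)) (by fun_prop)

theorem measurable_condLik (h : IsRegularFamily p Θ μ r κ ψ φ Φ) {θ : Euc d} (hθ : θ ∈ Θ)
    (ys : List 𝒴) : Measurable (condLik μ r θ ys) := by
  have h1 := h.measurable_condLik_map hθ (Ω := Unit) (ys.map fun y _ => y) (by
    intro Y hY
    obtain ⟨y, _, rfl⟩ := List.mem_map.1 hY
    exact measurable_const)
  have h2 := h1.comp (measurable_prodMk_left (x := ()))
  simpa [Function.comp_def] using h2

theorem measurable_dens (h : IsRegularFamily p Θ μ r κ ψ φ Φ) {θ : Euc d} (hθ : θ ∈ Θ)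
    (y : 𝒴) (x : 𝒳) : Measurable fun x' => r θ y x' x :=
  (h.measurable θ hθ).comp (f := fun x' : 𝒳 => (y, x', x)) (by fun_prop)

theorem integrable_dens (h : IsRegularFamily p Θ μ r κ ψ φ Φ) {θ : Euc d} (hθ : θ ∈ Θ)
    (y : 𝒴) (x : 𝒳) : Integrable (fun x' => r θ y x' x) μ :=
  (h.integrable y).mono' (h.measurable_dens hθ y x).aestronglyMeasurable
    (Filter.Eventually.of_forall fun x' => by
      rw [Real.norm_of_nonneg (h.nonneg θ hθ y x' x)]; exact h.dominated θ hθ y x' x)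

theorem dens_mass_pos (h : IsRegularFamily p Θ μ r κ ψ φ Φ) {θ : Euc d} (hθ : θ ∈ Θ)
    (y : 𝒴) (x : 𝒳) : 0 < ∫ x', r θ y x' x ∂μ :=
  (div_pos (Real.exp_pos _) (zero_lt_one.trans_le h.one_le)).trans_le (h.mass_lower θ hθ y x)

/-- The four facts feed each other along the string and are proved together. The comparison constant
does not compound: the initial state enters only through the first kernel, and the rest of the
integrand is common to both sides. -/
theorem condLik_aux (h : IsRegularFamily p Θ μ r κ ψ φ Φ) {θ : Euc d} (hθ : θ ∈ Θ)
    (ys : List 𝒴) : (∀ x, 0 < condLik μ r θ ys x) ∧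
      (∀ x, condLik μ r θ ys x ≤ (ys.map fun y => ∫ x', Φ y x' ∂μ).prod) ∧
      (∀ x z, condLik μ r θ ys x ≤ κ * condLik μ r θ ys z) ∧
      (∀ y x, Integrable (fun x' => r θ y x' x * condLik μ r θ ys x') μ) := by
  have hκ := zero_lt_one.trans_le h.one_le
  have hint : ∀ (zs : List 𝒴) (C : ℝ), (∀ x, 0 < condLik μ r θ zs x) →
      (∀ x, condLik μ r θ zs x ≤ C) →
      ∀ y x, Integrable (fun x' => r θ y x' x * condLik μ r θ zs x') μ := by
    intro zs C h1 h2 y x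
    refine (h.integrable_dens hθ y x).mul_bdd (c := C)
      (h.measurable_condLik hθ zs).aestronglyMeasurable (Filter.Eventually.of_forall fun x' => ?_)
    rw [Real.norm_of_nonneg (h1 x').le]
    exact h2 x'
  induction ys with
  | nil =>
    refine ⟨fun _ => zero_lt_one, fun _ => by simp [condLik], fun _ _ => ?_,
      hint _ 1 (fun _ => zero_lt_one) fun _ => le_rfl⟩
    simpa [condLik] using h.one_le
  | cons y ys ih =>
    obtain ⟨h1, h2, h3, h4⟩ := ih
    have c1 : ∀ x, 0 < condLik μ r θ (y :: ys) x := by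
      intro x
      -- Comparability bounds the inner likelihood below by a positive constant, which reduces
      -- positivity of the integral to that of the mass of the kernel.
      have h5 : 0 < κ⁻¹ * condLik μ r θ ys x * ∫ x', r θ y x' x ∂μ :=
        mul_pos (mul_pos (inv_pos.2 hκ) (h1 x)) (h.dens_mass_pos hθ y x)
      refine h5.trans_le ?_
      rw [condLik_cons, ← integral_const_mul]
      refine integral_mono ((h.integrable_dens hθ y x).const_mul _) (h4 y x) fun x' => ?_
      beta_reduce
      rw [mul_comm]
      refine mul_le_mul_of_nonneg_left ?_ (h.nonneg θ hθ y x' x)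
      rw [inv_mul_le_iff₀ hκ]
      exact h3 x x'
    have c2 : ∀ x, condLik μ r θ (y :: ys) x ≤
        ((y :: ys).map fun y => ∫ x', Φ y x' ∂μ).prod := by
      intro x
      rw [condLik_cons, List.map_cons, List.prod_cons, ← integral_mul_const]
      refine integral_mono (h4 y x) ((h.integrable y).mul_const _) fun x' => ?_
      exact mul_le_mul (h.dominated θ hθ y x' x) (h2 x') (h1 x').le
        ((h.nonneg θ hθ y x' x).trans (h.dominated θ hθ y x' x))
    refine ⟨c1, c2, fun x z => ?_, hint _ _ c1 c2⟩
    rw [condLik_cons, condLik_cons, ← integral_const_mul]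
    refine integral_mono_ae (h4 y x) ((h4 y z).const_mul _) ?_
    filter_upwards [h.mixing θ hθ y x z] with x' hx'
    rw [← mul_assoc]
    exact mul_le_mul_of_nonneg_right hx' (h1 x').le

theorem condLik_pos (h : IsRegularFamily p Θ μ r κ ψ φ Φ) {θ : Euc d} (hθ : θ ∈ Θ)
    (ys : List 𝒴) (x : 𝒳) : 0 < condLik μ r θ ys x := (h.condLik_aux hθ ys).1 x

theorem condLik_le (h : IsRegularFamily p Θ μ r κ ψ φ Φ) {θ : Euc d} (hθ : θ ∈ Θ)
    (ys : List 𝒴) (x : 𝒳) : condLik μ r θ ys x ≤ (ys.map fun y => ∫ x', Φ y x' ∂μ).prod :=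
  (h.condLik_aux hθ ys).2.1 x

theorem condLik_le_mul (h : IsRegularFamily p Θ μ r κ ψ φ Φ) {θ : Euc d} (hθ : θ ∈ Θ)
    (ys : List 𝒴) (x z : 𝒳) : condLik μ r θ ys x ≤ κ * condLik μ r θ ys z :=
  (h.condLik_aux hθ ys).2.2.1 x z

theorem integrable_dens_mul_condLik (h : IsRegularFamily p Θ μ r κ ψ φ Φ) {θ : Euc d}
    (hθ : θ ∈ Θ) (ys : List 𝒴) (y : 𝒴) (x : 𝒳) :
    Integrable (fun x' => r θ y x' x * condLik μ r θ ys x') μ :=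
  (h.condLik_aux hθ ys).2.2.2 y x

theorem sum_score_nonneg (h : IsRegularFamily p Θ μ r κ ψ φ Φ) (ys : List 𝒴) :
    0 ≤ (ys.map ψ).sum :=
  List.sum_nonneg fun a ha => by
    obtain ⟨y, _, rfl⟩ := List.mem_map.1 ha
    exact zero_le_one.trans (h.one_le_score y)

/-- The hypotheses `hs` and `hb` are the induction hypotheses of `condLik_deriv`, so the lemma
serves inside that induction as well as after it. -/
theorem dens_mul_condLik_deriv (h : IsRegularFamily p Θ μ r κ ψ φ Φ) (ys : List 𝒴) (y : 𝒴)
    (hs : ∀ x, WordDiffOn p (fun t => condLik μ r t ys x) Θ)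
    (hb : ∀ x, ∀ θ ∈ Θ, ∀ w : List (Fin d), w.length ≤ p →
      |wordDeriv w (fun t => condLik μ r t ys x) θ| ≤
        (ys.map ψ).sum ^ w.length * condLik μ r θ ys x) (x x' : 𝒳) :
    WordDiffOn p (fun t => r t y x' x * condLik μ r t ys x') Θ ∧
    ∀ θ ∈ Θ, ∀ w : List (Fin d), w.length ≤ p →
      |wordDeriv w (fun t => r t y x' x * condLik μ r t ys x') θ| ≤
        ((y :: ys).map ψ).sum ^ w.length * (r θ y x' x * condLik μ r θ ys x') := by
  refine ⟨(h.smooth y x' x).mul h.isOpen (hs x'), fun θ hθ w hw => ?_⟩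
  rw [List.map_cons, List.sum_cons]
  exact abs_wordDeriv_mul_le h.isOpen (h.smooth y x' x) (hs x') hθ (h.nonneg θ hθ y x' x)
    (zero_le_one.trans (h.one_le_score y)) (h.score θ hθ y x' x) (hb x' θ hθ) w hw

/-- Rates add when a kernel is multiplied on, and a bound by a multiple of a nonnegative function
survives integration. The dominating function is the product of the `Φ`'s, times a power of the
total score. -/
theorem condLik_deriv (h : IsRegularFamily p Θ μ r κ ψ φ Φ) (ys : List 𝒴) :
    (∀ x, WordDiffOn p (fun t => condLik μ r t ys x) Θ) ∧
    ∀ x, ∀ θ ∈ Θ, ∀ w : List (Fin d), w.length ≤ p →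
      |wordDeriv w (fun t => condLik μ r t ys x) θ| ≤
        (ys.map ψ).sum ^ w.length * condLik μ r θ ys x := by
  induction ys with
  | nil =>
    refine ⟨fun x => wordDiffOn_const 1, fun x θ hθ w hw => ?_⟩
    rcases eq_or_ne w [] with rfl | hw'
    · simp [condLik]
    · simp only [condLik, wordDeriv_const hw']
      simp
  | cons y ys ih =>
    have hd := fun x x' => h.dens_mul_condLik_deriv ys y ih.1 ih.2 x x'
    have hs1 : 1 ≤ ((y :: ys).map ψ).sum := by
      have := h.sum_score_nonneg ys
      have := h.one_le_score y
      simp; linarith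
    have key := fun x => wordDeriv_integral (m := μ) h.isOpen (n := p)
      (F := fun θ x' => r θ y x' x * condLik μ r θ ys x')
      (fun θ hθ => (h.measurable_dens hθ y x).mul (h.measurable_condLik hθ ys))
      (fun x' => (hd x x').1)
      (B := fun x' => ((y :: ys).map ψ).sum ^ p *
        (Φ y x' * (ys.map fun y => ∫ x', Φ y x' ∂μ).prod))
      (((h.integrable y).mul_const _).const_mul _) (fun w hw θ hθ x' => by
        refine ((hd x x').2 θ hθ w hw).trans (mul_le_mul (pow_le_pow_right₀ hs1 hw) ?_ ?_ ?_)
        · exact mul_le_mul (h.dominated θ hθ y x' x) (h.condLik_le hθ ys x')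
            (h.condLik_pos hθ ys x').le
            ((h.nonneg θ hθ y x' x).trans (h.dominated θ hθ y x' x))
        · exact mul_nonneg (h.nonneg θ hθ y x' x) (h.condLik_pos hθ ys x').le
        · positivity)
    refine ⟨fun x => (key x).1, fun x θ hθ w hw => ?_⟩
    have h1 := (key x).2 w hw θ hθ
    simp only [condLik_cons]
    rw [h1.2, ← integral_const_mul]
    refine abs_integral_le_integral_abs.trans (integral_mono h1.1.abs
      ((h.integrable_dens_mul_condLik hθ ys y x).const_mul _) fun x' => ?_)
    exact (hd x x').2 θ hθ w hw

theorem one_le_sum_score (h : IsRegularFamily p Θ μ r κ ψ φ Φ) (y : 𝒴) (ys : List 𝒴) :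
    1 ≤ ((y :: ys).map ψ).sum := by
  have := h.sum_score_nonneg ys
  have := h.one_le_score y
  simp; linarith

theorem condLik_mul_postKer (h : IsRegularFamily p Θ μ r κ ψ φ Φ) {θ : Euc d} (hθ : θ ∈ Θ)
    (y : 𝒴) (ys : List 𝒴) (x x' : 𝒳) : condLik μ r θ (y :: ys) x * postKer μ r θ y ys x x' =
      r θ y x' x * condLik μ r θ ys x' :=
  mul_div_cancel₀ _ (h.condLik_pos hθ _ x).ne'

theorem postKer_nonneg (h : IsRegularFamily p Θ μ r κ ψ φ Φ) {θ : Euc d} (hθ : θ ∈ Θ)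
    (y : 𝒴) (ys : List 𝒴) (x x' : 𝒳) : 0 ≤ postKer μ r θ y ys x x' :=
  div_nonneg (mul_nonneg (h.nonneg θ hθ y x' x) (h.condLik_pos hθ ys x').le)
    (h.condLik_pos hθ _ x).le

theorem measurable_postKer (h : IsRegularFamily p Θ μ r κ ψ φ Φ) {θ : Euc d} (hθ : θ ∈ Θ)
    (y : 𝒴) (ys : List 𝒴) (x : 𝒳) : Measurable (postKer μ r θ y ys x) :=
  ((h.measurable_dens hθ y x).mul (h.measurable_condLik hθ ys)).div_const _

theorem integrable_postKer (h : IsRegularFamily p Θ μ r κ ψ φ Φ) {θ : Euc d} (hθ : θ ∈ Θ)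
    (y : 𝒴) (ys : List 𝒴) (x : 𝒳) : Integrable (postKer μ r θ y ys x) μ :=
  (h.integrable_dens_mul_condLik hθ ys y x).div_const _

theorem integral_postKer (h : IsRegularFamily p Θ μ r κ ψ φ Φ) {θ : Euc d} (hθ : θ ∈ Θ)
    (y : 𝒴) (ys : List 𝒴) (x : 𝒳) : ∫ x', postKer μ r θ y ys x x' ∂μ = 1 := by
  unfold postKer
  rw [integral_div, ← condLik_cons, div_self (h.condLik_pos hθ _ x).ne']

/-- One factor `κ` comes from the kernels in the numerators, the other from the normalizing
likelihoods; the common factor `condLik μ r θ ys x'` cancels. -/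
theorem postKer_mixing (h : IsRegularFamily p Θ μ r κ ψ φ Φ) {θ : Euc d} (hθ : θ ∈ Θ)
    (y : 𝒴) (ys : List 𝒴) (x z : 𝒳) :
    ∀ᵐ x' ∂μ, (κ ^ 2)⁻¹ * postKer μ r θ y ys z x' ≤ postKer μ r θ y ys x x' := by
  have hκ := zero_lt_one.trans_le h.one_le
  filter_upwards [h.mixing θ hθ y z x] with x' hx'
  have h1 := h.condLik_le_mul hθ (y :: ys) x z
  have h2 := h.condLik_pos hθ (y :: ys) x
  have h3 := h.condLik_pos hθ (y :: ys) z
  have h4 := h.condLik_pos hθ ys x'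
  rw [inv_mul_le_iff₀ (by positivity)]
  unfold postKer
  rw [mul_div_assoc', div_le_div_iff₀ h3 h2]
  calc r θ y x' z * condLik μ r θ ys x' * condLik μ r θ (y :: ys) x
      ≤ (κ * r θ y x' x) * condLik μ r θ ys x' * (κ * condLik μ r θ (y :: ys) z) := by
        have := h.nonneg θ hθ y x' x
        gcongr
    _ = _ := by ring

/-- A dominating function uniform in the parameter and in the current state. The normalizing
likelihood is at least `κ⁻¹ * condLik μ r θ ys x'` times the mass of the kernel, and that mass is at
least `exp (-φ y) / κ`. -/
theorem postKer_le (h : IsRegularFamily p Θ μ r κ ψ φ Φ) {θ : Euc d} (hθ : θ ∈ Θ)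
    (y : 𝒴) (ys : List 𝒴) (x x' : 𝒳) :
    postKer μ r θ y ys x x' ≤ κ ^ 2 * Real.exp (φ y) * Φ y x' := by
  have hκ := zero_lt_one.trans_le h.one_le
  have h1 := h.condLik_pos hθ (y :: ys) x
  have h4 := h.condLik_pos hθ ys x'
  have hlow : condLik μ r θ ys x' ≤ κ ^ 2 * Real.exp (φ y) * condLik μ r θ (y :: ys) x := by
    have e1 : κ⁻¹ * condLik μ r θ ys x' * ∫ z, r θ y z x ∂μ ≤ condLik μ r θ (y :: ys) x := by
      rw [condLik_cons, ← integral_const_mul]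
      refine integral_mono ((h.integrable_dens hθ y x).const_mul _)
        (h.integrable_dens_mul_condLik hθ ys y x) fun z => ?_
      beta_reduce
      rw [mul_comm]
      refine mul_le_mul_of_nonneg_left ?_ (h.nonneg θ hθ y z x)
      rw [inv_mul_le_iff₀ hκ]
      exact h.condLik_le_mul hθ ys x' z
    have e2 := h.mass_lower θ hθ y x
    have e3 : κ⁻¹ * condLik μ r θ ys x' * (Real.exp (-φ y) / κ) ≤
        condLik μ r θ (y :: ys) x :=
      (mul_le_mul_of_nonneg_left e2 (by positivity)).trans e1
    calc condLik μ r θ ys x' = κ ^ 2 * Real.exp (φ y) *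
          (κ⁻¹ * condLik μ r θ ys x' * (Real.exp (-φ y) / κ)) := by
          rw [Real.exp_neg]; field_simp
      _ ≤ _ := mul_le_mul_of_nonneg_left e3 (by positivity)
  unfold postKer
  rw [div_le_iff₀ h1]
  calc _ ≤ Φ y x' * (κ ^ 2 * Real.exp (φ y) * condLik μ r θ (y :: ys) x) :=
        mul_le_mul (h.dominated θ hθ y x' x) hlow h4.le
          ((h.nonneg θ hθ y x' x).trans (h.dominated θ hθ y x' x))
    _ = _ := by ring

theorem smooth_postKer (h : IsRegularFamily p Θ μ r κ ψ φ Φ) (y : 𝒴) (ys : List 𝒴) (x x' : 𝒳) :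
    WordDiffOn p (fun t => postKer μ r t y ys x x') Θ := by
  have h1 := (h.dens_mul_condLik_deriv ys y (h.condLik_deriv ys).1 (h.condLik_deriv ys).2 x x').1
  exact h1.mul h.isOpen (((h.condLik_deriv (y :: ys)).1 x).inv h.isOpen
    fun θ hθ => (h.condLik_pos hθ _ x).ne')

theorem abs_wordDeriv_postKer_le (h : IsRegularFamily p Θ μ r κ ψ φ Φ) {θ : Euc d} (hθ : θ ∈ Θ)
    (y : 𝒴) (ys : List 𝒴) (x x' : 𝒳) (w : List (Fin d)) (hw : w.length ≤ p) :
    |wordDeriv w (fun t => postKer μ r t y ys x x') θ| ≤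
      ((1 + 2 ^ p) * ((y :: ys).map ψ).sum) ^ w.length * postKer μ r θ y ys x x' := by
  have h1 := h.dens_mul_condLik_deriv ys y (h.condLik_deriv ys).1 (h.condLik_deriv ys).2 x x'
  exact abs_wordDeriv_div_le h.isOpen ((h.condLik_deriv (y :: ys)).1 x)
    (h.smooth_postKer y ys x x') (fun t ht => h.condLik_mul_postKer ht y ys x x') hθ
    (h.condLik_pos hθ _ x) (mul_nonneg (h.nonneg θ hθ y x' x) (h.condLik_pos hθ ys x').le)
    (h.sum_score_nonneg _) ((h.condLik_deriv (y :: ys)).2 x θ hθ) (h1.2 θ hθ) w hw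

theorem predLik_pos (h : IsRegularFamily p Θ μ r κ ψ φ Φ) {θ : Euc d} (hθ : θ ∈ Θ)
    (ys : List 𝒴) (b : 𝒴) (x : 𝒳) : 0 < predLik μ r θ ys b x :=
  div_pos (h.condLik_pos hθ _ x) (h.condLik_pos hθ _ x)

theorem smooth_predLik (h : IsRegularFamily p Θ μ r κ ψ φ Φ) (ys : List 𝒴) (b : 𝒴) (x : 𝒳) :
    WordDiffOn p (fun t => predLik μ r t ys b x) Θ :=
  ((h.condLik_deriv (ys ++ [b])).1 x).mul h.isOpen (((h.condLik_deriv ys).1 x).inv h.isOpen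
    fun _ hθ => (h.condLik_pos hθ _ x).ne')

theorem abs_wordDeriv_predLik_le (h : IsRegularFamily p Θ μ r κ ψ φ Φ) {θ : Euc d} (hθ : θ ∈ Θ)
    (ys : List 𝒴) (b : 𝒴) (x : 𝒳) {s : ℝ} (hs : (ys.map ψ).sum + ψ b ≤ s)
    (w : List (Fin d)) (hw : w.length ≤ p) :
    |wordDeriv w (fun t => predLik μ r t ys b x) θ| ≤
      ((1 + 2 ^ p) * s) ^ w.length * predLik μ r θ ys b x := by
  have h0 := h.sum_score_nonneg ys
  have h1 := h.one_le_score b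
  have e : ((ys ++ [b]).map ψ).sum = (ys.map ψ).sum + ψ b := by simp
  refine abs_wordDeriv_div_le h.isOpen ((h.condLik_deriv ys).1 x) (h.smooth_predLik ys b x)
    (fun t ht => mul_div_cancel₀ _ (h.condLik_pos ht _ x).ne') hθ
    (h.condLik_pos hθ _ x) (h.condLik_pos hθ _ x).le (by linarith) (fun v hv => ?_)
    (fun v hv => ?_) w hw
  · refine ((h.condLik_deriv ys).2 x θ hθ v hv).trans (mul_le_mul_of_nonneg_right ?_
      (h.condLik_pos hθ _ x).le)
    exact pow_le_pow_left₀ h0 (by linarith) _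
  · refine ((h.condLik_deriv (ys ++ [b])).2 x θ hθ v hv).trans (mul_le_mul_of_nonneg_right ?_
      (h.condLik_pos hθ _ x).le)
    rw [e]
    exact pow_le_pow_left₀ (by linarith) hs _

omit [MeasurableSpace 𝒴] in
theorem predLik_nil (θ : Euc d) (b : 𝒴) (x : 𝒳) :
    predLik μ r θ [] b x = ∫ x', r θ b x' x ∂μ := by
  simp [predLik, condLik]

theorem postKer_mul_predLik (h : IsRegularFamily p Θ μ r κ ψ φ Φ) {θ : Euc d} (hθ : θ ∈ Θ)
    (y : 𝒴) (ys : List 𝒴) (b : 𝒴) (x x' : 𝒳) :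
    postKer μ r θ y ys x x' * predLik μ r θ ys b x' =
      r θ y x' x * condLik μ r θ (ys ++ [b]) x' / condLik μ r θ (y :: ys) x := by
  have := (h.condLik_pos hθ ys x').ne'
  unfold postKer predLik
  field_simp

theorem integrable_postKer_mul_predLik (h : IsRegularFamily p Θ μ r κ ψ φ Φ) {θ : Euc d}
    (hθ : θ ∈ Θ) (y : 𝒴) (ys : List 𝒴) (b : 𝒴) (x : 𝒳) :
    Integrable (fun x' => postKer μ r θ y ys x x' * predLik μ r θ ys b x') μ := by
  simp_rw [h.postKer_mul_predLik hθ]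
  exact (h.integrable_dens_mul_condLik hθ _ y x).div_const _

/-- The recursion on the oldest observation. It represents the dependence on the initial state
through successive posterior kernels applied to the one-step likelihood of `b`, which is where
mixing can act. -/
theorem predLik_cons (h : IsRegularFamily p Θ μ r κ ψ φ Φ) {θ : Euc d} (hθ : θ ∈ Θ)
    (y : 𝒴) (ys : List 𝒴) (b : 𝒴) (x : 𝒳) : predLik μ r θ (y :: ys) b x =
      ∫ x', postKer μ r θ y ys x x' * predLik μ r θ ys b x' ∂μ := by
  simp_rw [h.postKer_mul_predLik hθ]
  rw [integral_div]
  rfl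

/-- Averages against probability densities stay within the range of what is averaged. -/
theorem predLik_mem_Icc (h : IsRegularFamily p Θ μ r κ ψ φ Φ) {θ : Euc d} (hθ : θ ∈ Θ)
    (b : 𝒴) {m M : ℝ} (hm : ∀ x, m ≤ predLik μ r θ [] b x) (hM : ∀ x, predLik μ r θ [] b x ≤ M)
    (ys : List 𝒴) (x : 𝒳) : m ≤ predLik μ r θ ys b x ∧ predLik μ r θ ys b x ≤ M := by
  induction ys generalizing x with
  | nil => exact ⟨hm x, hM x⟩
  | cons y ys ih =>
    rw [h.predLik_cons hθ]
    have e : ∀ c : ℝ, c = ∫ x', postKer μ r θ y ys x x' * c ∂μ := fun c => by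
      rw [integral_mul_const, h.integral_postKer hθ, one_mul]
    constructor
    · conv_lhs => rw [e m]
      exact integral_mono ((h.integrable_postKer hθ y ys x).mul_const _)
        (h.integrable_postKer_mul_predLik hθ y ys b x) fun x' =>
        mul_le_mul_of_nonneg_left (ih x').1 (h.postKer_nonneg hθ y ys x x')
    · conv_rhs => rw [e M]
      exact integral_mono (h.integrable_postKer_mul_predLik hθ y ys b x)
        ((h.integrable_postKer hθ y ys x).mul_const _) fun x' =>
        mul_le_mul_of_nonneg_left (ih x').2 (h.postKer_nonneg hθ y ys x x')

end IsRegularFamily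

end


/-! ### Contraction of oscillations by probability densities. -/

section Contraction

variable {α : Type*} [MeasurableSpace α] {m : Measure α}

theorem integral_list_sum {β : Type*} (l : List β) (F : β → α → ℝ)
    (h : ∀ q ∈ l, Integrable (F q) m) :
    Integrable (fun a => (l.map fun q => F q a).sum) m ∧
      ∫ a, (l.map fun q => F q a).sum ∂m = (l.map fun q => ∫ a, F q a ∂m).sum := by
  induction l with
  | nil => simp
  | cons b l ih =>
    obtain ⟨h1, h2⟩ := ih fun q hq => h q (by simp [hq])
    have h3 := h b (by simp)
    simp only [List.map_cons, List.sum_cons]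
    exact ⟨h3.add h1, by rw [integral_add h3 h1, h2]⟩

/-- Doeblin's contraction of the oscillation. -/
theorem integral_sub_integral_le_of_minorization {S T g : α → ℝ} {γ O : ℝ}
    (hS : Integrable S m) (hT : Integrable T m) (hS1 : ∫ a, S a ∂m = 1) (hT1 : ∫ a, T a ∂m = 1)
    (hT0 : ∀ a, 0 ≤ T a) (hST : ∀ᵐ a ∂m, γ * T a ≤ S a)
    (hSg : Integrable (fun a => S a * g a) m) (hTg : Integrable (fun a => T a * g a) m)
    (hg : ∀ a b, g a - g b ≤ O) :
    ∫ a, S a * g a ∂m - ∫ a, T a * g a ∂m ≤ (1 - γ) * O := by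
  set J := ∫ a, T a * g a ∂m with hJ
  -- No value of `g` exceeds its `T`-mean `J` by more than `O`. Since `S - γ T` is nonnegative
  -- almost everywhere with mass `1 - γ`, integrating this bound against it gives the claim.
  have h1 : ∀ a, g a ≤ J + O := by
    intro a
    have : ∫ b, T b * (g a - O) ∂m ≤ J := integral_mono (hT.mul_const _) hTg fun b =>
      mul_le_mul_of_nonneg_left (by linarith [hg a b]) (hT0 b)
    rw [integral_mul_const, hT1] at this
    linarith
  have h2 : ∫ a, (S a * g a - γ * (T a * g a)) ∂m ≤ ∫ a, (S a - γ * T a) * (J + O) ∂m := by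
    refine integral_mono_ae (hSg.sub (hTg.const_mul _))
      ((hS.sub (hT.const_mul γ)).mul_const _) ?_
    filter_upwards [hST] with a ha
    have : (S a - γ * T a) * g a ≤ (S a - γ * T a) * (J + O) :=
      mul_le_mul_of_nonneg_left (h1 a) (by linarith)
    linarith
  rw [integral_sub hSg (hTg.const_mul _), integral_const_mul, integral_mul_const,
    integral_sub hS (hT.const_mul _), integral_const_mul, hS1, hT1, ← hJ] at h2
  linarith

/-- As `T` has integral zero, `g` may be centred at `c` at no cost. For `T` a derivative of a
posterior density, this brings the oscillation of `g` rather than its size into the estimate. -/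
theorem abs_integral_mul_le_of_integral_eq_zero {S T g : α → ℝ} {C O c : ℝ}
    (hS : Integrable S m) (hS1 : ∫ a, S a ∂m = 1) (hT : Integrable T m) (hT0 : ∫ a, T a ∂m = 0)
    (hTS : ∀ a, |T a| ≤ C * S a) (hTg : Integrable (fun a => T a * g a) m)
    (hg : ∀ a, |g a - c| ≤ O) : |∫ a, T a * g a ∂m| ≤ C * O := by
  have h1 : ∫ a, T a * g a ∂m = ∫ a, T a * (g a - c) ∂m := by
    simp_rw [mul_sub]
    rw [integral_sub hTg (hT.mul_const _), integral_mul_const, hT0]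
    simp
  have h2 : Integrable (fun a => T a * (g a - c)) m := by
    simp_rw [mul_sub]; exact hTg.sub (hT.mul_const _)
  rw [h1]
  have h3 : C * O = ∫ a, C * S a * O ∂m := by
    rw [integral_mul_const, integral_const_mul, hS1, mul_one]
  rw [h3]
  refine abs_integral_le_integral_abs.trans
    (integral_mono h2.abs ((hS.const_mul _).mul_const _) fun a => ?_)
  beta_reduce
  rw [abs_mul]
  exact mul_le_mul (hTS a) (hg a) (abs_nonneg _) ((abs_nonneg _).trans (hTS a))

end Contraction

/-! ### Forgetting of the initial state by the predictive likelihood and its derivatives. -/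

section

variable {𝒳 𝒴 : Type*} [MeasurableSpace 𝒳] [MeasurableSpace 𝒴] {d : ℕ}
  {p : ℕ} {Θ : Set (Euc d)} {μ : Measure 𝒳} {r : Euc d → 𝒴 → 𝒳 → 𝒳 → ℝ} {κ : ℝ}
  {ψ φ : 𝒴 → ℝ} {Φ : 𝒴 → 𝒳 → ℝ}

namespace IsRegularFamily

theorem predLik_le_exp (h : IsRegularFamily p Θ μ r κ ψ φ Φ) {θ : Euc d} (hθ : θ ∈ Θ)
    (ys : List 𝒴) (b : 𝒴) (x : 𝒳) : predLik μ r θ ys b x ≤ κ * Real.exp (φ b) :=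
  (h.predLik_mem_Icc hθ b (m := Real.exp (-φ b) / κ) (M := κ * Real.exp (φ b))
    (fun x => by rw [predLik_nil]; exact h.mass_lower θ hθ b x)
    (fun x => by rw [predLik_nil]; exact h.mass_upper θ hθ b x) ys x).2

theorem exp_le_predLik (h : IsRegularFamily p Θ μ r κ ψ φ Φ) {θ : Euc d} (hθ : θ ∈ Θ)
    (ys : List 𝒴) (b : 𝒴) (x : 𝒳) : Real.exp (-φ b) / κ ≤ predLik μ r θ ys b x :=
  (h.predLik_mem_Icc hθ b (m := Real.exp (-φ b) / κ) (M := κ * Real.exp (φ b))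
    (fun x => by rw [predLik_nil]; exact h.mass_lower θ hθ b x)
    (fun x => by rw [predLik_nil]; exact h.mass_upper θ hθ b x) ys x).1

theorem abs_log_predLik_le (h : IsRegularFamily p Θ μ r κ ψ φ Φ) {θ : Euc d} (hθ : θ ∈ Θ)
    (ys : List 𝒴) (b : 𝒴) (x : 𝒳) :
    |Real.log (predLik μ r θ ys b x)| ≤ φ b + Real.log κ := by
  have hκ := zero_lt_one.trans_le h.one_le
  have h1 := Real.log_le_log (h.predLik_pos hθ ys b x) (h.predLik_le_exp hθ ys b x)
  have h2 := Real.log_le_log (by positivity) (h.exp_le_predLik hθ ys b x)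
  rw [Real.log_mul hκ.ne' (Real.exp_pos _).ne', Real.log_exp] at h1
  rw [Real.log_div (Real.exp_pos _).ne' hκ.ne', Real.log_exp] at h2
  rw [abs_le]
  constructor <;> linarith

theorem predLik_nil_le_mul (h : IsRegularFamily p Θ μ r κ ψ φ Φ) {θ : Euc d} (hθ : θ ∈ Θ)
    (b : 𝒴) (x z : 𝒳) : predLik μ r θ [] b x ≤ κ * predLik μ r θ [] b z := by
  simpa [predLik, condLik] using h.condLik_le_mul hθ [b] x z

theorem measurable_predLik (h : IsRegularFamily p Θ μ r κ ψ φ Φ) {θ : Euc d} (hθ : θ ∈ Θ)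
    (ys : List 𝒴) (b : 𝒴) : Measurable (predLik μ r θ ys b) :=
  (h.measurable_condLik hθ _).div (h.measurable_condLik hθ _)

/-- The posterior density has integral one for every parameter, and differentiation passes under the
integral. -/
theorem wordDeriv_postKer (h : IsRegularFamily p Θ μ r κ ψ φ Φ) {θ : Euc d} (hθ : θ ∈ Θ)
    (y : 𝒴) (ys : List 𝒴) (x : 𝒳) (w : List (Fin d)) (hw : w.length ≤ p) :
    Integrable (fun x' => wordDeriv w (fun t => postKer μ r t y ys x x') θ) μ ∧
    (w ≠ [] → ∫ x', wordDeriv w (fun t => postKer μ r t y ys x x') θ ∂μ = 0) := by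
  have hs := h.one_le_sum_score y ys
  have hc : (1 : ℝ) ≤ 1 + 2 ^ p := by linarith [show (0 : ℝ) ≤ 2 ^ p by positivity]
  have key := wordDeriv_integral (m := μ) h.isOpen (n := p)
    (F := fun θ x' => postKer μ r θ y ys x x')
    (fun θ hθ => h.measurable_postKer hθ y ys x)
    (fun x' => h.smooth_postKer y ys x x')
    (B := fun x' => ((1 + 2 ^ p) * ((y :: ys).map ψ).sum) ^ p *
        (κ ^ 2 * Real.exp (φ y) * Φ y x'))
    (((h.integrable y).const_mul _).const_mul _) (fun w hw θ hθ x' => by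
      refine (h.abs_wordDeriv_postKer_le hθ y ys x x' w hw).trans
        (mul_le_mul (pow_le_pow_right₀ (one_le_mul_of_one_le_of_one_le hc hs) hw)
          (h.postKer_le hθ y ys x x') (h.postKer_nonneg hθ y ys x x') (by positivity)))
  obtain ⟨h1, h2⟩ := key.2 w hw θ hθ
  refine ⟨h1, fun hw' => ?_⟩
  rw [← h2, wordDeriv_congr h.isOpen (g := fun _ => 1)
    (fun t ht => h.integral_postKer ht y ys x) w hθ, wordDeriv_const hw']

theorem integrable_wordDeriv_postKer_mul (h : IsRegularFamily p Θ μ r κ ψ φ Φ) {θ : Euc d}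
    (hθ : θ ∈ Θ) (y : 𝒴) (ys : List 𝒴) (b : 𝒴) (x : 𝒳) (u v : List (Fin d))
    (hu : u.length ≤ p) (hv : v.length ≤ p) :
    Integrable (fun x' => wordDeriv u (fun t => postKer μ r t y ys x x') θ *
      wordDeriv v (fun t => predLik μ r t ys b x') θ) μ := by
  have hκ := zero_lt_one.trans_le h.one_le
  have h0 := h.sum_score_nonneg ys
  have h1 := h.one_le_score b
  refine (h.wordDeriv_postKer hθ y ys x u hu).1.mul_bdd
    (c := ((1 + 2 ^ p) * ((ys.map ψ).sum + ψ b)) ^ v.length * (κ * Real.exp (φ b)))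
    (measurable_wordDeriv h.isOpen (F := fun θ x' => predLik μ r θ ys b x')
      (fun θ hθ => h.measurable_predLik hθ ys b)
      (fun x' => h.smooth_predLik ys b x') v hv hθ).aestronglyMeasurable
    (Filter.Eventually.of_forall fun x' => ?_)
  refine (h.abs_wordDeriv_predLik_le hθ ys b x' le_rfl v hv).trans
    (mul_le_mul_of_nonneg_left (h.predLik_le_exp hθ ys b x') (by positivity))

/-- Leibniz in the recursion, with the term accessible to Doeblin's contraction separated from those
whose kernel has integral zero. -/
theorem wordDeriv_predLik_cons (h : IsRegularFamily p Θ μ r κ ψ φ Φ) {θ : Euc d} (hθ : θ ∈ Θ)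
    (y : 𝒴) (ys : List 𝒴) (b : 𝒴) (x : 𝒳) (w : List (Fin d)) (hw : w.length ≤ p) :
    wordDeriv w (fun t => predLik μ r t (y :: ys) b x) θ =
      (∫ x', postKer μ r θ y ys x x' * wordDeriv w (fun t => predLik μ r t ys b x') θ ∂μ) +
      ((properSplits w).map fun q =>
        ∫ x', wordDeriv q.1 (fun t => postKer μ r t y ys x x') θ *
          wordDeriv q.2 (fun t => predLik μ r t ys b x') θ ∂μ).sum := by
  have hκ := zero_lt_one.trans_le h.one_le
  have hs := h.one_le_sum_score y ys
  have h0 := h.sum_score_nonneg ys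
  have hb := h.one_le_score b
  have hc : (1 : ℝ) ≤ 1 + 2 ^ p := by linarith [show (0 : ℝ) ≤ 2 ^ p by positivity]
  set s := ((y :: ys).map ψ).sum + ψ b with hsdef
  have key := wordDeriv_integral (m := μ) h.isOpen (n := p)
    (F := fun θ x' => postKer μ r θ y ys x x' * predLik μ r θ ys b x')
    (fun θ hθ => (h.measurable_postKer hθ y ys x).mul (h.measurable_predLik hθ ys b))
    (fun x' => (h.smooth_postKer y ys x x').mul h.isOpen (h.smooth_predLik ys b x'))
    (B := fun x' => ((1 + 2 ^ p) * s + (1 + 2 ^ p) * s) ^ p *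
        ((κ ^ 2 * Real.exp (φ y) * Φ y x') * (κ * Real.exp (φ b))))
    ((((h.integrable y).const_mul _).mul_const _).const_mul _) (fun w hw θ hθ x' => by
      have hcs : 1 ≤ (1 + 2 ^ p) * s := one_le_mul_of_one_le_of_one_le hc (by linarith)
      refine (abs_wordDeriv_mul_le h.isOpen (h.smooth_postKer y ys x x')
        (h.smooth_predLik ys b x') hθ (a := (1 + 2 ^ p) * s) (b := (1 + 2 ^ p) * s)
        (h.postKer_nonneg hθ y ys x x')
        (by linarith) (fun v hv => ?_)
        (fun v hv => h.abs_wordDeriv_predLik_le hθ ys b x' ?_ v hv) w hw).trans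
        (mul_le_mul (pow_le_pow_right₀ (by linarith) hw) ?_ ?_ (by positivity))
      · refine (h.abs_wordDeriv_postKer_le hθ y ys x x' v hv).trans
          (mul_le_mul_of_nonneg_right ?_ (h.postKer_nonneg hθ y ys x x'))
        exact pow_le_pow_left₀ (by positivity)
          (mul_le_mul_of_nonneg_left (by linarith) (by linarith)) _
      · rw [hsdef, List.map_cons, List.sum_cons]
        have := h.one_le_score y
        linarith
      · exact mul_le_mul (h.postKer_le hθ y ys x x') (h.predLik_le_exp hθ ys b x')
          (h.predLik_pos hθ ys b x').le
          ((h.postKer_nonneg hθ y ys x x').trans (h.postKer_le hθ y ys x x'))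
      · exact mul_nonneg (h.postKer_nonneg hθ y ys x x') (h.predLik_pos hθ ys b x').le)
  rw [wordDeriv_congr h.isOpen (fun t ht => h.predLik_cons ht y ys b x) w hθ,
    (key.2 w hw θ hθ).2]
  have e : ∀ x', wordDeriv w (fun t => postKer μ r t y ys x x' * predLik μ r t ys b x') θ =
      ((splits w).map fun q => wordDeriv q.1 (fun t => postKer μ r t y ys x x') θ *
          wordDeriv q.2 (fun t => predLik μ r t ys b x') θ).sum := fun x' =>
    wordDeriv_mul h.isOpen (h.smooth_postKer y ys x x') (h.smooth_predLik ys b x') w hw hθ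
  simp_rw [e]
  rw [(integral_list_sum (splits w) (fun q x' =>
    wordDeriv q.1 (fun t => postKer μ r t y ys x x') θ *
      wordDeriv q.2 (fun t => predLik μ r t ys b x') θ) fun q hq =>
        h.integrable_wordDeriv_postKer_mul hθ y ys b x _ _
          (by have := length_of_mem_splits hq; omega)
          (by have := length_of_mem_splits hq; omega)).2, sum_splits]
  rfl

/-- The growth constant of the derivatives of the predictive likelihood. -/
noncomputable def growthConst (p : ℕ) (κ : ℝ) : ℝ := (1 + 2 ^ p) * (4 * 2 ^ p * κ ^ 2)

/-- The rate at which the filter forgets its initial state. -/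
noncomputable def forgetRate (κ : ℝ) : ℝ := 1 - (κ ^ 2)⁻¹ / 2

theorem forgetRate_pos (hκ : 1 ≤ κ) : 0 < forgetRate κ := by
  have : (κ ^ 2)⁻¹ ≤ 1 := inv_le_one_of_one_le₀ (one_le_pow₀ hκ)
  unfold forgetRate; linarith

theorem forgetRate_lt_one (hκ : 1 ≤ κ) : forgetRate κ < 1 := by
  have : 0 < (κ ^ 2)⁻¹ := by positivity
  unfold forgetRate; linarith

theorem le_growthConst (hκ : 1 ≤ κ) : 1 + 2 ^ p ≤ growthConst p κ := by
  unfold growthConst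
  have h1 : (1 : ℝ) ≤ 2 ^ p := one_le_pow₀ (by norm_num)
  have h2 : 1 ≤ κ ^ 2 := one_le_pow₀ hκ
  have : (1 : ℝ) ≤ 4 * 2 ^ p * κ ^ 2 := by nlinarith
  exact le_mul_of_one_le_right (by positivity) this

theorem abs_integral_proper_le (h : IsRegularFamily p Θ μ r κ ψ φ Φ) {θ : Euc d} (hθ : θ ∈ Θ)
    (y : 𝒴) (ys : List 𝒴) (b : 𝒴) (x : 𝒳) {s O : ℝ} (hs : ((y :: ys).map ψ).sum ≤ s)
    (u v : List (Fin d)) (hu : u.length ≤ p) (hv : v.length ≤ p) (hu' : u ≠ [])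
    (hO : ∀ x z, |wordDeriv v (fun t => predLik μ r t ys b x) θ -
      wordDeriv v (fun t => predLik μ r t ys b z) θ| ≤ O) :
    |∫ x', wordDeriv u (fun t => postKer μ r t y ys x x') θ *
      wordDeriv v (fun t => predLik μ r t ys b x') θ ∂μ| ≤ ((1 + 2 ^ p) * s) ^ u.length * O := by
  have h0 := h.sum_score_nonneg (y :: ys)
  refine abs_integral_mul_le_of_integral_eq_zero (h.integrable_postKer hθ y ys x)
    (h.integral_postKer hθ y ys x) (h.wordDeriv_postKer hθ y ys x u hu).1
    ((h.wordDeriv_postKer hθ y ys x u hu).2 hu') (fun x' => ?_)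
    (h.integrable_wordDeriv_postKer_mul hθ y ys b x u v hu hv) (fun x' => hO x' x)
  refine (h.abs_wordDeriv_postKer_le hθ y ys x x' u hu).trans
          (mul_le_mul_of_nonneg_right ?_ (h.postKer_nonneg hθ y ys x x'))
  exact pow_le_pow_left₀ (by positivity) (mul_le_mul_of_nonneg_left hs (by positivity)) _

/-- This dictates the factor `L = 4 * 2 ^ p * κ ^ 2` in `growthConst`: the proper splits amount to
at most `2 ^ p * L ^ |w| / L` times the common power of `1 + 2 ^ p`. Counted twice, once for each of
the two initial states, this is half of the Doeblin gap `(κ ^ 2)⁻¹`; `forgetRate` keeps the other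
half. -/
theorem growthConst_step (hκ : 1 ≤ κ) (w : List (Fin d)) (hw : w.length ≤ p) :
    (1 - (κ ^ 2)⁻¹) * growthConst p κ ^ w.length +
      2 * ((properSplits w).map fun q : List (Fin d) × List (Fin d) =>
        (1 + 2 ^ p : ℝ) ^ q.1.length * growthConst p κ ^ q.2.length).sum ≤
      forgetRate κ * growthConst p κ ^ w.length := by
  set c : ℝ := 1 + 2 ^ p with hc
  set L : ℝ := 4 * 2 ^ p * κ ^ 2 with hL
  have hcpos : 0 < c := by positivity
  have h1 : (1 : ℝ) ≤ 2 ^ p := one_le_pow₀ (by norm_num)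
  have h2 : 1 ≤ κ ^ 2 := one_le_pow₀ hκ
  have hL1 : 1 ≤ L := by rw [hL]; nlinarith
  have e : ((properSplits w).map fun q : List (Fin d) × List (Fin d) =>
        c ^ q.1.length * growthConst p κ ^ q.2.length).sum =
      ((properSplits w).map fun q : List (Fin d) × List (Fin d) =>
        L ^ q.2.length).sum * c ^ w.length := by
    rw [← List.sum_map_mul_right]
    congr 1
    refine List.map_congr_left fun q hq => ?_
    rw [← length_of_mem_splits (mem_splits_of_mem_properSplits hq), growthConst, mul_pow, pow_add]
    ring
  have h3 := sum_properSplits_le w hL1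
  have h4 : ((properSplits w).map fun q : List (Fin d) × List (Fin d) =>
        L ^ q.2.length).sum ≤ 2 ^ p * L ^ w.length / L := by
    rw [le_div_iff₀ (by linarith)]
    refine h3.trans (mul_le_mul_of_nonneg_right ?_ (by positivity))
    exact pow_le_pow_right₀ (by norm_num) hw
  have h5 : growthConst p κ ^ w.length = c ^ w.length * L ^ w.length := by
    rw [growthConst, mul_pow]
  rw [e, h5]
  have h6 : 2 * (2 ^ p * L ^ w.length / L) = (κ ^ 2)⁻¹ / 2 * L ^ w.length := by
    have : L ≠ 0 := by linarith
    rw [mul_div_assoc', div_eq_iff this]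
    rw [show (κ ^ 2)⁻¹ / 2 * L ^ w.length * L = (κ ^ 2)⁻¹ / 2 * L ^ w.length * (4 * 2 ^ p * κ ^ 2)
      by rw [← hL]]
    field_simp
    ring
  have h7 : 0 ≤ c ^ w.length := by positivity
  unfold forgetRate
  have h8 := mul_le_mul_of_nonneg_left h4 h7
  have h9 : 2 * (c ^ w.length * (2 ^ p * L ^ w.length / L)) =
    c ^ w.length * ((κ ^ 2)⁻¹ / 2 * L ^ w.length) := by rw [← h6]; ring
  nlinarith

/-- All parameter derivatives of the predictive likelihood forget the initial state at a
geometric rate. -/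
theorem wordDeriv_predLik_osc_le (h : IsRegularFamily p Θ μ r κ ψ φ Φ) {θ : Euc d} (hθ : θ ∈ Θ)
    (b : 𝒴) {M s : ℝ} (hM : ∀ x, predLik μ r θ [] b x ≤ M) (ys : List 𝒴)
    (hs : (ys.map ψ).sum + ψ b ≤ s) (w : List (Fin d)) (hw : w.length ≤ p) (x z : 𝒳) :
    |wordDeriv w (fun t => predLik μ r t ys b x) θ -
      wordDeriv w (fun t => predLik μ r t ys b z) θ| ≤
      2 * M * (growthConst p κ * s) ^ w.length * forgetRate κ ^ ys.length := by
  have hM0 : 0 ≤ M := (h.predLik_pos hθ [] b x).le.trans (hM x)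
  have hc : (1 : ℝ) ≤ 1 + 2 ^ p := by linarith [show (0 : ℝ) ≤ 2 ^ p by positivity]
  have hK := le_growthConst (p := p) h.one_le
  have hs0 : 0 ≤ s := by linarith [h.sum_score_nonneg ys, h.one_le_score b]
  -- The bound `s` on the total score stays fixed, so the same weight per order serves at every
  -- stage. All words are carried along because the proper splits call on lower orders.
  induction ys generalizing w x z with
  | nil =>
    have h1 : ∀ x, |wordDeriv w (fun t => predLik μ r t [] b x) θ| ≤
        (growthConst p κ * s) ^ w.length * M := fun x =>
      (h.abs_wordDeriv_predLik_le hθ [] b x hs w hw).trans (mul_le_mul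
        (pow_le_pow_left₀ (by positivity) (mul_le_mul_of_nonneg_right hK hs0) _) (hM x)
        (h.predLik_pos hθ [] b x).le (pow_nonneg (mul_nonneg (by linarith) hs0) _))
    refine (abs_sub _ _).trans ((add_le_add (h1 x) (h1 z)).trans (le_of_eq ?_))
    simp
    ring
  | cons y ys ih =>
    have hys : (ys.map ψ).sum + ψ b ≤ s := by
      have := h.one_le_score y
      simp only [List.map_cons, List.sum_cons] at hs
      linarith
    have hys' : ((y :: ys).map ψ).sum ≤ s := by linarith [h.one_le_score b]
    have ih' := ih hys
    have main : ∀ x z, wordDeriv w (fun t => predLik μ r t (y :: ys) b x) θ -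
        wordDeriv w (fun t => predLik μ r t (y :: ys) b z) θ ≤
        2 * M * (growthConst p κ * s) ^ w.length * forgetRate κ ^ (y :: ys).length := by
      intro x z
      rw [h.wordDeriv_predLik_cons hθ y ys b x w hw, h.wordDeriv_predLik_cons hθ y ys b z w hw]
      -- The kernel is undifferentiated here, and the oscillation of the full derivative contracts
      -- by `1 - (κ ^ 2)⁻¹`.
      have h1 := integral_sub_integral_le_of_minorization (h.integrable_postKer hθ y ys x)
        (h.integrable_postKer hθ y ys z) (h.integral_postKer hθ y ys x)
        (h.integral_postKer hθ y ys z) (h.postKer_nonneg hθ y ys z)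
        (h.postKer_mixing hθ y ys x z)
        (h.integrable_wordDeriv_postKer_mul hθ y ys b x [] w (by simp) hw)
        (h.integrable_wordDeriv_postKer_mul hθ y ys b z [] w (by simp) hw)
        (fun a b => (le_abs_self _).trans (ih' w hw a b))
      -- Here the kernel is differentiated and has integral zero, so only oscillations of
      -- derivatives of lower order enter, known from the induction hypothesis.
      have h2 : ∀ x, |((properSplits w).map fun q =>
          ∫ x', wordDeriv q.1 (fun t => postKer μ r t y ys x x') θ *
            wordDeriv q.2 (fun t => predLik μ r t ys b x') θ ∂μ).sum| ≤
          ((properSplits w).map fun q : List (Fin d) × List (Fin d) =>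
            (1 + 2 ^ p : ℝ) ^ q.1.length * growthConst p κ ^ q.2.length).sum *
            (2 * M * s ^ w.length * forgetRate κ ^ ys.length) := by
        intro x
        rw [← List.sum_map_mul_right]
        refine abs_sum_map_le _ _ _ fun q hq => ?_
        have h3 := length_of_mem_splits (mem_splits_of_mem_properSplits hq)
        refine (h.abs_integral_proper_le hθ y ys b x hys' q.1 q.2 (by omega) (by omega)
          (fst_ne_nil_of_mem_properSplits hq) (ih' q.2 (by omega))).trans (le_of_eq ?_)
        rw [← h3, mul_pow, mul_pow, pow_add]
        ring
      have h4 := mul_le_mul_of_nonneg_right (growthConst_step h.one_le w hw)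
        (show 0 ≤ 2 * M * s ^ w.length * forgetRate κ ^ ys.length by
          have := (forgetRate_pos h.one_le).le
          positivity)
      have h5 := (le_abs_self _).trans (h2 x)
      have h6 := (neg_le_abs _).trans (h2 z)
      rw [List.length_cons, pow_succ, mul_pow]
      rw [mul_pow] at h1
      linarith
    rw [abs_le]
    constructor
    · linarith [main z x]
    · exact main x z

end IsRegularFamily

end


/-! ### Forgetting of the oldest observation, and passage to the logarithm. -/

section

variable {𝒳 𝒴 : Type*} [MeasurableSpace 𝒳] [MeasurableSpace 𝒴] {d : ℕ}
  {p : ℕ} {Θ : Set (Euc d)} {μ : Measure 𝒳} {r : Euc d → 𝒴 → 𝒳 → 𝒳 → ℝ} {κ : ℝ}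
  {ψ φ : 𝒴 → ℝ} {Φ : 𝒴 → 𝒳 → ℝ}

namespace IsRegularFamily

/-- An additional oldest observation replaces a value by an average over states, so the
undifferentiated-kernel term changes by at most an oscillation. The other terms are oscillations
too, since their kernels have integral zero; summing over all splits gives the binomial rate. -/
theorem wordDeriv_predLik_cons_sub_le (h : IsRegularFamily p Θ μ r κ ψ φ Φ) {θ : Euc d}
    (hθ : θ ∈ Θ) (b : 𝒴) {M s : ℝ} (hM : ∀ x, predLik μ r θ [] b x ≤ M) (y : 𝒴) (ys : List 𝒴)
    (hs : ((y :: ys).map ψ).sum + ψ b ≤ s) (w : List (Fin d)) (hw : w.length ≤ p) (x : 𝒳) :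
    |wordDeriv w (fun t => predLik μ r t (y :: ys) b x) θ -
      wordDeriv w (fun t => predLik μ r t ys b x) θ| ≤
      ((1 + 2 ^ p) * s + growthConst p κ * s) ^ w.length *
        (2 * M * forgetRate κ ^ ys.length) := by
  have hys : (ys.map ψ).sum + ψ b ≤ s := by
    have := h.one_le_score y
    simp only [List.map_cons, List.sum_cons] at hs
    linarith
  have hys' : ((y :: ys).map ψ).sum ≤ s := by linarith [h.one_le_score b]
  have hosc := h.wordDeriv_predLik_osc_le hθ b hM ys hys
  rw [h.wordDeriv_predLik_cons hθ y ys b x w hw, ← sum_splits_pow, sum_splits, add_mul,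
    ← List.sum_map_mul_right, add_sub_right_comm]
  refine (abs_add_le _ _).trans (add_le_add ?_ (abs_sum_map_le _ _ _ fun q hq => ?_))
  · set c := wordDeriv w (fun t => predLik μ r t ys b x) θ with hc
    have hi := h.integrable_wordDeriv_postKer_mul hθ y ys b x [] w (by simp) hw
    simp only [wordDeriv_nil] at hi
    have e : (∫ x', postKer μ r θ y ys x x' *
        wordDeriv w (fun t => predLik μ r t ys b x') θ ∂μ) - c =
        ∫ x', postKer μ r θ y ys x x' *
          (wordDeriv w (fun t => predLik μ r t ys b x') θ - c) ∂μ := by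
      simp_rw [mul_sub]
      rw [integral_sub hi ((h.integrable_postKer hθ y ys x).mul_const _), integral_mul_const,
        h.integral_postKer hθ, one_mul]
    have hi2 : Integrable (fun x' => postKer μ r θ y ys x x' *
          (wordDeriv w (fun t => predLik μ r t ys b x') θ - c)) μ := by
      simp_rw [mul_sub]
      exact hi.sub ((h.integrable_postKer hθ y ys x).mul_const _)
    rw [e]
    have e2 : ∀ O : ℝ, O = ∫ x', postKer μ r θ y ys x x' * O ∂μ := fun O => by
      rw [integral_mul_const, h.integral_postKer hθ, one_mul]
    rw [e2 (_ * _)]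
    refine abs_integral_le_integral_abs.trans (integral_mono hi2.abs
      ((h.integrable_postKer hθ y ys x).mul_const _) fun x' => ?_)
    beta_reduce
    rw [abs_mul, abs_of_nonneg (h.postKer_nonneg hθ y ys x x')]
    refine mul_le_mul_of_nonneg_left ((hosc w hw x' x).trans (le_of_eq ?_))
      (h.postKer_nonneg hθ y ys x x')
    simp
    ring
  · have h3 := length_of_mem_splits (mem_splits_of_mem_properSplits hq)
    refine (h.abs_integral_proper_le hθ y ys b x hys' q.1 q.2 (by omega) (by omega)
      (fst_ne_nil_of_mem_properSplits hq) (hosc q.2 (by omega))).trans (le_of_eq ?_)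
    ring

/-- After one differentiation the logarithm becomes the quotient of `∂ᵢ predLik` by `predLik`, and
the size of `predLik` cancels. The letter `i` is the innermost one. -/
theorem abs_wordDeriv_partialDeriv_log_predLik_le (h : IsRegularFamily p Θ μ r κ ψ φ Φ)
    {θ : Euc d} (hθ : θ ∈ Θ) (ys : List 𝒴) (b : 𝒴) {s : ℝ} (hs : (ys.map ψ).sum + ψ b ≤ s)
    (v : List (Fin d)) (i : Fin d) (hv : v.length + 1 ≤ p) (x : 𝒳) :
    |wordDeriv v (partialDeriv i (fun t => Real.log (predLik μ r t ys b x))) θ| ≤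
      ((1 + 2 ^ p) * ((1 + 2 ^ p) * s)) ^ v.length * ((1 + 2 ^ p) * s) := by
  obtain ⟨n, rfl⟩ : ∃ n, p = n + 1 := ⟨p - 1, by omega⟩
  have hs0 : 0 ≤ s := by linarith [h.sum_score_nonneg ys, h.one_le_score b]
  have hR := h.smooth_predLik ys b x
  have hpos := fun θ hθ => h.predLik_pos (θ := θ) hθ ys b x
  have hL := wordDiffOn_succ.1 (hR.log h.isOpen fun t ht => (hpos t ht).ne')
  have h1 := abs_wordDeriv_div_le h.isOpen (n := n) (hR.mono (Nat.le_succ n)) (hL.2 i)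
    (g := partialDeriv i fun t => predLik μ r t ys b x) (fun t ht => by
      beta_reduce
      rw [partialDeriv_log (hR.differentiableAt (Nat.succ_pos n) ht) (hpos t ht).ne',
        mul_inv_cancel_left₀ (hpos t ht).ne']) hθ (a := (1 + 2 ^ (n + 1)) * s)
    (G := (1 + 2 ^ (n + 1)) * s * predLik μ r θ ys b x) (hpos θ hθ)
    (mul_nonneg (by positivity) (hpos θ hθ).le) (by positivity)
    (fun w hw => h.abs_wordDeriv_predLik_le hθ ys b x hs w (by omega))
    (fun w hw => by
      have := h.abs_wordDeriv_predLik_le hθ ys b x hs (w ++ [i]) (by simp; omega)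
      rw [wordDeriv_append, List.length_append, List.length_singleton] at this
      refine this.trans (le_of_eq ?_)
      ring) v (by omega)
  rw [mul_div_cancel_right₀ _ (hpos θ hθ).ne'] at h1
  refine h1.trans (mul_le_mul_of_nonneg_right (pow_le_pow_left₀ (by positivity)
    (mul_le_mul_of_nonneg_right ?_ (by positivity)) _) (by positivity))
  have : (2 : ℝ) ^ n ≤ 2 ^ (n + 1) := pow_le_pow_right₀ (by norm_num) (Nat.le_succ n)
  linarith

theorem abs_wordDeriv_log_predLik_le (h : IsRegularFamily p Θ μ r κ ψ φ Φ) {θ : Euc d}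
    (hθ : θ ∈ Θ) (ys : List 𝒴) (b : 𝒴) {s : ℝ} (hs : (ys.map ψ).sum + ψ b ≤ s)
    (w : List (Fin d)) (hw : w.length ≤ p) (x : 𝒳) :
    |wordDeriv w (fun t => Real.log (predLik μ r t ys b x)) θ| ≤
      φ b + Real.log κ + ((1 + 2 ^ p) ^ 2 * s) ^ p := by
  have hs1 : 1 ≤ s := by linarith [h.sum_score_nonneg ys, h.one_le_score b]
  have hc : (1 : ℝ) ≤ 1 + 2 ^ p := by linarith [show (0 : ℝ) ≤ 2 ^ p by positivity]
  have hlog := h.abs_log_predLik_le hθ ys b x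
  rcases List.eq_nil_or_concat w with rfl | ⟨v, i, rfl⟩
  · rw [wordDeriv_nil]
    have : 0 ≤ ((1 + 2 ^ p) ^ 2 * s) ^ p := by positivity
    linarith
  · simp only [List.concat_eq_append, List.length_append, List.length_singleton] at hw ⊢
    rw [wordDeriv_append]
    have h1 := h.abs_wordDeriv_partialDeriv_log_predLik_le hθ ys b hs v i hw x
    have hcs : 1 ≤ (1 + 2 ^ p) * s := one_le_mul_of_one_le_of_one_le hc hs1
    have h2 : ((1 + 2 ^ p) * ((1 + 2 ^ p) * s)) ^ v.length * ((1 + 2 ^ p) * s) ≤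
        ((1 + 2 ^ p) ^ 2 * s) ^ p := by
      have e : (1 + 2 ^ p) * ((1 + 2 ^ p) * s) = (1 + 2 ^ p) ^ 2 * s := by ring
      have h3 : (1 + 2 ^ p) * s ≤ (1 + 2 ^ p) ^ 2 * s := by
        rw [← e]; exact le_mul_of_one_le_left (by positivity) hc
      rw [e]
      refine (mul_le_mul_of_nonneg_left h3 (by positivity)).trans ?_
      rw [← pow_succ]
      exact pow_le_pow_right₀ (hcs.trans h3) hw
    have h4 : 0 ≤ φ b + Real.log κ := (abs_nonneg _).trans hlog
    simp only [wordDeriv_cons, wordDeriv_nil]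
    linarith

/-- The growth constant of the derivatives of the predictive log-likelihood. -/
noncomputable def logGrowthConst (p : ℕ) (κ : ℝ) : ℝ :=
  (1 + 2 ^ p) * ((1 + 2 ^ p) + growthConst p κ + (1 + 2 ^ p) ^ 2)

theorem one_le_logGrowthConst (hκ : 1 ≤ κ) : 1 ≤ logGrowthConst p κ := by
  have h1 := le_growthConst (p := p) hκ
  have h2 : (1 : ℝ) ≤ 2 ^ p := one_le_pow₀ (by norm_num)
  unfold logGrowthConst
  nlinarith [sq_nonneg ((1 : ℝ) + 2 ^ p)]

theorem abs_log_sub_log_le {a b m : ℝ} (hm : 0 < m) (ha : m ≤ a) (hb : m ≤ b) :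
    |Real.log a - Real.log b| ≤ |a - b| / m := by
  have main : ∀ a b : ℝ, m ≤ a → m ≤ b → Real.log a - Real.log b ≤ |a - b| / m := by
    intro a b ha hb
    have ha0 := hm.trans_le ha
    have hb0 := hm.trans_le hb
    rw [← Real.log_div ha0.ne' hb0.ne']
    have h1 := Real.log_le_sub_one_of_pos (div_pos ha0 hb0)
    have h2 : a / b - 1 = (a - b) / b := by field_simp
    rw [h2] at h1
    refine h1.trans ((div_le_div_of_nonneg_right (le_abs_self _) hb0.le).trans ?_)
    exact div_le_div_of_nonneg_left (abs_nonneg _) hm hb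
  rw [abs_le]
  refine ⟨?_, main a b ha hb⟩
  have := main b a hb ha
  rw [abs_sub_comm] at this
  linarith

/-- All parameter derivatives of the predictive log-likelihood forget the first observation at a
geometric rate. -/
theorem wordDeriv_log_predLik_cons_sub_le (h : IsRegularFamily p Θ μ r κ ψ φ Φ) {θ : Euc d}
    (hθ : θ ∈ Θ) (b y : 𝒴) (ys : List 𝒴) {s : ℝ}
    (hs : ((y :: ys).map ψ).sum + ψ b ≤ s) (w : List (Fin d)) (hw : w.length ≤ p) (x : 𝒳) :
    |wordDeriv w (fun t => Real.log (predLik μ r t (y :: ys) b x)) θ -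
      wordDeriv w (fun t => Real.log (predLik μ r t ys b x)) θ| ≤
      2 * κ ^ 2 * (logGrowthConst p κ * s) ^ w.length * forgetRate κ ^ ys.length := by
  have hκ := zero_lt_one.trans_le h.one_le
  have hys : (ys.map ψ).sum + ψ b ≤ s := by
    have := h.one_le_score y
    simp only [List.map_cons, List.sum_cons] at hs
    linarith
  have hs0 : 0 ≤ s := by linarith [h.sum_score_nonneg ys, h.one_le_score b]
  have hc : (1 : ℝ) ≤ 1 + 2 ^ p := by linarith [show (0 : ℝ) ≤ 2 ^ p by positivity]
  have hq := forgetRate_pos h.one_le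
  have hK := le_growthConst (p := p) h.one_le
  -- With this `M` every predictive likelihood of `b` lies between `M / κ ^ 2` and `M`. An error
  -- proportional to `M` is thus a relative error, and the final bound is free of the size of the
  -- likelihood.
  set M := κ * predLik μ r θ [] b x with hMdef
  have hMpos : 0 < M := mul_pos hκ (h.predLik_pos hθ [] b x)
  have hM : ∀ z, predLik μ r θ [] b z ≤ M := fun z => h.predLik_nil_le_mul hθ b z x
  have hm : ∀ z, M / κ ^ 2 ≤ predLik μ r θ [] b z := fun z => by
    rw [div_le_iff₀ (by positivity), hMdef]
    have := mul_le_mul_of_nonneg_left (h.predLik_nil_le_mul hθ b x z) hκ.le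
    linarith
  have hlow : ∀ zs, M / κ ^ 2 ≤ predLik μ r θ zs b x := fun zs =>
    (h.predLik_mem_Icc hθ b hm hM zs x).1
  have hmpos : 0 < M / κ ^ 2 := by positivity
  set c : ℝ := 1 + 2 ^ p with hcdef
  set K : ℝ := growthConst p κ with hKdef
  have hK0 : 0 ≤ K := by linarith
  set f : Euc d → ℝ := fun t => predLik μ r t (y :: ys) b x with hf
  set g : Euc d → ℝ := fun t => predLik μ r t ys b x with hg
  have hE := h.wordDeriv_predLik_cons_sub_le hθ b hM y ys hs
  rw [← hcdef, ← hKdef] at hE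
  rcases List.eq_nil_or_concat w with rfl | ⟨v, i, rfl⟩
  · have h1 := hE [] (by simp) x
    simp only [wordDeriv_nil, List.length_nil, pow_zero, one_mul, mul_one] at h1 ⊢
    refine (abs_log_sub_log_le hmpos (hlow _) (hlow _)).trans ?_
    rw [div_le_iff₀ hmpos]
    refine h1.trans (le_of_eq ?_)
    field_simp
  · simp only [List.concat_eq_append, List.length_append, List.length_singleton] at hw ⊢
    obtain ⟨n, hn⟩ : ∃ n, p = n + 1 := ⟨p - 1, by omega⟩
    have hsf : WordDiffOn (n + 1) f Θ := hn ▸ h.smooth_predLik (y :: ys) b x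
    have hsg : WordDiffOn (n + 1) g Θ := hn ▸ h.smooth_predLik ys b x
    have hfp : ∀ t ∈ Θ, 0 < f t := fun t ht => h.predLik_pos ht (y :: ys) b x
    have hgp : ∀ t ∈ Θ, 0 < g t := fun t ht => h.predLik_pos ht ys b x
    have hlf := wordDiffOn_succ.1 (hsf.log h.isOpen fun t ht => (hfp t ht).ne')
    have hlg := wordDiffOn_succ.1 (hsg.log h.isOpen fun t ht => (hgp t ht).ne')
    have hsE := hsf.sub h.isOpen hsg
    have hsE' := wordDiffOn_succ.1 hsE
    have hvn : v.length ≤ n := by omega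
    set B : Euc d → ℝ := partialDeriv i (fun t => Real.log (g t)) with hB
    set A : Euc d → ℝ := partialDeriv i (fun t => Real.log (f t)) with hA
    set e : Euc d → ℝ := fun t => f t - g t with he
    -- From `f * A = ∂ᵢ f` and `g * B = ∂ᵢ g`. Each term on the right contains the small difference
    -- `e`, so the quotient bound yields a small difference of logarithmic derivatives.
    have hfe : Set.EqOn (fun t => f t * (A t - B t)) (fun t => partialDeriv i e t - e t * B t)
        Θ := by
      intro t ht
      have h1 := partialDeriv_log (hsf.differentiableAt (Nat.succ_pos n) ht) (hfp t ht).ne' i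
      have h2 := partialDeriv_log (hsg.differentiableAt (Nat.succ_pos n) ht) (hgp t ht).ne' i
      have h3 := wordDeriv_sub h.isOpen hsf hsg [i] (by simp) ht
      simp only [wordDeriv_cons, wordDeriv_nil] at h3
      have e1 : f t * A t = partialDeriv i f t := by
        rw [hA, h1, mul_inv_cancel_left₀ (hfp t ht).ne']
      have e2 : g t * B t = partialDeriv i g t := by
        rw [hB, h2, mul_inv_cancel_left₀ (hgp t ht).ne']
      beta_reduce
      rw [he, h3, ← e1, ← e2]
      ring
    have hbe : ∀ v : List (Fin d), v.length ≤ n + 1 → |wordDeriv v e θ| ≤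
        (c * s + K * s) ^ v.length * (2 * M * forgetRate κ ^ ys.length) := by
      intro v hv
      rw [he, wordDeriv_sub h.isOpen hsf hsg v hv hθ]
      exact hE v (by omega) x
    set ρ := 2 * M * forgetRate κ ^ ys.length with hρ
    have hρ0 : 0 ≤ ρ := by positivity
    have hKc : c * s + K * s ≤ (c + K + c ^ 2) * s := by nlinarith [sq_nonneg c]
    have hcs0 : 0 ≤ c * s + K * s := by positivity
    have hbB : ∀ v : List (Fin d), v.length ≤ n →
        |wordDeriv v B θ| ≤ (c * (c * s)) ^ v.length * (c * s) := fun v hv =>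
      h.abs_wordDeriv_partialDeriv_log_predLik_le hθ ys b hys v i (by omega) x
    have hnum : ∀ v : List (Fin d), v.length ≤ n →
        |wordDeriv v (fun t => partialDeriv i e t - e t * B t) θ| ≤
          ((c + K + c ^ 2) * s) ^ v.length * (ρ * ((2 * c + K) * s)) := by
      intro v hv
      have h1 := hbe (v ++ [i]) (by simpa using hv)
      rw [wordDeriv_append, List.length_append, List.length_singleton] at h1
      have h2 := abs_wordDeriv_mul_le h.isOpen (hsE.mono (Nat.le_succ n)) (hlg.2 i) hθ hρ0 hcs0
        (fun w hw => hbe w (by omega)) hbB v hv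
      rw [wordDeriv_sub h.isOpen (hsE'.2 i)
        ((hsE.mono (Nat.le_succ n)).mul h.isOpen (hlg.2 i)) v hv hθ]
      refine (abs_sub _ _).trans ((add_le_add h1 h2).trans ?_)
      have e1 : c * s + K * s + c * (c * s) = (c + K + c ^ 2) * s := by ring
      rw [e1, pow_succ, mul_assoc]
      have h3 := mul_le_mul_of_nonneg_right (pow_le_pow_left₀ hcs0 hKc v.length)
        (show 0 ≤ (c * s + K * s) * ρ by positivity)
      refine (add_le_add_left h3 _).trans (le_of_eq ?_)
      ring
    have hmain := abs_wordDeriv_div_le h.isOpen (n := n) (hsf.mono (Nat.le_succ n))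
      ((hlf.2 i).sub h.isOpen (hlg.2 i)) hfe hθ (a := (c + K + c ^ 2) * s)
      (G := ρ * ((2 * c + K) * s)) (hfp θ hθ) (by positivity) (by positivity)
      (fun w hw => (h.abs_wordDeriv_predLik_le hθ (y :: ys) b x hs w (by omega)).trans
        (mul_le_mul_of_nonneg_right (pow_le_pow_left₀ (by positivity)
          ((le_add_of_nonneg_right (by positivity)).trans hKc) _) (hfp θ hθ).le))
      hnum v hvn
    rw [wordDeriv_sub h.isOpen (hlf.2 i) (hlg.2 i) v hvn hθ] at hmain
    rw [wordDeriv_append, wordDeriv_append]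
    refine hmain.trans ?_
    have hD : (1 : ℝ) + 2 ^ n ≤ c := by
      have : (2 : ℝ) ^ n ≤ 2 ^ p := pow_le_pow_right₀ (by norm_num) (by omega)
      linarith
    have h4 : ((1 + 2 ^ n) * ((c + K + c ^ 2) * s)) ^ v.length ≤
        (logGrowthConst p κ * s) ^ v.length := by
      refine pow_le_pow_left₀ (by positivity) ?_ _
      rw [logGrowthConst, mul_assoc]
      exact mul_le_mul_of_nonneg_right hD (by positivity)
    have h5 : ρ * ((2 * c + K) * s) / f θ ≤
        2 * κ ^ 2 * forgetRate κ ^ ys.length * (logGrowthConst p κ * s) := by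
      rw [div_le_iff₀ (hfp θ hθ)]
      have h6 : 2 * c + K ≤ logGrowthConst p κ := by
        rw [logGrowthConst, ← hcdef, ← hKdef]; nlinarith [sq_nonneg c]
      have h7 : M ≤ κ ^ 2 * f θ := by
        have := hlow (y :: ys)
        rw [div_le_iff₀ (by positivity)] at this
        linarith
      calc ρ * ((2 * c + K) * s) = M * (2 * forgetRate κ ^ ys.length * ((2 * c + K) * s)) := by
            rw [hρ]; ring
        _ ≤ (κ ^ 2 * f θ) * (2 * forgetRate κ ^ ys.length * (logGrowthConst p κ * s)) :=
            mul_le_mul h7 (by gcongr) (by positivity) (mul_nonneg (by positivity) (hfp θ hθ).le)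
        _ = _ := by ring
    refine (mul_le_mul h4 h5 (div_nonneg (by positivity) (hfp θ hθ).le) ?_).trans (le_of_eq ?_)
    · have := one_le_logGrowthConst (p := p) h.one_le
      positivity
    · ring

end IsRegularFamily

end


/-! ### Integrals under laws close in total variation. -/

section TotalVariation

variable {α : Type*} [MeasurableSpace α]

/-- Layer cake: `g + G` takes values in `[0, 2G]`, so its integral is that of its tail probabilities
over an interval of length `2G`, and the tails differ by at most `η`. -/
theorem abs_integral_sub_integral_le {m₁ m₂ : Measure α} [IsProbabilityMeasure m₁]
    [IsProbabilityMeasure m₂] {η G : ℝ}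
    (h : ∀ B, MeasurableSet B → |m₁.real B - m₂.real B| ≤ η) {g : α → ℝ} (hg : Measurable g)
    (hG : ∀ a, |g a| ≤ G) : |∫ a, g a ∂m₁ - ∫ a, g a ∂m₂| ≤ 2 * G * η := by
  rcases isEmpty_or_nonempty α with hα | ⟨⟨a₀⟩⟩
  · exact absurd (measure_univ (μ := m₁)) (by simp [Set.eq_empty_of_isEmpty])
  have hG0 : 0 ≤ G := (abs_nonneg _).trans (hG a₀)
  have hint : ∀ m : Measure α, IsProbabilityMeasure m → Integrable g m := fun m _ =>
    Integrable.of_bound hg.aestronglyMeasurable G (Filter.Eventually.of_forall hG)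
  have key : ∀ m : Measure α, IsProbabilityMeasure m → ∫ a, g a ∂m + G =
      ∫ t in Set.Ioc 0 (2 * G), m.real {a | t ≤ g a + G} := by
    intro m hm
    have h1 := Integrable.integral_eq_integral_Ioc_meas_le (M := 2 * G)
      ((hint m hm).add (integrable_const G)) ?_ ?_
    · simp only [Pi.add_apply] at h1
      rw [← h1, integral_add (hint m hm) (integrable_const G)]
      simp
    · exact Filter.Eventually.of_forall fun a => by
        have := (abs_le.1 (hG a)).1
        simp only [Pi.zero_apply, Pi.add_apply]; linarith
    · exact Filter.Eventually.of_forall fun a => by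
        have := (abs_le.1 (hG a)).2
        simp only [Pi.add_apply]; linarith
  have hti : ∀ m : Measure α, IsProbabilityMeasure m →
      IntegrableOn (fun t => m.real {a | t ≤ g a + G}) (Set.Ioc 0 (2 * G)) := by
    intro m hm
    have hanti : Antitone fun t : ℝ => m.real {a | t ≤ g a + G} := fun s t hst =>
      measureReal_mono fun a (ha : t ≤ g a + G) => hst.trans ha
    exact Integrable.of_bound hanti.measurable.aestronglyMeasurable 1
      (Filter.Eventually.of_forall fun t => by
        rw [Real.norm_of_nonneg measureReal_nonneg]; exact measureReal_le_one)
  have e : ∫ a, g a ∂m₁ - ∫ a, g a ∂m₂ =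
      ∫ t in Set.Ioc 0 (2 * G), (m₁.real {a | t ≤ g a + G} - m₂.real {a | t ≤ g a + G}) := by
    rw [integral_sub (hti m₁ inferInstance) (hti m₂ inferInstance), ← key m₁ inferInstance,
      ← key m₂ inferInstance]
    ring
  rw [e]
  have := norm_setIntegral_le_of_norm_le_const (μ := volume) (s := Set.Ioc 0 (2 * G)) (C := η)
    (f := fun t => m₁.real {a | t ≤ g a + G} - m₂.real {a | t ≤ g a + G}) measure_Ioc_lt_top
    (fun t _ => h _ (measurableSet_le measurable_const (hg.add_const G)))
  rw [Real.norm_eq_abs] at this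
  refine this.trans (le_of_eq ?_)
  rw [Real.volume_real_Ioc_of_le (by linarith)]
  ring

end TotalVariation

/-! ### The true model: path laws and convergence to stationarity. -/

section Chain

variable {𝒳 𝒴 : Type*} [MeasurableSpace 𝒳] [MeasurableSpace 𝒴]

/-- The joint transition kernel `x ↦ P(x,dx') Q(x',dy)`. -/
noncomputable def jointKernel (P : Kernel 𝒳 𝒳) (Q : Kernel 𝒳 𝒴) : Kernel 𝒳 (𝒳 × 𝒴) :=
  P ⊗ₖ Kernel.prodMkLeft 𝒳 Q

/-- One transition of the model, which records the new observation at time `m`. -/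
noncomputable def recordKernel (P : Kernel 𝒳 𝒳) (Q : Kernel 𝒳 𝒴) (m : ℕ) :
    Kernel ((ℕ → 𝒴) × 𝒳) ((ℕ → 𝒴) × 𝒳) :=
  (Kernel.id ×ₖ Kernel.prodMkLeft (ℕ → 𝒴) (jointKernel P Q)).map
    fun z : ((ℕ → 𝒴) × 𝒳) × 𝒳 × 𝒴 => (Function.update z.1.1 m z.2.2, z.2.1)

/-- The law of the first `m` observations and of the `m`-th state, given the initial state. The
remaining entries of the record have the default value `y₀`. -/
noncomputable def pathKernel (P : Kernel 𝒳 𝒳) (Q : Kernel 𝒳 𝒴) (y₀ : 𝒴) :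
    ℕ → Kernel 𝒳 ((ℕ → 𝒴) × 𝒳)
  | 0 => Kernel.deterministic (fun x => (fun _ => y₀, x)) (by fun_prop)
  | m + 1 => recordKernel P Q m ∘ₖ pathKernel P Q y₀ m

/-- The first `m` entries of a sequence, continued by the default value `y₀`. -/
def truncate (y₀ : 𝒴) (m : ℕ) (f : ℕ → 𝒴) : ℕ → 𝒴 := fun i => if i < m then f i else y₀

variable {P : Kernel 𝒳 𝒳} {Q : Kernel 𝒳 𝒴} [IsMarkovKernel P] [IsMarkovKernel Q]

instance : IsMarkovKernel (jointKernel P Q) := by unfold jointKernel; infer_instance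

theorem measurable_record (m : ℕ) : Measurable fun z : ((ℕ → 𝒴) × 𝒳) × 𝒳 × 𝒴 =>
    (Function.update z.1.1 m z.2.2, z.2.1) := by
  refine Measurable.prodMk ?_ (by fun_prop)
  exact measurable_update'.comp (f := fun z : ((ℕ → 𝒴) × 𝒳) × 𝒳 × 𝒴 => (z.1.1, z.2.2))
    (by fun_prop)

instance (m : ℕ) : IsMarkovKernel (recordKernel P Q m) :=
  Kernel.IsMarkovKernel.map _ (measurable_record m)

instance (y₀ : 𝒴) (m : ℕ) : IsMarkovKernel (pathKernel P Q y₀ m) := by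
  induction m with
  | zero => unfold pathKernel; infer_instance
  | succ m ih => unfold pathKernel; infer_instance

theorem lintegral_recordKernel (m : ℕ) (z : (ℕ → 𝒴) × 𝒳) {F : (ℕ → 𝒴) × 𝒳 → ℝ≥0∞}
    (hF : Measurable F) : ∫⁻ a, F a ∂(recordKernel P Q m z) =
      ∫⁻ a, F (Function.update z.1 m a.2, a.1) ∂(jointKernel P Q z.2) := by
  unfold recordKernel
  rw [Kernel.lintegral_map _ (measurable_record m) _ hF,
    Kernel.lintegral_id_prod (f := fun z : ((ℕ → 𝒴) × 𝒳) × 𝒳 × 𝒴 =>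
      F (Function.update z.1.1 m z.2.2, z.2.1)) (hF.comp (measurable_record m))]
  rfl

theorem lintegral_jointKernel_snd (x : 𝒳) {g : 𝒴 → ℝ≥0∞} (hg : Measurable g) :
    ∫⁻ a, g a.2 ∂(jointKernel P Q x) = ∫⁻ x', ∫⁻ y, g y ∂(Q x') ∂(P x) := by
  unfold jointKernel
  rw [Kernel.lintegral_compProd (f := fun a : 𝒳 × 𝒴 => g a.2) _ _ _ (hg.comp measurable_snd)]
  rfl

theorem lintegral_jointKernel_snd_le (x : 𝒳) {g : 𝒴 → ℝ≥0∞} (hg : Measurable g) {C : ℝ≥0∞}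
    (hC : ∀ x, ∫⁻ y, g y ∂(Q x) ≤ C) : ∫⁻ a, g a.2 ∂(jointKernel P Q x) ≤ C := by
  rw [lintegral_jointKernel_snd x hg]
  refine (lintegral_mono fun x' => hC x').trans ?_
  simp

/-- Entry `i` of the record is drawn from `Q` at step `i`, and later updates leave it unchanged. -/
theorem lintegral_pathKernel_le (y₀ : 𝒴) {g : 𝒴 → ℝ≥0∞} (hg : Measurable g) {C : ℝ≥0∞}
    (hC : ∀ x, ∫⁻ y, g y ∂(Q x) ≤ C) (m i : ℕ) (hi : i < m) (x : 𝒳) :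
    ∫⁻ z, g (z.1 i) ∂(pathKernel P Q y₀ m x) ≤ C := by
  induction m with
  | zero => omega
  | succ m ih =>
    have hF : Measurable fun z : (ℕ → 𝒴) × 𝒳 => g (z.1 i) := by fun_prop
    unfold pathKernel
    rw [Kernel.lintegral_comp _ _ _ hF]
    simp_rw [lintegral_recordKernel m _ hF]
    rcases eq_or_ne i m with rfl | him
    · simp only [Function.update_self]
      refine (lintegral_mono fun z : (ℕ → 𝒴) × 𝒳 =>
        lintegral_jointKernel_snd_le z.2 hg hC).trans ?_
      simp
    · simp only [Function.update_of_ne him]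
      simp only [lintegral_const, measure_univ, mul_one]
      exact ih (by omega)

variable {Ω : Type*} [MeasurableSpace Ω] {Pr : Measure Ω} [IsProbabilityMeasure Pr]
  {X : ℕ → Ω → 𝒳} {Y : ℕ → Ω → 𝒴}

namespace IsStateSpaceModel

omit [IsMarkovKernel P] [IsMarkovKernel Q] [IsProbabilityMeasure Pr] in
theorem measurable_hist (h : IsStateSpaceModel Pr P Q X Y) (n : ℕ) :
    Measurable fun ω (k : Fin (n + 1)) => (X k ω, Y k ω) :=
  measurable_pi_iff.2 fun k => (h.measurable_state k).prodMk (h.measurable_obs k)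

/-- The conditional probabilities in the hypothesis become a disintegration of the joint law of
history and next pair. It is enough to compare rectangles, where integrating the conditional
probability over an event of the history gives the identity. -/
theorem map_hist_next (h : IsStateSpaceModel Pr P Q X Y) (n : ℕ) :
    Pr.map (fun ω => ((fun k : Fin (n + 1) => (X k ω, Y k ω)), (X (n + 1) ω, Y (n + 1) ω))) =
      (Pr.map fun ω (k : Fin (n + 1)) => (X k ω, Y k ω)) ⊗ₘ
        ((jointKernel P Q).comap (fun z : Fin (n + 1) → 𝒳 × 𝒴 => (z (Fin.last n)).1)
          (by fun_prop)) := by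
  have hZ := h.measurable_hist n
  have hW : Measurable fun ω => (X (n + 1) ω, Y (n + 1) ω) :=
    (h.measurable_state _).prodMk (h.measurable_obs _)
  have := Measure.isProbabilityMeasure_map (μ := Pr) hZ.aemeasurable
  have := Measure.isProbabilityMeasure_map (μ := Pr) (hZ.prodMk hW).aemeasurable
  refine Measure.ext_prod fun {A B} hA hB => ?_
  rw [Measure.compProd_apply_prod hA hB, setLIntegral_map hA
    (Kernel.measurable_coe _ hB) hZ, Measure.map_apply (hZ.prodMk hW) (hA.prod hB)]
  have hm : MeasurableSpace.comap (fun ω (k : Fin (n + 1)) => (X k ω, Y k ω)) inferInstance ≤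
    (inferInstance : MeasurableSpace Ω) := hZ.comap_le
  have h1 : ∫ ω in (fun ω (k : Fin (n + 1)) => (X k ω, Y k ω)) ⁻¹' A,
      (Pr⟦(fun ω => (X (n + 1) ω, Y (n + 1) ω)) ⁻¹' B |
        MeasurableSpace.comap (fun ω (k : Fin (n + 1)) => (X k ω, Y k ω)) inferInstance⟧) ω ∂Pr =
      ∫ ω in (fun ω (k : Fin (n + 1)) => (X k ω, Y k ω)) ⁻¹' A,
        ((fun ω => (X (n + 1) ω, Y (n + 1) ω)) ⁻¹' B).indicator (fun _ => (1 : ℝ)) ω ∂Pr :=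
    setIntegral_condExp hm ((integrable_const (1 : ℝ)).indicator (hW hB)) ⟨A, hA, rfl⟩
  rw [setIntegral_congr_ae (hZ hA) ((h.markov n B hB).mono fun ω hω _ => hω)] at h1
  have e : ∀ ω, (∫⁻ x, Q x {y | (x, y) ∈ B} ∂(P (X n ω))) = jointKernel P Q (X n ω) B :=
    fun ω => by
      unfold jointKernel
      rw [Kernel.compProd_apply hB]
      rfl
  simp_rw [e] at h1
  have hmX : Measurable fun ω => jointKernel P Q (X n ω) B :=
    (Kernel.measurable_coe _ hB).comp (h.measurable_state n)
  rw [integral_toReal hmX.aemeasurable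
    (Filter.Eventually.of_forall fun ω => measure_lt_top _ _), integral_indicator (hW hB),
    setIntegral_const, smul_eq_mul, mul_one, measureReal_restrict_apply (hW hB),
    measureReal_def] at h1
  rw [← ENNReal.toReal_eq_toReal_iff' (measure_ne_top _ _) (ne_of_lt ?_)]
  · refine Eq.trans ?_ h1.symm
    rw [Set.inter_comm]
    rfl
  · refine (lintegral_mono fun ω => prob_le_one).trans_lt ?_
    simp

theorem lintegral_next (h : IsStateSpaceModel Pr P Q X Y) (n : ℕ)
    {F : (Fin (n + 1) → 𝒳 × 𝒴) × 𝒳 × 𝒴 → ℝ≥0∞} (hF : Measurable F) :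
    ∫⁻ ω, F ((fun k => (X k ω, Y k ω)), (X (n + 1) ω, Y (n + 1) ω)) ∂Pr =
      ∫⁻ ω, ∫⁻ z, F ((fun k => (X k ω, Y k ω)), z) ∂(jointKernel P Q (X n ω)) ∂Pr := by
  have hZ := h.measurable_hist n
  have hW : Measurable fun ω => (X (n + 1) ω, Y (n + 1) ω) :=
    (h.measurable_state _).prodMk (h.measurable_obs _)
  have := Measure.isProbabilityMeasure_map (μ := Pr) hZ.aemeasurable
  rw [← lintegral_map hF (hZ.prodMk hW), h.map_hist_next, Measure.lintegral_compProd hF,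
    lintegral_map hF.lintegral_kernel_prod_right' hZ]
  rfl

theorem lintegral_obs_le (h : IsStateSpaceModel Pr P Q X Y) (n : ℕ) {g : 𝒴 → ℝ≥0∞}
    (hg : Measurable g) {C : ℝ≥0∞} (hC : ∀ x, ∫⁻ y, g y ∂(Q x) ≤ C) :
    ∫⁻ ω, g (Y (n + 1) ω) ∂Pr ≤ C := by
  rw [h.lintegral_next n (F := fun z => g z.2.2) (by fun_prop)]
  refine (lintegral_mono fun ω => lintegral_jointKernel_snd_le (X n ω) hg hC).trans ?_
  simp

omit [IsMarkovKernel P] [IsMarkovKernel Q] [IsProbabilityMeasure Pr] in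
theorem measurable_truncate (h : IsStateSpaceModel Pr P Q X Y) (y₀ : 𝒴) (m j : ℕ) :
    Measurable fun ω => truncate y₀ m fun i => Y (j + i) ω := by
  refine measurable_pi_iff.2 fun i => ?_
  unfold truncate
  split_ifs
  · exact h.measurable_obs _
  · exact measurable_const

/-- The law of the observations after time `j` is determined by the law of the state at
time `j`. -/
theorem map_path (h : IsStateSpaceModel Pr P Q X Y) (y₀ : 𝒴) (j m : ℕ) :
    Pr.map (fun ω => (truncate y₀ m (fun i => Y (j + 1 + i) ω), X (j + m) ω)) =
      pathKernel P Q y₀ m ∘ₘ Pr.map (X j) := by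
  induction m with
  | zero =>
    unfold pathKernel
    rw [Measure.deterministic_comp_eq_map, Measure.map_map (by fun_prop) (h.measurable_state j)]
    rfl
  | succ m ih =>
    have e : pathKernel P Q y₀ (m + 1) = recordKernel P Q m ∘ₖ pathKernel P Q y₀ m := rfl
    rw [e, ← Measure.comp_assoc, ← ih]
    have hM : ∀ m, Measurable fun ω =>
        (truncate y₀ m (fun i => Y (j + 1 + i) ω), X (j + m) ω) := fun m =>
      (h.measurable_truncate y₀ m (j + 1)).prodMk (h.measurable_state _)
    refine Measure.ext_of_lintegral _ fun F hF => ?_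
    rw [lintegral_map hF (hM _), Measure.lintegral_bind (Kernel.aemeasurable _) hF.aemeasurable,
      lintegral_map hF.lintegral_kernel (hM m)]
    simp_rw [lintegral_recordKernel m _ hF]
    -- The record as a function of the history up to time `j + m`, so that the one-step property at
    -- that time applies.
    let T : (Fin (j + m + 1) → 𝒳 × 𝒴) → ℕ → 𝒴 := fun z i =>
      if hi : i < m then (z ⟨j + 1 + i, by omega⟩).2 else y₀
    have hT : Measurable T := by
      refine measurable_pi_iff.2 fun i => ?_
      by_cases hi : i < m
      · simp only [T, hi, dite_true]; fun_prop
      · simp only [T, hi, dite_false]; fun_prop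
    have hTY : ∀ ω, T (fun k => (X k ω, Y k ω)) = truncate y₀ m fun i => Y (j + 1 + i) ω := by
      intro ω; funext i
      by_cases hi : i < m <;> simp [T, truncate, hi]
    have key := h.lintegral_next (j + m)
      (F := fun z => F (Function.update (T z.1) m z.2.2, z.2.1)) (hF.comp
        ((measurable_record (𝒳 := 𝒳) m).comp
          (f := fun z : (Fin (j + m + 1) → 𝒳 × 𝒴) × 𝒳 × 𝒴 => ((T z.1, z.2.1), z.2))
          (by fun_prop)))
    simp only [hTY] at key
    rw [← key]
    refine lintegral_congr fun ω => ?_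
    congr 2
    funext i
    rcases lt_trichotomy i m with hi | rfl | hi
    · simp [truncate, hi, hi.ne, hi.trans (Nat.lt_succ_self m)]
    · simp [truncate, add_right_comm]
    · simp [truncate, hi.ne', hi.not_gt, show ¬ i < m + 1 by omega]

theorem map_state_succ (h : IsStateSpaceModel Pr P Q X Y) (n : ℕ) {B : Set 𝒳}
    (hB : MeasurableSet B) : Pr.map (X (n + 1)) B = ∫⁻ x, P x B ∂(Pr.map (X n)) := by
  have key := h.lintegral_next n (F := fun z => B.indicator 1 z.2.1)
    ((measurable_one.indicator hB).comp (by fun_prop))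
  rw [lintegral_map (Kernel.measurable_coe _ hB) (h.measurable_state n)]
  have e1 : ∫⁻ ω, B.indicator 1 (X (n + 1) ω) ∂Pr = Pr.map (X (n + 1)) B := by
    rw [← lintegral_map (measurable_one.indicator hB) (h.measurable_state _),
      lintegral_indicator_one hB]
  rw [← e1, key]
  refine lintegral_congr fun ω => ?_
  unfold jointKernel
  rw [Kernel.lintegral_compProd (f := fun a : 𝒳 × 𝒴 => B.indicator 1 a.1) _ _ _
    ((measurable_one.indicator hB).comp measurable_fst)]
  simp [lintegral_indicator_one hB]

theorem map_state (h : IsStateSpaceModel Pr P Q X Y) (n : ℕ) {B : Set 𝒳}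
    (hB : MeasurableSet B) : Pr.map (X n) B = ∫⁻ x, (P ^ n) x B ∂(Pr.map (X 0)) := by
  have : Pr.map (X n) = (P ^ n) ∘ₘ Pr.map (X 0) := by
    induction n with
    | zero =>
      rw [pow_zero]
      exact (Measure.id_comp (μ := Pr.map (X 0))).symm
    | succ n ih =>
      have e : P ^ (n + 1) = P ∘ₖ (P ^ n) := pow_succ' P n
      rw [e, ← Measure.comp_assoc, ← ih]
      refine Measure.ext fun B hB => ?_
      rw [h.map_state_succ n hB, Measure.bind_apply hB (Kernel.aemeasurable _)]
  rw [this, Measure.bind_apply hB (Kernel.aemeasurable _)]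

theorem abs_map_state_sub_le (h : IsStateSpaceModel Pr P Q X Y) {π : Measure 𝒳} {δ K₀ : ℝ}
    (herg : GeometricallyErgodic P π δ K₀) (n : ℕ) {B : Set 𝒳} (hB : MeasurableSet B) :
    |(Pr.map (X n)).real B - π.real B| ≤ K₀ * δ ^ n := by
  have := Measure.isProbabilityMeasure_map (μ := Pr) (h.measurable_state 0).aemeasurable
  have hmk : IsMarkovKernel (P ^ n) := by
    induction n with
    | zero => exact inferInstanceAs (IsMarkovKernel (Kernel.id : Kernel 𝒳 𝒳))
    | succ n ih =>
      have e : P ^ (n + 1) = P ∘ₖ (P ^ n) := pow_succ' P n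
      rw [e]; infer_instance
  have hmeas : Measurable fun x => ((P ^ n) x).real B := (Kernel.measurable_coe _ hB).ennreal_toReal
  have hint : Integrable (fun x => ((P ^ n) x).real B) (Pr.map (X 0)) :=
    Integrable.of_bound hmeas.aestronglyMeasurable 1 (Filter.Eventually.of_forall fun x => by
      rw [Real.norm_of_nonneg measureReal_nonneg]; exact measureReal_le_one)
  have e : (Pr.map (X n)).real B = ∫ x, ((P ^ n) x).real B ∂(Pr.map (X 0)) := by
    rw [measureReal_def, h.map_state n hB]
    exact (integral_toReal (Kernel.measurable_coe _ hB).aemeasurable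
      (Filter.Eventually.of_forall fun x => measure_lt_top _ _)).symm
  have e2 : (Pr.map (X n)).real B - π.real B =
      ∫ x, (((P ^ n) x).real B - π.real B) ∂(Pr.map (X 0)) := by
    rw [integral_sub hint (integrable_const _), e]
    simp
  rw [e2]
  have := norm_integral_le_of_norm_le_const (μ := Pr.map (X 0))
    (f := fun x => ((P ^ n) x).real B - π.real B)
    (Filter.Eventually.of_forall fun x => herg.bound x B hB n)
  simpa using this

/-- Expectations of functions of `m` consecutive observations become stationary at a geometric
rate. -/
theorem abs_expectation_shift_le (h : IsStateSpaceModel Pr P Q X Y) {π : Measure 𝒳} {δ K₀ : ℝ}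
    (herg : GeometricallyErgodic P π δ K₀) (y₀ : 𝒴) (m : ℕ) {F : (ℕ → 𝒴) → ℝ}
    (hF : Measurable F) (hFm : ∀ f, F (truncate y₀ m f) = F f) {G : ℝ}
    (hG : ∀ x, ∫⁻ z, ‖F z.1‖ₑ ∂(pathKernel P Q y₀ m x) ≤ ENNReal.ofReal G) (j : ℕ) :
    |∫ ω, F (fun i => Y (j + 1 + 1 + i) ω) ∂Pr - ∫ ω, F (fun i => Y (j + 1 + i) ω) ∂Pr| ≤
      4 * max G 0 * (K₀ * δ ^ j) := by
  -- `g` is the expectation of `F` given the state just before the window. It is bounded, so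
  -- shifting the window amounts to integrating one bounded function against the laws of two
  -- consecutive states.
  set g : 𝒳 → ℝ := fun x => ∫ z, F z.1 ∂(pathKernel P Q y₀ m x) with hg
  have hF1 : Measurable fun z : (ℕ → 𝒴) × 𝒳 => F z.1 := hF.comp measurable_fst
  have hgm : Measurable g := by
    have : StronglyMeasurable g := hF1.stronglyMeasurable.integral_kernel
    exact this.measurable
  have hgG : ∀ x, |g x| ≤ max G 0 := fun x => by
    have h1 := enorm_integral_le_lintegral_enorm (μ := pathKernel P Q y₀ m x)
      (fun z : (ℕ → 𝒴) × 𝒳 => F z.1)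
    have h2 := ENNReal.toReal_mono ENNReal.ofReal_ne_top (h1.trans (hG x))
    rwa [toReal_enorm, ENNReal.toReal_ofReal'] at h2
  have hE : ∀ j, ∫ ω, F (fun i => Y (j + 1 + i) ω) ∂Pr = ∫ x, g x ∂(Pr.map (X j)) := by
    intro j
    have := Measure.isProbabilityMeasure_map (μ := Pr) (h.measurable_state j).aemeasurable
    have hM : Measurable fun ω =>
        (truncate y₀ m (fun i => Y (j + 1 + i) ω), X (j + m) ω) :=
      (h.measurable_truncate y₀ m (j + 1)).prodMk (h.measurable_state _)
    have h1 : ∫ ω, F (fun i => Y (j + 1 + i) ω) ∂Pr =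
        ∫ z, F z.1 ∂(pathKernel P Q y₀ m ∘ₘ Pr.map (X j)) := by
      rw [← h.map_path, integral_map hM.aemeasurable hF1.aestronglyMeasurable]
      simp_rw [hFm]
    rw [h1, Measure.comp_eq_comp_const_apply, Kernel.integral_comp, Kernel.const_apply]
    rw [← Measure.comp_eq_comp_const_apply]
    refine ⟨hF1.aestronglyMeasurable, ?_⟩
    rw [HasFiniteIntegral, Measure.lintegral_bind (Kernel.aemeasurable _)
      hF1.enorm.aemeasurable]
    refine (lintegral_mono fun x => hG x).trans_lt ?_
    simp
  rw [hE (j + 1), hE j]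
  have i1 := Measure.isProbabilityMeasure_map (μ := Pr) (h.measurable_state j).aemeasurable
  have i2 := Measure.isProbabilityMeasure_map (μ := Pr) (h.measurable_state (j + 1)).aemeasurable
  -- Both laws are compared with `π`, which gives the factor `2` in `η`.
  refine (abs_integral_sub_integral_le (η := 2 * (K₀ * δ ^ j)) (fun B hB => ?_) hgm hgG).trans
    (le_of_eq (by ring))
  have h1 := h.abs_map_state_sub_le herg j hB
  have h2 := h.abs_map_state_sub_le herg (j + 1) hB
  have h3 : K₀ * δ ^ (j + 1) ≤ K₀ * δ ^ j :=
    mul_le_mul_of_nonneg_left (pow_le_pow_of_le_one herg.delta_pos.le herg.delta_lt_one.le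
      (Nat.le_succ j)) (zero_le_one.trans herg.one_le)
  rw [abs_le] at h1 h2 ⊢
  constructor <;> linarith [h1.1, h1.2, h2.1, h2.2]

end IsStateSpaceModel

end Chain


/-! ### Moments of sums and summability. -/

section Auxiliary

theorem integrable_and_integral_le_of_lintegral_le {α : Type*} [MeasurableSpace α]
    {m : Measure α} {f : α → ℝ} (hf : Measurable f) (h0 : ∀ a, 0 ≤ f a) {C : ℝ} (hC : 0 ≤ C)
    (h : ∫⁻ a, ENNReal.ofReal (f a) ∂m ≤ ENNReal.ofReal C) :
    Integrable f m ∧ ∫ a, f a ∂m ≤ C := by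
  have h1 : Integrable f m := by
    refine ⟨hf.aestronglyMeasurable, ?_⟩
    rw [hasFiniteIntegral_iff_ofReal (Filter.Eventually.of_forall h0)]
    exact h.trans_lt ENNReal.ofReal_lt_top
  refine ⟨h1, ?_⟩
  rw [← ofReal_integral_eq_lintegral_ofReal h1 (Filter.Eventually.of_forall h0)] at h
  exact (ENNReal.ofReal_le_ofReal_iff hC).1 h

theorem pow_sum_range_le (a : ℕ → ℝ) (ha : ∀ i, 0 ≤ a i) (n p : ℕ) :
    (∑ i ∈ Finset.range (n + 1), a i) ^ p ≤
      ((n : ℝ) + 1) ^ p * ∑ i ∈ Finset.range (n + 1), a i ^ p := by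
  obtain ⟨k, hk, hmax⟩ := Finset.exists_max_image (Finset.range (n + 1)) a ⟨0, by simp⟩
  have h1 : ∑ i ∈ Finset.range (n + 1), a i ≤ ((n : ℝ) + 1) * a k := by
    refine (Finset.sum_le_sum hmax).trans ?_
    simp
  calc (∑ i ∈ Finset.range (n + 1), a i) ^ p ≤ (((n : ℝ) + 1) * a k) ^ p :=
        pow_le_pow_left₀ (Finset.sum_nonneg fun i _ => ha i) h1 p
    _ = ((n : ℝ) + 1) ^ p * a k ^ p := mul_pow _ _ _
    _ ≤ _ := by
        refine mul_le_mul_of_nonneg_left ?_ (by positivity)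
        exact Finset.single_le_sum (f := fun i => a i ^ p) (fun i _ => pow_nonneg (ha i) p) hk

theorem lintegral_pow_sum_le {α : Type*} [MeasurableSpace α] {m : Measure α}
    {a : ℕ → α → ℝ} (ha : ∀ i, Measurable (a i)) (h0 : ∀ i x, 0 ≤ a i x) {n p : ℕ} {M₀ : ℝ}
    (hM : ∀ i ≤ n, ∫⁻ x, ENNReal.ofReal (a i x ^ p) ∂m ≤ ENNReal.ofReal M₀) :
    ∫⁻ x, ENNReal.ofReal ((∑ i ∈ Finset.range (n + 1), a i x) ^ p) ∂m ≤
      ENNReal.ofReal (((n : ℝ) + 1) ^ (p + 1) * M₀) := by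
  have h1 : ∀ x, ENNReal.ofReal ((∑ i ∈ Finset.range (n + 1), a i x) ^ p) ≤
      ENNReal.ofReal (((n : ℝ) + 1) ^ p) *
        ∑ i ∈ Finset.range (n + 1), ENNReal.ofReal (a i x ^ p) := fun x => by
    rw [← ENNReal.ofReal_sum_of_nonneg fun i _ => pow_nonneg (h0 i x) p,
      ← ENNReal.ofReal_mul (by positivity)]
    exact ENNReal.ofReal_le_ofReal (pow_sum_range_le (fun i => a i x) (fun i => h0 i x) n p)
  refine (lintegral_mono h1).trans ?_
  rw [lintegral_const_mul' _ _ ENNReal.ofReal_ne_top,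
    lintegral_finsetSum _ fun i _ => ((ha i).pow_const p).ennreal_ofReal]
  refine (mul_le_mul_right (Finset.sum_le_sum fun i hi =>
    hM i (Nat.lt_succ_iff.1 (Finset.mem_range.1 hi))) _).trans ?_
  rw [Finset.sum_const, Finset.card_range, nsmul_eq_mul, pow_succ, mul_assoc,
    ENNReal.ofReal_mul (by positivity), ENNReal.ofReal_mul (by positivity : (0 : ℝ) ≤ n + 1)]
  refine le_of_eq ?_
  congr 2
  rw [← Nat.cast_succ, ENNReal.ofReal_natCast]

theorem exists_tendstoUniformlyOn_of_summable {E : Type*} {s : Set E} {F : ℕ → E → ℝ}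
    {b : ℕ → ℝ} (hb : Summable b) (h : ∀ n, ∀ θ ∈ s, |F (n + 1) θ - F n θ| ≤ b n) :
    ∃ G : E → ℝ, TendstoUniformlyOn F G atTop s := by
  have h1 : ∀ θ ∈ s, ∀ n, dist (F n θ) (F (n + 1) θ) ≤ b n := fun θ hθ n => by
    rw [dist_comm, Real.dist_eq]; exact h n θ hθ
  have h2 : ∀ θ, ∃ g, θ ∈ s → Tendsto (fun n => F n θ) atTop (𝓝 g) := fun θ => by
    by_cases hθ : θ ∈ s
    · obtain ⟨g, hg⟩ := cauchySeq_tendsto_of_complete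
        (cauchySeq_of_dist_le_of_summable b (h1 θ hθ) hb)
      exact ⟨g, fun _ => hg⟩
    · exact ⟨0, fun h => absurd h hθ⟩
  choose G hG using h2
  refine ⟨G, Metric.tendstoUniformlyOn_iff.2 fun ε hε => ?_⟩
  filter_upwards [(tendsto_sum_nat_add b).eventually (gt_mem_nhds hε)] with n hn θ hθ
  rw [dist_comm]
  refine (dist_le_tsum_of_dist_le_of_tendsto b (h1 θ hθ) hb (hG θ hθ) n).trans_lt ?_
  simpa only [add_comm] using hn

theorem summable_poly_mul_geometric (k : ℕ) {τ : ℝ} (h0 : 0 < τ) (h1 : τ < 1) (C : ℝ) :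
    Summable fun n : ℕ => C * ((n : ℝ) + 2) ^ k * τ ^ n := by
  have h2 := (summable_nat_add_iff 2).2 (summable_pow_mul_geometric_of_norm_lt_one k
    (r := τ) (by rwa [Real.norm_of_nonneg h0.le]))
  refine (h2.mul_left (C * (τ ^ 2)⁻¹)).congr fun n => ?_
  push_cast
  rw [pow_add]
  field_simp

end Auxiliary

/-! ### Increments of the log-likelihood along an observation sequence. -/

section

variable {𝒳 𝒴 : Type*} [MeasurableSpace 𝒳] [MeasurableSpace 𝒴] {d : ℕ}
  {p : ℕ} {Θ : Set (Euc d)} {μ : Measure 𝒳} {r : Euc d → 𝒴 → 𝒳 → 𝒳 → ℝ} {κ : ℝ}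
  {ψ φ : 𝒴 → ℝ} {Φ : 𝒴 → 𝒳 → ℝ}

/-- The increment of the log-likelihood which is due to the observation number `n`. -/
noncomputable def logIncr (μ : Measure 𝒳) (r : Euc d → 𝒴 → 𝒳 → 𝒳 → ℝ) (x₀ : 𝒳) (n : ℕ)
    (θ : Euc d) (f : ℕ → 𝒴) : ℝ :=
  Real.log (predLik μ r θ ((List.range n).map f) (f n) x₀)

omit [MeasurableSpace 𝒴] in
theorem sum_map_range_eq (ψ : 𝒴 → ℝ) (n : ℕ) (f : ℕ → 𝒴) :
    ((((List.range n).map f).map ψ).sum + ψ (f n)) = ∑ i ∈ Finset.range (n + 1), ψ (f i) := by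
  have h1 : ((List.range n).map fun i => ψ (f i)).sum = ∑ i ∈ Finset.range n, ψ (f i) := by
    induction n with
    | zero => simp
    | succ n ih => simp [List.range_succ, Finset.sum_range_succ, ih]
  rw [Finset.sum_range_succ, ← h1, List.map_map]
  rfl

namespace IsRegularFamily

theorem smooth_logIncr (h : IsRegularFamily p Θ μ r κ ψ φ Φ) (x₀ : 𝒳) (n : ℕ) (f : ℕ → 𝒴) :
    WordDiffOn p (fun t => logIncr μ r x₀ n t f) Θ :=
  (h.smooth_predLik _ _ x₀).log h.isOpen fun _ ht => (h.predLik_pos ht _ _ x₀).ne'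

theorem measurable_condLik_range (h : IsRegularFamily p Θ μ r κ ψ φ Φ) {θ : Euc d} (hθ : θ ∈ Θ)
    (n : ℕ) : Measurable fun z : (ℕ → 𝒴) × 𝒳 => condLik μ r θ ((List.range n).map z.1) z.2 := by
  have h1 := h.measurable_condLik_map hθ (Ω := ℕ → 𝒴) ((List.range n).map fun i f => f i) (by
    intro Y hY
    obtain ⟨i, _, rfl⟩ := List.mem_map.1 hY
    exact measurable_pi_apply i)
  simpa only [List.map_map, Function.comp_def] using h1

theorem measurable_logIncr (h : IsRegularFamily p Θ μ r κ ψ φ Φ) {θ : Euc d} (hθ : θ ∈ Θ)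
    (x₀ : 𝒳) (n : ℕ) : Measurable (logIncr μ r x₀ n θ) := by
  have h1 := fun n => (h.measurable_condLik_range hθ n).comp
    (f := fun f : ℕ → 𝒴 => (f, x₀)) (by fun_prop)
  have h2 := ((h1 (n + 1)).div (h1 n)).log
  have e : logIncr μ r x₀ n θ = fun f => Real.log
      (condLik μ r θ ((List.range (n + 1)).map f) x₀ / condLik μ r θ ((List.range n).map f) x₀) := by
    funext f
    simp [logIncr, predLik, List.range_succ]
  rw [e]
  exact h2

theorem abs_wordDeriv_logIncr_le (h : IsRegularFamily p Θ μ r κ ψ φ Φ) {θ : Euc d}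
    (hθ : θ ∈ Θ) (x₀ : 𝒳) (n : ℕ) (f : ℕ → 𝒴) (w : List (Fin d)) (hw : w.length ≤ p) :
    |wordDeriv w (fun t => logIncr μ r x₀ n t f) θ| ≤ φ (f n) + Real.log κ +
      ((1 + 2 ^ p) ^ 2) ^ p * (∑ i ∈ Finset.range (n + 1), ψ (f i)) ^ p := by
  rw [← mul_pow]
  exact h.abs_wordDeriv_log_predLik_le hθ _ _ (sum_map_range_eq ψ n f).le w hw x₀

/-- Deleting the first observation turns increment `n + 1` into increment `n` of the shifted
sequence. The power `|w|` is raised to `p`, the base being at least one, so that the bound is the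
same for all words. -/
theorem abs_wordDeriv_logIncr_sub_le (h : IsRegularFamily p Θ μ r κ ψ φ Φ) {θ : Euc d}
    (hθ : θ ∈ Θ) (x₀ : 𝒳) (n : ℕ) (f : ℕ → 𝒴) (w : List (Fin d)) (hw : w.length ≤ p) :
    |wordDeriv w (fun t => logIncr μ r x₀ (n + 1) t f) θ -
      wordDeriv w (fun t => logIncr μ r x₀ n t fun i => f (i + 1)) θ| ≤
      2 * κ ^ 2 * logGrowthConst p κ ^ p * forgetRate κ ^ n *
        (∑ i ∈ Finset.range (n + 1 + 1), ψ (f i)) ^ p := by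
  have e : (List.range (n + 1)).map f = f 0 :: (List.range n).map fun i => f (i + 1) := by
    rw [List.range_succ_eq_map, List.map_cons, List.map_map]; rfl
  have hs := sum_map_range_eq ψ (n + 1) f
  rw [e] at hs
  have h1 := h.wordDeriv_log_predLik_cons_sub_le hθ (f (n + 1)) (f 0) _ hs.le w hw x₀
  have hK := one_le_logGrowthConst (p := p) h.one_le
  have hs1 : 1 ≤ ∑ i ∈ Finset.range (n + 1 + 1), ψ (f i) := by
    rw [← hs]
    have := h.one_le_sum_score (f 0) ((List.range n).map fun i => f (i + 1))
    have := h.one_le_score (f (n + 1))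
    linarith
  have hq := (forgetRate_pos h.one_le).le
  unfold logIncr
  rw [e]
  refine h1.trans ?_
  rw [List.length_map, List.length_range]
  have h2 := pow_le_pow_right₀ (one_le_mul_of_one_le_of_one_le hK hs1) hw
  calc _ ≤ 2 * κ ^ 2 * (logGrowthConst p κ * ∑ i ∈ Finset.range (n + 1 + 1), ψ (f i)) ^ p *
        forgetRate κ ^ n :=
        mul_le_mul_of_nonneg_right (mul_le_mul_of_nonneg_left h2 (by positivity)) (by positivity)
    _ = _ := by rw [mul_pow]; ring

/-- Telescoping, as `predLik` is a ratio of consecutive likelihoods. -/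
theorem log_condLik_range (h : IsRegularFamily p Θ μ r κ ψ φ Φ) {θ : Euc d} (hθ : θ ∈ Θ)
    (x₀ : 𝒳) (N : ℕ) (f : ℕ → 𝒴) : Real.log (condLik μ r θ ((List.range N).map f) x₀) =
      ∑ n ∈ Finset.range N, logIncr μ r x₀ n θ f := by
  induction N with
  | zero => simp [condLik]
  | succ N ih =>
    rw [Finset.sum_range_succ, ← ih, logIncr, predLik, Real.log_div (h.condLik_pos hθ _ _).ne'
      (h.condLik_pos hθ _ _).ne', List.range_succ, List.map_append]
    simp

end IsRegularFamily

end


/-! ### Expected increments and their smooth limit. -/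

section

variable {𝒳 𝒴 : Type*} [MeasurableSpace 𝒳] [MeasurableSpace 𝒴] {d : ℕ}
  {p : ℕ} {Θ : Set (Euc d)} {μ : Measure 𝒳} {r : Euc d → 𝒴 → 𝒳 → 𝒳 → ℝ} {κ : ℝ}
  {ψ φ : 𝒴 → ℝ} {Φ : 𝒴 → 𝒳 → ℝ}
  {Ω : Type*} [MeasurableSpace Ω] {Pr : Measure Ω} [IsProbabilityMeasure Pr]
  {P : Kernel 𝒳 𝒳} {Q : Kernel 𝒳 𝒴} [IsMarkovKernel P] [IsMarkovKernel Q]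
  {X : ℕ → Ω → 𝒳} {Y : ℕ → Ω → 𝒴} {π : Measure 𝒳} {δ K₀ M₀ : ℝ}

/-- Moment bounds for the score bound `ψ` and the log-mass bound `φ`, uniform in the state. -/
structure HasUniformMoments (p : ℕ) (Q : Kernel 𝒳 𝒴) (ψ φ : 𝒴 → ℝ) (M₀ : ℝ) : Prop where
  measurable_score : Measurable ψ
  measurable_log : Measurable φ
  log_nonneg : ∀ y, 0 ≤ φ y
  one_le : 1 ≤ M₀
  score : ∀ x, ∫⁻ y, ENNReal.ofReal (ψ y ^ p) ∂(Q x) ≤ ENNReal.ofReal M₀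
  log : ∀ x, ∫⁻ y, ENNReal.ofReal (φ y) ∂(Q x) ≤ ENNReal.ofReal M₀

/-- A bound for the expected size of the derivatives of the `n`-th log-likelihood increment. -/
noncomputable def incrMoment (p : ℕ) (κ M₀ : ℝ) (n : ℕ) : ℝ :=
  M₀ + Real.log κ + ((1 + 2 ^ p) ^ 2) ^ p * (((n : ℝ) + 1) ^ (p + 1) * M₀)

namespace IsRegularFamily

theorem score_nonneg (h : IsRegularFamily p Θ μ r κ ψ φ Φ) (y : 𝒴) : 0 ≤ ψ y :=
  zero_le_one.trans (h.one_le_score y)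

theorem incrMoment_nonneg (h : IsRegularFamily p Θ μ r κ ψ φ Φ) (hM : 1 ≤ M₀) (n : ℕ) :
    0 ≤ incrMoment p κ M₀ n := by
  have := Real.log_nonneg h.one_le
  unfold incrMoment
  positivity

-- The observations are an arbitrary sequence `Z`, since the estimate is needed under `Pr` and under
-- the path law from a fixed state.
omit [IsMarkovKernel Q] in
theorem lintegral_growth_le (h : IsRegularFamily p Θ μ r κ ψ φ Φ)
    (hm : HasUniformMoments p Q ψ φ M₀) {α : Type*} [MeasurableSpace α] {m : Measure α}
    [IsProbabilityMeasure m] {Z : ℕ → α → 𝒴} (hZ : ∀ i, Measurable (Z i)) (n : ℕ)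
    (hs : ∀ i ≤ n, ∫⁻ a, ENNReal.ofReal (ψ (Z i a) ^ p) ∂m ≤ ENNReal.ofReal M₀)
    (hl : ∫⁻ a, ENNReal.ofReal (φ (Z n a)) ∂m ≤ ENNReal.ofReal M₀) :
    ∫⁻ a, ENNReal.ofReal (φ (Z n a) + Real.log κ + ((1 + 2 ^ p) ^ 2) ^ p *
      (∑ i ∈ Finset.range (n + 1), ψ (Z i a)) ^ p) ∂m ≤
      ENNReal.ofReal (incrMoment p κ M₀ n) := by
  have hlog := Real.log_nonneg h.one_le
  have hM := zero_le_one.trans hm.one_le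
  have hψm := hm.measurable_score
  have hφm := hm.measurable_log
  have e : ∀ a, ENNReal.ofReal (φ (Z n a) + Real.log κ + ((1 + 2 ^ p) ^ 2) ^ p *
      (∑ i ∈ Finset.range (n + 1), ψ (Z i a)) ^ p) =
      ENNReal.ofReal (φ (Z n a)) + ENNReal.ofReal (Real.log κ) +
        ENNReal.ofReal (((1 + 2 ^ p) ^ 2) ^ p) *
          ENNReal.ofReal ((∑ i ∈ Finset.range (n + 1), ψ (Z i a)) ^ p) := fun a => by
    have h1 : 0 ≤ (∑ i ∈ Finset.range (n + 1), ψ (Z i a)) ^ p :=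
      pow_nonneg (Finset.sum_nonneg fun i _ => h.score_nonneg _) p
    have h2 := hm.log_nonneg (Z n a)
    rw [ENNReal.ofReal_add (by positivity) (by positivity), ENNReal.ofReal_add h2 hlog,
      ENNReal.ofReal_mul (by positivity)]
  simp_rw [e]
  rw [lintegral_add_left (by fun_prop), lintegral_add_left (by fun_prop),
    lintegral_const_mul' _ _ ENNReal.ofReal_ne_top, lintegral_const, measure_univ, mul_one,
    incrMoment, ENNReal.ofReal_add (by positivity) (by positivity),
    ENNReal.ofReal_add hM hlog, ENNReal.ofReal_mul (p := ((1 + 2 ^ p) ^ 2) ^ p) (by positivity)]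
  gcongr
  exact lintegral_pow_sum_le (a := fun i a => ψ (Z i a)) (fun i => hψm.comp (hZ i))
    (fun i a => h.score_nonneg _) hs

theorem measurable_wordDeriv_logIncr (h : IsRegularFamily p Θ μ r κ ψ φ Φ) {θ : Euc d}
    (hθ : θ ∈ Θ) (x₀ : 𝒳) (n : ℕ) (w : List (Fin d)) (hw : w.length ≤ p) :
    Measurable fun f => wordDeriv w (fun t => logIncr μ r x₀ n t f) θ :=
  measurable_wordDeriv h.isOpen (F := fun θ f => logIncr μ r x₀ n θ f)
    (fun _ hθ => h.measurable_logIncr hθ x₀ n) (fun f => h.smooth_logIncr x₀ n f) w hw hθ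

end IsRegularFamily

omit [IsProbabilityMeasure Pr] [IsMarkovKernel P] [IsMarkovKernel Q] in
theorem IsStateSpaceModel.measurable_obsFrom (hXY : IsStateSpaceModel Pr P Q X Y) (j : ℕ) :
    Measurable fun ω i => Y (j + 1 + i) ω :=
  measurable_pi_iff.2 fun _ => hXY.measurable_obs _

namespace IsRegularFamily

theorem integrable_growth (h : IsRegularFamily p Θ μ r κ ψ φ Φ)
    (hm : HasUniformMoments p Q ψ φ M₀) (hXY : IsStateSpaceModel Pr P Q X Y) (n j : ℕ) :
    Integrable (fun ω => φ (Y (j + 1 + n) ω) + Real.log κ + ((1 + 2 ^ p) ^ 2) ^ p *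
      (∑ i ∈ Finset.range (n + 1), ψ (Y (j + 1 + i) ω)) ^ p) Pr := by
  have hlog := Real.log_nonneg h.one_le
  have hψm := hm.measurable_score
  have hφm := hm.measurable_log
  have hY := hXY.measurable_obs
  have hobs : ∀ (g : 𝒴 → ℝ), Measurable g →
      (∀ x, ∫⁻ y, ENNReal.ofReal (g y) ∂(Q x) ≤ ENNReal.ofReal M₀) → ∀ i,
      ∫⁻ ω, ENNReal.ofReal (g (Y (j + 1 + i) ω)) ∂Pr ≤ ENNReal.ofReal M₀ := fun g hg hQ i => by
    rw [add_right_comm]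
    exact hXY.lintegral_obs_le (j + i) hg.ennreal_ofReal hQ
  have h1 := h.lintegral_growth_le hm (m := Pr) (Z := fun i => Y (j + 1 + i)) (fun i => hY _) n
    (fun i _ => hobs (fun y => ψ y ^ p) (hψm.pow_const p) hm.score i) (hobs φ hφm hm.log n)
  refine (integrable_and_integral_le_of_lintegral_le ?_ (fun ω => ?_)
    (h.incrMoment_nonneg hm.one_le n) h1).1
  · fun_prop
  · have h1 : 0 ≤ (∑ i ∈ Finset.range (n + 1), ψ (Y (j + 1 + i) ω)) ^ p :=
      pow_nonneg (Finset.sum_nonneg fun i _ => h.score_nonneg _) p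
    have h2 := hm.log_nonneg (Y (j + 1 + n) ω)
    positivity

theorem integrable_wordDeriv_logIncr (h : IsRegularFamily p Θ μ r κ ψ φ Φ)
    (hm : HasUniformMoments p Q ψ φ M₀) (hXY : IsStateSpaceModel Pr P Q X Y) {θ : Euc d}
    (hθ : θ ∈ Θ) (x₀ : 𝒳) (n j : ℕ) (w : List (Fin d)) (hw : w.length ≤ p) :
    Integrable (fun ω => wordDeriv w (fun t => logIncr μ r x₀ n t fun i => Y (j + 1 + i) ω) θ)
      Pr :=
  (h.integrable_growth hm hXY n j).mono'
    ((h.measurable_wordDeriv_logIncr hθ x₀ n w hw).comp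
      (hXY.measurable_obsFrom j)).aestronglyMeasurable
    (Filter.Eventually.of_forall fun ω =>
      h.abs_wordDeriv_logIncr_le hθ x₀ n (fun i => Y (j + 1 + i) ω) w hw)

theorem wordDeriv_expectation_logIncr (h : IsRegularFamily p Θ μ r κ ψ φ Φ)
    (hm : HasUniformMoments p Q ψ φ M₀) (hXY : IsStateSpaceModel Pr P Q X Y) (x₀ : 𝒳) (n j : ℕ) :
    WordDiffOn p (fun θ => ∫ ω, logIncr μ r x₀ n θ (fun i => Y (j + 1 + i) ω) ∂Pr) Θ ∧
    ∀ w : List (Fin d), w.length ≤ p → ∀ θ ∈ Θ,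
      wordDeriv w (fun θ => ∫ ω, logIncr μ r x₀ n θ (fun i => Y (j + 1 + i) ω) ∂Pr) θ =
        ∫ ω, wordDeriv w (fun t => logIncr μ r x₀ n t fun i => Y (j + 1 + i) ω) θ ∂Pr := by
  have key := wordDeriv_integral (m := Pr) h.isOpen (n := p)
    (F := fun θ ω => logIncr μ r x₀ n θ (fun i => Y (j + 1 + i) ω))
    (fun θ hθ => (h.measurable_logIncr hθ x₀ n).comp (hXY.measurable_obsFrom j))
    (fun ω => h.smooth_logIncr x₀ n _) (h.integrable_growth hm hXY n j)
    (fun w hw θ hθ ω => h.abs_wordDeriv_logIncr_le hθ x₀ n (fun i => Y (j + 1 + i) ω) w hw)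
  exact ⟨key.1, fun w hw θ hθ => (key.2 w hw θ hθ).2⟩

/-- The constant of the forgetting bound for the expected derivatives. -/
noncomputable def forgetConst (p : ℕ) (κ M₀ : ℝ) : ℝ := 2 * κ ^ 2 * logGrowthConst p κ ^ p * M₀

/-- Expectation of the pathwise forgetting bound. The `p`-th moment of a sum of `n + 2` scores
contributes the polynomial factor. -/
theorem abs_expectation_succ_sub_shift_le (h : IsRegularFamily p Θ μ r κ ψ φ Φ)
    (hm : HasUniformMoments p Q ψ φ M₀) (hXY : IsStateSpaceModel Pr P Q X Y) {θ : Euc d}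
    (hθ : θ ∈ Θ) (x₀ : 𝒳) (n j : ℕ) (w : List (Fin d)) (hw : w.length ≤ p) :
    |∫ ω, wordDeriv w (fun t => logIncr μ r x₀ (n + 1) t fun i => Y (j + 1 + i) ω) θ ∂Pr -
      ∫ ω, wordDeriv w (fun t => logIncr μ r x₀ n t fun i => Y (j + 1 + 1 + i) ω) θ ∂Pr| ≤
      forgetConst p κ M₀ * ((n : ℝ) + 2) ^ (p + 1) * forgetRate κ ^ n := by
  have hM := zero_le_one.trans hm.one_le
  have hq := (forgetRate_pos h.one_le).le
  have hK := zero_le_one.trans (one_le_logGrowthConst (p := p) h.one_le)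
  have hψm := hm.measurable_score
  have hY := hXY.measurable_obs
  have hsum := integrable_and_integral_le_of_lintegral_le (m := Pr)
    (f := fun ω => (∑ i ∈ Finset.range (n + 1 + 1), ψ (Y (j + 1 + i) ω)) ^ p)
    (by fun_prop) (fun ω => pow_nonneg (Finset.sum_nonneg fun i _ => h.score_nonneg _) p)
    (C := (((n + 1 : ℕ) : ℝ) + 1) ^ (p + 1) * M₀) (by positivity)
    (lintegral_pow_sum_le (a := fun i ω => ψ (Y (j + 1 + i) ω)) (fun i => hψm.comp (hY _))
      (fun i ω => h.score_nonneg _) fun i _ => by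
        rw [add_right_comm]
        exact hXY.lintegral_obs_le (g := fun y => ENNReal.ofReal (ψ y ^ p)) (j + i)
          (hψm.pow_const p).ennreal_ofReal hm.score)
  have i1 := h.integrable_wordDeriv_logIncr hm hXY hθ x₀ (n + 1) j w hw
  have i2 := h.integrable_wordDeriv_logIncr hm hXY hθ x₀ n (j + 1) w hw
  rw [← integral_sub i1 i2]
  refine abs_integral_le_integral_abs.trans ?_
  refine (integral_mono (i1.sub i2).abs
    (hsum.1.const_mul (2 * κ ^ 2 * logGrowthConst p κ ^ p * forgetRate κ ^ n))
    fun ω => ?_).trans ?_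
  · have h1 := h.abs_wordDeriv_logIncr_sub_le hθ x₀ n (fun i => Y (j + 1 + i) ω) w hw
    have e : (fun i => Y (j + 1 + 1 + i) ω) = fun i => Y (j + 1 + (i + 1)) ω := by
      funext i
      rw [add_assoc (j + 1), add_comm 1 i]
    rw [Pi.sub_apply, e]
    exact h1
  · rw [integral_const_mul]
    refine (mul_le_mul_of_nonneg_left hsum.2 (by positivity)).trans (le_of_eq ?_)
    unfold forgetConst
    push_cast
    ring

/-- The oldest observation is dropped `k` times. At each drop the exponent of `forgetRate` is at
least `m`, so `k` times the worst single error is enough. -/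
theorem abs_expectation_sub_shift_le (h : IsRegularFamily p Θ μ r κ ψ φ Φ)
    (hm : HasUniformMoments p Q ψ φ M₀) (hXY : IsStateSpaceModel Pr P Q X Y) {θ : Euc d}
    (hθ : θ ∈ Θ) (x₀ : 𝒳) (m k j : ℕ) (w : List (Fin d)) (hw : w.length ≤ p) :
    |∫ ω, wordDeriv w (fun t => logIncr μ r x₀ (m + k) t fun i => Y (j + 1 + i) ω) θ ∂Pr -
      ∫ ω, wordDeriv w (fun t => logIncr μ r x₀ m t fun i => Y (j + k + 1 + i) ω) θ ∂Pr| ≤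
      k * (forgetConst p κ M₀ * ((m : ℝ) + k + 1) ^ (p + 1) * forgetRate κ ^ m) := by
  have hM := zero_le_one.trans hm.one_le
  have hq := forgetRate_pos h.one_le
  have hK := zero_le_one.trans (one_le_logGrowthConst (p := p) h.one_le)
  have hF : 0 ≤ forgetConst p κ M₀ := by unfold forgetConst; positivity
  induction k generalizing j with
  | zero =>
    rw [Nat.cast_zero, zero_mul]
    exact (abs_eq_zero.2 (sub_self _)).le
  | succ k ih =>
    have h1 := h.abs_expectation_succ_sub_shift_le hm hXY hθ x₀ (m + k) j w hw
    have h2 := ih (j + 1)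
    have e : j + 1 + k = j + (k + 1) := by omega
    rw [e] at h2
    have h3 : forgetConst p κ M₀ * (((m + k : ℕ) : ℝ) + 2) ^ (p + 1) * forgetRate κ ^ (m + k) ≤
        forgetConst p κ M₀ * ((m : ℝ) + (k + 1 : ℕ) + 1) ^ (p + 1) * forgetRate κ ^ m := by
      have e2 : ((m + k : ℕ) : ℝ) + 2 = (m : ℝ) + (k + 1 : ℕ) + 1 := by push_cast; ring
      rw [e2]
      exact mul_le_mul_of_nonneg_left (pow_le_pow_of_le_one hq.le (forgetRate_lt_one h.one_le).le
        (Nat.le_add_right m k)) (by positivity)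
    have h4 : (k : ℝ) * (forgetConst p κ M₀ * ((m : ℝ) + k + 1) ^ (p + 1) * forgetRate κ ^ m) ≤
        k * (forgetConst p κ M₀ * ((m : ℝ) + (k + 1 : ℕ) + 1) ^ (p + 1) * forgetRate κ ^ m) := by
      push_cast
      gcongr
      linarith
    refine (abs_sub_le _ _ _).trans ((add_le_add (h1.trans h3) (h2.trans h4)).trans
      (le_of_eq ?_))
    push_cast
    ring

omit [MeasurableSpace 𝒴] in
theorem logIncr_truncate (x₀ : 𝒳) (n : ℕ) (θ : Euc d) (y₀ : 𝒴) (f : ℕ → 𝒴) :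
    logIncr μ r x₀ n θ (truncate y₀ (n + 1) f) = logIncr μ r x₀ n θ f := by
  unfold logIncr
  have e : (List.range n).map (truncate y₀ (n + 1) f) = (List.range n).map f :=
    List.map_congr_left fun i hi => by
      have := List.mem_range.1 hi
      simp [truncate, show i < n + 1 by omega]
  rw [e]
  simp [truncate]

/-- Increment `n` reads only `n + 1` observations, and its derivatives have moments bounded
uniformly in the state preceding them; ergodicity of the chain then applies. -/
theorem abs_expectation_shift_sub_le (h : IsRegularFamily p Θ μ r κ ψ φ Φ)
    (hm : HasUniformMoments p Q ψ φ M₀) (hXY : IsStateSpaceModel Pr P Q X Y)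
    (herg : GeometricallyErgodic P π δ K₀) (y₀ : 𝒴) {θ : Euc d}
    (hθ : θ ∈ Θ) (x₀ : 𝒳) (n j : ℕ) (w : List (Fin d)) (hw : w.length ≤ p) :
    |∫ ω, wordDeriv w (fun t => logIncr μ r x₀ n t fun i => Y (j + 1 + 1 + i) ω) θ ∂Pr -
      ∫ ω, wordDeriv w (fun t => logIncr μ r x₀ n t fun i => Y (j + 1 + i) ω) θ ∂Pr| ≤
      4 * incrMoment p κ M₀ n * (K₀ * δ ^ j) := by
  have key := hXY.abs_expectation_shift_le herg y₀ (n + 1)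
    (h.measurable_wordDeriv_logIncr hθ x₀ n w hw) (fun f => by simp_rw [logIncr_truncate])
    (G := incrMoment p κ M₀ n) (fun x => ?_) j
  · rwa [max_eq_left (h.incrMoment_nonneg hm.one_le n)] at key
  · have h1 := h.lintegral_growth_le hm (m := pathKernel P Q y₀ (n + 1) x)
      (Z := fun i z => z.1 i) (fun i => by fun_prop) n
      (fun i hi => lintegral_pathKernel_le y₀ (g := fun y => ENNReal.ofReal (ψ y ^ p))
        (hm.measurable_score.pow_const p).ennreal_ofReal hm.score (n + 1) i (by omega) x)
      (lintegral_pathKernel_le y₀ (g := fun y => ENNReal.ofReal (φ y))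
        hm.measurable_log.ennreal_ofReal hm.log (n + 1) n (by omega) x)
    refine (lintegral_mono fun z => ?_).trans h1
    rw [Real.enorm_eq_ofReal_abs]
    exact ENNReal.ofReal_le_ofReal (h.abs_wordDeriv_logIncr_le hθ x₀ n z.1 w hw)

theorem exists_summable_expectation_bound (h : IsRegularFamily p Θ μ r κ ψ φ Φ)
    (hm : HasUniformMoments p Q ψ φ M₀) (hXY : IsStateSpaceModel Pr P Q X Y)
    (herg : GeometricallyErgodic P π δ K₀) (y₀ : 𝒴) (x₀ : 𝒳) :
    ∃ b : ℕ → ℝ, Summable b ∧ ∀ n, ∀ θ ∈ Θ, ∀ w : List (Fin d), w.length ≤ p →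
      |∫ ω, wordDeriv w (fun t => logIncr μ r x₀ (n + 1) t fun i => Y (0 + 1 + i) ω) θ ∂Pr -
      ∫ ω, wordDeriv w (fun t => logIncr μ r x₀ n t fun i => Y (0 + 1 + i) ω) θ ∂Pr| ≤ b n := by
  have hq := forgetRate_pos h.one_le
  have hq1 := forgetRate_lt_one h.one_le
  have hM := zero_le_one.trans hm.one_le
  have hK := zero_le_one.trans (one_le_logGrowthConst (p := p) h.one_le)
  have hlog := Real.log_nonneg h.one_le
  have hF : 0 ≤ forgetConst p κ M₀ := by unfold forgetConst; positivity
  have hK₀ := zero_le_one.trans herg.one_le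
  have hδ := herg.delta_pos
  set D := forgetConst p κ M₀ with hD
  set q := forgetRate κ with hqdef
  -- Only half of `n` is available as exponent for each of `q` and `δ`; the square root turns this
  -- into a rate in `n`. Division by `τ` in `p1` covers odd `n`, where `2 * m + 1 = n`.
  set τ := Real.sqrt (max q δ) with hτ
  have hmax : 0 < max q δ := lt_max_of_lt_left hq
  have hτ0 : 0 < τ := Real.sqrt_pos.2 hmax
  have hτ1 : τ < 1 := (Real.sqrt_lt' one_pos).2 (by
    rw [one_pow]; exact max_lt hq1 herg.delta_lt_one)
  have hτ2 : τ ^ 2 = max q δ := Real.sq_sqrt hmax.le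
  set C₀ := M₀ + Real.log κ + ((1 + 2 ^ p) ^ 2) ^ p * M₀ with hC₀
  have hC₀0 : 0 ≤ C₀ := by positivity
  refine ⟨fun n => (2 * D / τ + 4 * C₀ * K₀) * ((n : ℝ) + 2) ^ (p + 2) * τ ^ n,
    summable_poly_mul_geometric _ hτ0 hτ1 _, fun n θ hθ w hw => ?_⟩
  set m := n / 2 with hm2
  obtain ⟨k, hk⟩ : ∃ k, n = m + k := ⟨n - m, by omega⟩
  -- Three comparisons link increments `n + 1` and `n`: forget `k + 1` observations, shift the
  -- remaining window from start `k + 1` to start `k`, and restore `k` forgotten observations.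
  have t1 := h.abs_expectation_sub_shift_le hm hXY hθ x₀ m (k + 1) 0 w hw
  have t2 := h.abs_expectation_sub_shift_le hm hXY hθ x₀ m k 0 w hw
  have t3 := h.abs_expectation_shift_sub_le hm hXY herg y₀ hθ x₀ m k w hw
  rw [zero_add k] at t2
  rw [zero_add (k + 1)] at t1
  rw [← add_assoc, ← hk] at t1
  rw [← hk] at t2
  rw [abs_sub_comm] at t2
  have hn : (n : ℝ) = m + k := by rw [hk]; push_cast; ring
  have hm0 : (0 : ℝ) ≤ m := Nat.cast_nonneg m
  have hk0 : (0 : ℝ) ≤ k := Nat.cast_nonneg k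
  have p1 : q ^ m ≤ τ ^ n / τ := by
    rw [le_div_iff₀ hτ0]
    calc q ^ m * τ ≤ (τ ^ 2) ^ m * τ := by
          gcongr
          rw [hτ2]; exact le_max_left _ _
      _ = τ ^ (2 * m + 1) := by rw [← pow_mul, pow_succ]
      _ ≤ τ ^ n := pow_le_pow_of_le_one hτ0.le hτ1.le (by omega)
  have p2 : δ ^ k ≤ τ ^ n := by
    calc δ ^ k ≤ (τ ^ 2) ^ k := by
          gcongr
          rw [hτ2]; exact le_max_right _ _
      _ = τ ^ (2 * k) := by rw [← pow_mul]
      _ ≤ τ ^ n := pow_le_pow_of_le_one hτ0.le hτ1.le (by omega)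
  set A : ℝ := (n : ℝ) + 2 with hA
  have hA0 : 1 ≤ A := by linarith
  have b1 : ((k + 1 : ℕ) : ℝ) * (D * ((m : ℝ) + (k + 1 : ℕ) + 1) ^ (p + 1) * q ^ m) ≤
      ((k : ℝ) + 1) * (D * A ^ (p + 1) * (τ ^ n / τ)) := by
    have e : (m : ℝ) + (k + 1 : ℕ) + 1 = A := by rw [hA, hn]; push_cast; ring
    rw [e]
    push_cast
    gcongr
  have b2 : (k : ℝ) * (D * ((m : ℝ) + k + 1) ^ (p + 1) * q ^ m) ≤
      k * (D * A ^ (p + 1) * (τ ^ n / τ)) := by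
    gcongr
    linarith
  have b3 : 4 * incrMoment p κ M₀ m * (K₀ * δ ^ k) ≤ 4 * (C₀ * A ^ (p + 1)) * (K₀ * τ ^ n) := by
    have e1 : 1 ≤ ((m : ℝ) + 1) ^ (p + 1) := one_le_pow₀ (by linarith)
    have e2 : ((m : ℝ) + 1) ^ (p + 1) ≤ A ^ (p + 1) := by
      gcongr
      linarith
    have e3 : incrMoment p κ M₀ m ≤ C₀ * ((m : ℝ) + 1) ^ (p + 1) := by
      unfold incrMoment
      have : M₀ + Real.log κ ≤ (M₀ + Real.log κ) * ((m : ℝ) + 1) ^ (p + 1) :=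
        le_mul_of_one_le_right (by positivity) e1
      rw [hC₀, add_mul]
      linarith
    have e4 := e3.trans (mul_le_mul_of_nonneg_left e2 hC₀0)
    have e5 : 0 ≤ C₀ * A ^ (p + 1) := by positivity
    gcongr
  have hsum : ((k : ℝ) + 1) * (D * A ^ (p + 1) * (τ ^ n / τ)) +
      (4 * (C₀ * A ^ (p + 1)) * (K₀ * τ ^ n) + k * (D * A ^ (p + 1) * (τ ^ n / τ))) ≤
      (2 * D / τ + 4 * C₀ * K₀) * A ^ (p + 2) * τ ^ n := by
    have e1 : (2 * (k : ℝ) + 1) * (D * A ^ (p + 1) * (τ ^ n / τ)) ≤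
        (2 * A) * (D * A ^ (p + 1) * (τ ^ n / τ)) :=
      mul_le_mul_of_nonneg_right (by linarith) (by positivity)
    have e2 : 4 * (C₀ * A ^ (p + 1)) * (K₀ * τ ^ n) ≤
        A * (4 * (C₀ * A ^ (p + 1)) * (K₀ * τ ^ n)) := le_mul_of_one_le_left (by positivity) hA0
    have e3 : (2 * D / τ + 4 * C₀ * K₀) * A ^ (p + 2) * τ ^ n =
        (2 * A) * (D * A ^ (p + 1) * (τ ^ n / τ)) +
          A * (4 * (C₀ * A ^ (p + 1)) * (K₀ * τ ^ n)) := by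
      rw [pow_succ A (p + 1)]; ring
    rw [e3]
    linarith
  refine le_trans ?_ hsum
  refine (abs_sub_le _ _ _).trans (add_le_add (t1.trans b1) ?_)
  exact (abs_sub_le _ _ _).trans (add_le_add (t3.trans b3) (t2.trans b2))

/-- The expected increments of the log-likelihood converge to a smooth limit. -/
theorem exists_limit_expectation_logIncr (h : IsRegularFamily p Θ μ r κ ψ φ Φ)
    (hm : HasUniformMoments p Q ψ φ M₀) (hXY : IsStateSpaceModel Pr P Q X Y)
    (herg : GeometricallyErgodic P π δ K₀) (y₀ : 𝒴) (x₀ : 𝒳) :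
    ∃ l : Euc d → ℝ, WordDiffOn p l Θ ∧ ∀ θ ∈ Θ,
      Tendsto (fun n => ∫ ω, logIncr μ r x₀ n θ (fun i => Y (0 + 1 + i) ω) ∂Pr) atTop
        (𝓝 (l θ)) := by
  obtain ⟨b, hb, hbound⟩ := h.exists_summable_expectation_bound hm hXY herg y₀ x₀
  set F : ℕ → Euc d → ℝ := fun n θ => ∫ ω, logIncr μ r x₀ n θ (fun i => Y (0 + 1 + i) ω) ∂Pr
    with hFdef
  have hder := fun n => h.wordDeriv_expectation_logIncr hm hXY x₀ n 0
  have hG : ∀ w : List (Fin d), ∃ G : Euc d → ℝ, w.length ≤ p →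
      TendstoUniformlyOn (fun n => wordDeriv w (F n)) G atTop Θ := fun w => by
    by_cases hw : w.length ≤ p
    · obtain ⟨G, hG⟩ := exists_tendstoUniformlyOn_of_summable (s := Θ)
        (F := fun n => wordDeriv w (F n)) hb fun n θ hθ => by
          rw [(hder (n + 1)).2 w hw θ hθ, (hder n).2 w hw θ hθ]
          exact hbound n θ hθ w hw
      exact ⟨G, fun _ => hG⟩
    · exact ⟨0, fun h => absurd h hw⟩
  choose G hG using hG
  refine ⟨G [], wordDiffOn_of_tendstoUniformlyOn h.isOpen (fun n => (hder n).1) hG,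
    fun θ hθ => ?_⟩
  exact (hG [] (Nat.zero_le _)).tendsto_at hθ

end IsRegularFamily

end


/-! ### The likelihood for a general initial law, and the limit of its average logarithm. -/

section

variable {𝒳 𝒴 : Type*} [MeasurableSpace 𝒳] [MeasurableSpace 𝒴] {d : ℕ}
  {p : ℕ} {Θ : Set (Euc d)} {μ : Measure 𝒳} {r : Euc d → 𝒴 → 𝒳 → 𝒳 → ℝ} {κ : ℝ}
  {ψ φ : 𝒴 → ℝ} {Φ : 𝒴 → 𝒳 → ℝ}

theorem iterIntegral_const_mul (μ : Measure 𝒳) (n : ℕ) {c : ℝ≥0∞} (hc : c ≠ ∞)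
    (g : (Fin n → 𝒳) → ℝ≥0∞) :
    iterIntegral μ n (fun xs => c * g xs) = c * iterIntegral μ n g := by
  induction n with
  | zero => rfl
  | succ n ih =>
    simp only [iterIntegral]
    simp_rw [ih]
    exact lintegral_const_mul' c _ hc

namespace IsRegularFamily

/-- The first transition factor does not involve the later states, so it comes out of the inner
integrals and leaves the same problem started from the first integrated state. -/
theorem iterIntegral_prod_eq (h : IsRegularFamily p Θ μ r κ ψ φ Φ) {θ : Euc d} (hθ : θ ∈ Θ)
    (n : ℕ) (y : Fin n → 𝒴) (x₀ : 𝒳) :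
    iterIntegral μ n (fun xs => ∏ k : Fin n,
      ENNReal.ofReal (r θ (y k) ((Fin.cons x₀ xs : Fin (n + 1) → 𝒳) k.succ)
        ((Fin.cons x₀ xs : Fin (n + 1) → 𝒳) k.castSucc))) =
      ENNReal.ofReal (condLik μ r θ (List.ofFn y) x₀) := by
  induction n generalizing x₀ with
  | zero => simp [iterIntegral, condLik]
  | succ n ih =>
    have e : ∀ (x : 𝒳) (xs : Fin n → 𝒳), ∏ k : Fin (n + 1),
        ENNReal.ofReal (r θ (y k) ((Fin.cons x₀ (Fin.cons x xs : Fin (n + 1) → 𝒳) :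
          Fin (n + 2) → 𝒳) k.succ) ((Fin.cons x₀ (Fin.cons x xs : Fin (n + 1) → 𝒳) :
          Fin (n + 2) → 𝒳) k.castSucc)) =
        ENNReal.ofReal (r θ (y 0) x x₀) * ∏ k : Fin n,
          ENNReal.ofReal (r θ (y k.succ) ((Fin.cons x xs : Fin (n + 1) → 𝒳) k.succ)
            ((Fin.cons x xs : Fin (n + 1) → 𝒳) k.castSucc)) := fun x xs => by
      rw [Fin.prod_univ_succ]
      rfl
    simp only [iterIntegral, e, iterIntegral_const_mul μ n ENNReal.ofReal_ne_top]
    rw [List.ofFn_succ, condLik_cons, ofReal_integral_eq_lintegral_ofReal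
      (h.integrable_dens_mul_condLik hθ _ _ _) (Filter.Eventually.of_forall fun x =>
        mul_nonneg (h.nonneg θ hθ _ _ _) (h.condLik_pos hθ _ _).le)]
    refine lintegral_congr fun x => ?_
    rw [ih (fun i => y i.succ) x, ENNReal.ofReal_mul (h.nonneg θ hθ _ _ _)]

theorem integrable_condLik (h : IsRegularFamily p Θ μ r κ ψ φ Φ) {θ : Euc d} (hθ : θ ∈ Θ)
    (lam : Measure 𝒳) [IsProbabilityMeasure lam] (ys : List 𝒴) :
    Integrable (condLik μ r θ ys) lam :=
  Integrable.of_bound (h.measurable_condLik hθ ys).aestronglyMeasurable _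
    (Filter.Eventually.of_forall fun x => by
      rw [Real.norm_of_nonneg (h.condLik_pos hθ ys x).le]
      exact h.condLik_le hθ ys x)

theorem likelihood_eq (h : IsRegularFamily p Θ μ r κ ψ φ Φ) {θ : Euc d} (hθ : θ ∈ Θ)
    (lam : Measure 𝒳) [IsProbabilityMeasure lam] (n : ℕ) (y : Fin n → 𝒴) :
    likelihood μ (r θ) lam n y =
      ENNReal.ofReal (∫ x, condLik μ r θ (List.ofFn y) x ∂lam) := by
  unfold likelihood
  rw [ofReal_integral_eq_lintegral_ofReal (h.integrable_condLik hθ lam _)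
    (Filter.Eventually.of_forall fun x => (h.condLik_pos hθ _ x).le)]
  exact lintegral_congr fun x => h.iterIntegral_prod_eq hθ n y x

theorem integral_condLik_mem_Icc (h : IsRegularFamily p Θ μ r κ ψ φ Φ) {θ : Euc d} (hθ : θ ∈ Θ)
    (lam : Measure 𝒳) [IsProbabilityMeasure lam] (ys : List 𝒴) (x₀ : 𝒳) :
    ∫ x, condLik μ r θ ys x ∂lam ∈
      Set.Icc (κ⁻¹ * condLik μ r θ ys x₀) (κ * condLik μ r θ ys x₀) := by
  have hκ := zero_lt_one.trans_le h.one_le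
  have e : ∀ c : ℝ, c = ∫ _, c ∂lam := fun c => by simp
  constructor
  · rw [e (κ⁻¹ * _)]
    refine integral_mono (integrable_const _) (h.integrable_condLik hθ lam ys) fun x => ?_
    beta_reduce
    rw [inv_mul_le_iff₀ hκ]
    exact h.condLik_le_mul hθ ys x₀ x
  · rw [e (κ * _)]
    exact integral_mono (h.integrable_condLik hθ lam ys) (integrable_const _) fun x =>
      h.condLik_le_mul hθ ys x x₀

theorem integral_condLik_pos (h : IsRegularFamily p Θ μ r κ ψ φ Φ) {θ : Euc d} (hθ : θ ∈ Θ)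
    (lam : Measure 𝒳) [IsProbabilityMeasure lam] (ys : List 𝒴) (x₀ : 𝒳) :
    0 < ∫ x, condLik μ r θ ys x ∂lam :=
  (mul_pos (inv_pos.2 (zero_lt_one.trans_le h.one_le)) (h.condLik_pos hθ ys x₀)).trans_le
    (h.integral_condLik_mem_Icc hθ lam ys x₀).1

/-- Comparability in the initial state, integrated over `lam`: replacing the initial law by a point
costs a factor between `κ⁻¹` and `κ`, independently of the number of observations. -/
theorem abs_log_integral_condLik_sub_le (h : IsRegularFamily p Θ μ r κ ψ φ Φ) {θ : Euc d}
    (hθ : θ ∈ Θ) (lam : Measure 𝒳) [IsProbabilityMeasure lam] (ys : List 𝒴) (x₀ : 𝒳) :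
    |Real.log (∫ x, condLik μ r θ ys x ∂lam) - Real.log (condLik μ r θ ys x₀)| ≤ Real.log κ := by
  have hκ := zero_lt_one.trans_le h.one_le
  have hu := h.condLik_pos hθ ys x₀
  have hI := h.integral_condLik_mem_Icc hθ lam ys x₀
  have h1 := Real.log_le_log (mul_pos (inv_pos.2 hκ) hu) hI.1
  have h2 := Real.log_le_log (h.integral_condLik_pos hθ lam ys x₀) hI.2
  rw [Real.log_mul (inv_ne_zero hκ.ne') hu.ne', Real.log_inv] at h1
  rw [Real.log_mul hκ.ne' hu.ne'] at h2
  exact abs_le.2 ⟨by linarith, by linarith⟩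

variable {Ω : Type*} [MeasurableSpace Ω] {Pr : Measure Ω} [IsProbabilityMeasure Pr]
  {P : Kernel 𝒳 𝒳} {Q : Kernel 𝒳 𝒴} [IsMarkovKernel P] [IsMarkovKernel Q]
  {X : ℕ → Ω → 𝒳} {Y : ℕ → Ω → 𝒴} {π : Measure 𝒳} {δ K₀ M₀ : ℝ}

omit [MeasurableSpace Ω] in
theorem normLogLikelihood_eq (h : IsRegularFamily p Θ μ r κ ψ φ Φ) {θ : Euc d} (hθ : θ ∈ Θ)
    (lam : Measure 𝒳) [IsProbabilityMeasure lam] (x₀ : 𝒳) (n : ℕ) (ω : Ω) :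
    normLogLikelihood μ (r θ) Y lam n ω = (n : ℝ)⁻¹ * Real.log
      (∫ x, condLik μ r θ ((List.range n).map fun i => Y (0 + 1 + i) ω) x ∂lam) := by
  have e : List.ofFn (fun k : Fin n => Y (k + 1) ω) =
      (List.range n).map fun i => Y (0 + 1 + i) ω := by
    refine List.ext_getElem (by simp) fun i _ _ => ?_
    simp [add_comm]
  rw [normLogLikelihood, h.likelihood_eq hθ, e,
    ENNReal.toReal_ofReal (h.integral_condLik_pos hθ lam _ x₀).le, one_div]

theorem integrable_log_integral_condLik (h : IsRegularFamily p Θ μ r κ ψ φ Φ)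
    (hm : HasUniformMoments p Q ψ φ M₀) (hXY : IsStateSpaceModel Pr P Q X Y) {θ : Euc d}
    (hθ : θ ∈ Θ) (lam : Measure 𝒳) [IsProbabilityMeasure lam] (x₀ : 𝒳) (n : ℕ) :
    Integrable (fun ω => Real.log
        (∫ x, condLik μ r θ ((List.range n).map fun i => Y (0 + 1 + i) ω) x ∂lam)) Pr ∧
      |∫ ω, Real.log (∫ x, condLik μ r θ ((List.range n).map fun i => Y (0 + 1 + i) ω) x ∂lam) ∂Pr -
        ∑ i ∈ Finset.range n, ∫ ω, logIncr μ r x₀ i θ (fun i => Y (0 + 1 + i) ω) ∂Pr| ≤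
        Real.log κ := by
  have hi := fun i => h.integrable_wordDeriv_logIncr hm hXY hθ x₀ i 0 [] (Nat.zero_le _)
  simp only [wordDeriv_nil] at hi
  have hS := integrable_finsetSum (Finset.range n) fun i _ => hi i
  have hb := fun ω => h.abs_log_integral_condLik_sub_le hθ lam
    ((List.range n).map fun i => Y (0 + 1 + i) ω) x₀
  simp only [h.log_condLik_range hθ] at hb
  have hmeas : Measurable fun ω => Real.log
      (∫ x, condLik μ r θ ((List.range n).map fun i => Y (0 + 1 + i) ω) x ∂lam) := by
    refine Measurable.log (StronglyMeasurable.integral_prod_right' (f := fun z : Ω × 𝒳 =>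
      condLik μ r θ ((List.range n).map fun i => Y (0 + 1 + i) z.1) z.2) ?_).measurable
    exact ((h.measurable_condLik_range hθ n).comp (f := fun z : Ω × 𝒳 =>
      ((fun i => Y (0 + 1 + i) z.1 : ℕ → 𝒴), z.2))
      (((hXY.measurable_obsFrom 0).comp measurable_fst).prodMk measurable_snd)).stronglyMeasurable
  -- The logarithm of the likelihood differs from the integrable sum of increments by a bounded
  -- variable, which gives its integrability.
  have hD := Integrable.of_bound (μ := Pr) (hmeas.aestronglyMeasurable.sub
    hS.aestronglyMeasurable) _ (Filter.Eventually.of_forall hb)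
  have hL := hD.add hS
  rw [sub_add_cancel] at hL
  refine ⟨hL, ?_⟩
  rw [← integral_finsetSum _ fun i _ => hi i, ← integral_sub hL hS, ← Real.norm_eq_abs]
  refine (norm_integral_le_of_norm_le_const (C := Real.log κ)
    (Filter.Eventually.of_forall fun ω => hb ω)).trans ?_
  simp

theorem integrable_normLogLikelihood (h : IsRegularFamily p Θ μ r κ ψ φ Φ)
    (hm : HasUniformMoments p Q ψ φ M₀) (hXY : IsStateSpaceModel Pr P Q X Y) {θ : Euc d}
    (hθ : θ ∈ Θ) (lam : Measure 𝒳) [IsProbabilityMeasure lam] (x₀ : 𝒳) (n : ℕ) :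
    Integrable (normLogLikelihood μ (r θ) Y lam n) Pr := by
  have e := funext (h.normLogLikelihood_eq (Y := Y) hθ lam x₀ n)
  rw [e]
  exact (h.integrable_log_integral_condLik hm hXY hθ lam x₀ n).1.const_mul _

/-- The initial law contributes an error at most `log κ / n`; the rest is the Cesàro mean of the
expected increments. -/
theorem tendsto_avgLogLikelihood (h : IsRegularFamily p Θ μ r κ ψ φ Φ)
    (hm : HasUniformMoments p Q ψ φ M₀) (hXY : IsStateSpaceModel Pr P Q X Y) {θ : Euc d}
    (hθ : θ ∈ Θ) (lam : Measure 𝒳) [IsProbabilityMeasure lam] (x₀ : 𝒳) {a : ℝ}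
    (ha : Tendsto (fun n => ∫ ω, logIncr μ r x₀ n θ (fun i => Y (0 + 1 + i) ω) ∂Pr) atTop (𝓝 a)) :
    Tendsto (fun n => avgLogLikelihood Pr μ (r θ) Y lam n) atTop (𝓝 a) := by
  have h0 : Tendsto (fun n : ℕ => (n : ℝ)⁻¹ * Real.log κ) atTop (𝓝 0) := by
    simpa using tendsto_inv_atTop_nhds_zero_nat.mul_const (Real.log κ)
  have h1 : Tendsto (fun n : ℕ => avgLogLikelihood Pr μ (r θ) Y lam n - (n : ℝ)⁻¹ *
      ∑ i ∈ Finset.range n, ∫ ω, logIncr μ r x₀ i θ (fun i => Y (0 + 1 + i) ω) ∂Pr) atTop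
      (𝓝 0) := by
    refine squeeze_zero_norm (fun n => ?_) h0
    unfold avgLogLikelihood
    simp only [h.normLogLikelihood_eq hθ lam x₀]
    rw [integral_const_mul, ← mul_sub, norm_mul, Real.norm_of_nonneg (by positivity)]
    exact mul_le_mul_of_nonneg_left (h.integrable_log_integral_condLik hm hXY hθ lam x₀ n).2
      (by positivity)
  simpa using h1.add ha.cesaro

end IsRegularFamily

end


/-! ### Regularity of the parametric family from the assumptions. -/

section

variable {𝒳 𝒴 : Type*} [MeasurableSpace 𝒳] [MeasurableSpace 𝒴] {d : ℕ}
  {p : ℕ} {Θ : Set (Euc d)} {μ : Measure 𝒳} {ν : Measure 𝒴} {ε : ℝ}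
  {μθ : Euc d → 𝒴 → Measure 𝒳} {r : Euc d → 𝒴 → 𝒳 → 𝒳 → ℝ}
  {pden : Euc d → 𝒳 → 𝒳 → ℝ} {qden : Euc d → 𝒳 → 𝒴 → ℝ}
  {ψ φ : 𝒴 → ℝ} {Φ : 𝒴 → 𝒳 → ℝ} {M₀ : ℝ} {Q : Kernel 𝒳 𝒴}

/-- The reference measure is arbitrary at the outset; an integrable dominating function that is at
least one forces it to be finite, which makes Fubini and the almost everywhere comparison of
densities available. -/
theorem isFiniteMeasure_of_integrable_of_one_le {f : 𝒳 → ℝ} (hf : Integrable f μ)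
    (h1 : ∀ x, 1 ≤ f x) : IsFiniteMeasure μ := by
  have h2 : Integrable (fun _ : 𝒳 => (1 : ℝ)) μ :=
    hf.mono' aestronglyMeasurable_const (Filter.Eventually.of_forall fun x => by
      rw [norm_one]; exact h1 x)
  exact (integrable_const_iff_isFiniteMeasure one_ne_zero).1 h2

-- Both integrated kernels are comparable with `μθ θ y` on every measurable set, each at the cost of
-- a factor `ε⁻¹`. An inequality of integrals over all such sets passes to the densities.
omit [MeasurableSpace 𝒴] in
theorem StrongMixing.ae_le (h : StrongMixing Θ μ r ε μθ) [SigmaFinite μ]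
    (hr : ∀ θ ∈ Θ, ∀ y x, Measurable fun x' => r θ y x' x)
    (h0 : ∀ θ ∈ Θ, ∀ y x' x, 0 ≤ r θ y x' x) {θ : Euc d} (hθ : θ ∈ Θ) (y : 𝒴) (x z : 𝒳) :
    ∀ᵐ x' ∂μ, r θ y x' x ≤ (ε ^ 2)⁻¹ * r θ y x' z := by
  have hε := h.eps_pos
  have hε' : ENNReal.ofReal ε ≠ 0 := by simpa using hε
  have key : (fun x' => ENNReal.ofReal (r θ y x' x)) ≤ᵐ[μ]
      fun x' => ENNReal.ofReal ((ε ^ 2)⁻¹ * r θ y x' z) := by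
    refine ae_le_of_forall_setLIntegral_le_of_sigmaFinite (hr θ hθ y x).ennreal_ofReal
      fun B hB _ => ?_
    have h1 := h.upper θ hθ y x B hB
    have h2 := h.lower θ hθ y z B hB
    simp_rw [ENNReal.ofReal_mul (show 0 ≤ (ε ^ 2)⁻¹ by positivity)]
    rw [lintegral_const_mul' _ _ ENNReal.ofReal_ne_top]
    refine h1.trans ?_
    have h3 : μθ θ y B ≤ (∫⁻ x' in B, ENNReal.ofReal (r θ y x' z) ∂μ) / ENNReal.ofReal ε := by
      rw [ENNReal.le_div_iff_mul_le (Or.inl hε') (Or.inl ENNReal.ofReal_ne_top), mul_comm]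
      exact h2
    refine (ENNReal.div_le_div_right h3 _).trans (le_of_eq ?_)
    rw [ENNReal.ofReal_inv_of_pos (by positivity), ENNReal.ofReal_pow hε.le, pow_two,
      ENNReal.mul_inv (Or.inl hε') (Or.inr hε'), div_eq_mul_inv, div_eq_mul_inv]
    ring
  filter_upwards [key] with x' hx'
  exact (ENNReal.ofReal_le_ofReal_iff (mul_nonneg (by positivity) (h0 θ hθ y x' z))).1 hx'

theorem StrongMixing.mass_bounds (h : StrongMixing Θ μ r ε μθ) (hlog : LogMassBound Θ μθ φ)
    {θ : Euc d} (hθ : θ ∈ Θ) (y : 𝒴) (x : 𝒳) (hr : Integrable (fun x' => r θ y x' x) μ)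
    (h0 : ∀ x', 0 ≤ r θ y x' x) :
    Real.exp (-φ y) / (ε ^ 2)⁻¹ ≤ ∫ x', r θ y x' x ∂μ ∧
      ∫ x', r θ y x' x ∂μ ≤ (ε ^ 2)⁻¹ * Real.exp (φ y) := by
  have hε := h.eps_pos
  -- The masses satisfy the bounds with `ε`; they are weakened to `ε ^ 2` so that one constant `κ =
  -- ε⁻²` serves everywhere.
  have hε1 : ε ^ 2 ≤ ε := by nlinarith [h.eps_lt_one]
  have hpos := h.mass_pos θ hθ y
  have hfin := (h.mass_lt_top θ hθ y).ne
  set m := (μθ θ y).real Set.univ with hm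
  have hm0 : 0 < m := ENNReal.toReal_pos hpos.ne' hfin
  have hl := abs_le.1 (hlog.bound θ hθ y)
  have e1 : Real.exp (-φ y) ≤ m := (Real.le_log_iff_exp_le hm0).1 hl.1
  have e2 : m ≤ Real.exp (φ y) := (Real.log_le_iff_le_exp hm0).1 hl.2
  have hint : ∫⁻ x' in Set.univ, ENNReal.ofReal (r θ y x' x) ∂μ =
      ENNReal.ofReal (∫ x', r θ y x' x ∂μ) := by
    rw [Measure.restrict_univ, ofReal_integral_eq_lintegral_ofReal hr
      (Filter.Eventually.of_forall h0)]
  have hmm : μθ θ y Set.univ = ENNReal.ofReal m := (ENNReal.ofReal_toReal hfin).symm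
  have l1 := h.lower θ hθ y x Set.univ MeasurableSet.univ
  have l2 := h.upper θ hθ y x Set.univ MeasurableSet.univ
  have hI : 0 ≤ ∫ x', r θ y x' x ∂μ := integral_nonneg h0
  rw [hint, hmm, ← ENNReal.ofReal_mul hε.le, ENNReal.ofReal_le_ofReal_iff hI] at l1
  rw [hint, hmm, ← ENNReal.ofReal_div_of_pos hε,
    ENNReal.ofReal_le_ofReal_iff (by positivity)] at l2
  constructor
  · rw [div_inv_eq_mul, mul_comm]
    exact (mul_le_mul hε1 e1 (Real.exp_pos _).le hε.le).trans l1
  · refine l2.trans ?_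
    rw [div_eq_inv_mul]
    exact mul_le_mul (inv_anti₀ (by positivity) hε1) e2 hm0.le (by positivity)

omit [MeasurableSpace 𝒳] in
theorem ScoreBound.abs_wordDeriv_le {r : Euc d → 𝒴 → 𝒳 → 𝒳 → ℝ} (h : ScoreBound p Θ r ψ)
    (hΘ : IsOpen Θ) (hr : ∀ y x' x, WordDiffOn p (fun t => r t y x' x) Θ)
    (h0 : ∀ θ ∈ Θ, ∀ y x' x, 0 ≤ r θ y x' x) {θ : Euc d} (hθ : θ ∈ Θ) (y : 𝒴) (x' x : 𝒳)
    (w : List (Fin d)) (hw : w.length ≤ p) :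
    |wordDeriv w (fun t => r t y x' x) θ| ≤ ψ y ^ w.length * r θ y x' x := by
  rcases eq_or_ne w [] with rfl | hne
  · simp [abs_of_nonneg (h0 θ hθ y x' x)]
  · have hsum : ∑ i, w.count i = w.length := by
      simpa using Multiset.sum_count_eq_card (s := Finset.univ) (m := (w : Multiset (Fin d)))
        (by simp)
    rw [wordDeriv_eq_multiDeriv hΘ (hr y x' x) hw hθ]
    have key := h.bound θ hθ x x' y (fun i => w.count i) (fun e => hne ?_) (hsum.le.trans hw)
    · rwa [hsum] at key
    · rw [← List.length_eq_zero_iff, ← hsum]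
      exact Finset.sum_eq_zero fun i _ => congrFun e i

/-- The point `y₀` provides one dominating function, hence finiteness of `μ`. -/
theorem isRegularFamily_rden (hΘ : IsOpen Θ) (hfam : IsParametricFamily p Θ μ ν pden qden)
    (hmix : StrongMixing Θ μ (rden pden qden) ε μθ) (hscore : ScoreBound p Θ (rden pden qden) ψ)
    (hdom : Dominated Θ μ (rden pden qden) Φ) (hlog : LogMassBound Θ μθ φ) (y₀ : 𝒴) :
    IsRegularFamily p Θ μ (rden pden qden) (ε ^ 2)⁻¹ ψ φ Φ := by
  have hfin : IsFiniteMeasure μ :=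
    isFiniteMeasure_of_integrable_of_one_le (hdom.integrable y₀) (hdom.one_le y₀)
  have hmeas : ∀ θ ∈ Θ, Measurable fun z : 𝒴 × 𝒳 × 𝒳 => rden pden qden θ z.1 z.2.1 z.2.2 :=
    fun θ hθ => ((hfam.measurable_qden θ hθ).comp (f := fun z : 𝒴 × 𝒳 × 𝒳 => (z.2.1, z.1))
      (by fun_prop)).mul ((hfam.measurable_pden θ hθ).comp
      (f := fun z : 𝒴 × 𝒳 × 𝒳 => (z.2.2, z.2.1)) (by fun_prop))
  have hmeas' : ∀ θ ∈ Θ, ∀ y x, Measurable fun x' => rden pden qden θ y x' x :=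
    fun θ hθ y x => (hmeas θ hθ).comp (f := fun x' : 𝒳 => (y, x', x)) (by fun_prop)
  have h0 : ∀ θ ∈ Θ, ∀ y x' x, 0 ≤ rden pden qden θ y x' x := fun θ hθ y x' x =>
    mul_nonneg (hfam.qden_nonneg θ hθ x' y) (hfam.pden_nonneg θ hθ x x')
  have hint : ∀ θ ∈ Θ, ∀ y x, Integrable (fun x' => rden pden qden θ y x' x) μ :=
    fun θ hθ y x => (hdom.integrable y).mono' (hmeas' θ hθ y x).aestronglyMeasurable
      (Filter.Eventually.of_forall fun x' => by
        rw [Real.norm_of_nonneg (h0 θ hθ y x' x)]; exact hdom.bound θ hθ x x' y)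
  have hsm : ∀ y x' x, WordDiffOn p (fun t => rden pden qden t y x' x) Θ := fun y x' x =>
    ((hfam.diff_qden x' y).wordDiffOn hΘ).mul hΘ ((hfam.diff_pden x x').wordDiffOn hΘ)
  exact
    { isOpen := hΘ
      sfinite := inferInstance
      measurable := hmeas
      nonneg := h0
      smooth := hsm
      one_le_score := hscore.one_le
      score := fun θ hθ => hscore.abs_wordDeriv_le hΘ hsm h0 hθ
      dominated := fun θ hθ y x' x => hdom.bound θ hθ x x' y
      integrable := hdom.integrable
      one_le := (one_le_inv₀ (pow_pos hmix.eps_pos 2)).2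
        (pow_le_one₀ hmix.eps_pos.le hmix.eps_lt_one.le)
      mixing := fun θ hθ => hmix.ae_le hmeas' h0 hθ
      mass_lower := fun θ hθ y x =>
        (hmix.mass_bounds hlog hθ y x (hint θ hθ y x) fun x' => h0 θ hθ y x' x).1
      mass_upper := fun θ hθ y x =>
        (hmix.mass_bounds hlog hθ y x (hint θ hθ y x) fun x' => h0 θ hθ y x' x).2 }

theorem hasUniformMoments_of_momentBound
    (hscore : ScoreBound p Θ r ψ) (hlog : LogMassBound Θ μθ φ) (hmom : MomentBound p Q φ ψ M₀) :
    HasUniformMoments p Q ψ φ M₀ where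
  measurable_score := hscore.measurable
  measurable_log := hlog.measurable
  log_nonneg y := zero_le_one.trans (hlog.one_le y)
  one_le := hmom.one_le
  score x := (lintegral_mono fun y => ENNReal.ofReal_le_ofReal
    -- As `ψ ≥ 1`, its power `p` is below the power `2 * p * (p + 1)`.
    (pow_le_pow_right₀ (hscore.one_le y) (by nlinarith))).trans (hmom.bound_v x)
  log x := (lintegral_mono fun y => ENNReal.ofReal_le_ofReal
    (le_mul_of_one_le_right (zero_le_one.trans (hlog.one_le y))
      (one_le_pow₀ (hscore.one_le y)))).trans (hmom.bound_u x)

end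

end SSM

/-! ### The main theorem. -/

theorem theorem2p1
    {d dx dy p : ℕ} (hd : 1 ≤ d) (hdx : 1 ≤ dx) (hdy : 1 ≤ dy) (hp : 1 ≤ p)
    -- state space, observation space and parameter space
    (𝒳 : Set (SSM.Euc dx)) (h𝒳 : MeasurableSet 𝒳)
    (𝒴 : Set (SSM.Euc dy)) (h𝒴 : MeasurableSet 𝒴)
    (Θ : Set (SSM.Euc d)) (hΘ : IsOpen Θ) (hΘb : Bornology.IsBounded Θ)
    -- the true model
    {Ω : Type*} [MeasurableSpace Ω] (Pr : Measure Ω) [IsProbabilityMeasure Pr]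
    (P : Kernel 𝒳 𝒳) [IsMarkovKernel P] (Q : Kernel 𝒳 𝒴) [IsMarkovKernel Q]
    (X : ℕ → Ω → 𝒳) (Y : ℕ → Ω → 𝒴) (hXY : SSM.IsStateSpaceModel Pr P Q X Y)
    -- the parametric family of models
    (μ : Measure 𝒳) (ν : Measure 𝒴)
    (pden : SSM.Euc d → 𝒳 → 𝒳 → ℝ) (qden : SSM.Euc d → 𝒳 → 𝒴 → ℝ)
    (hfam : SSM.IsParametricFamily p Θ μ ν pden qden)
    -- the assumptions
    (ε : ℝ) (μθ : SSM.Euc d → 𝒴 → Measure 𝒳)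
    (hmix : SSM.StrongMixing Θ μ (SSM.rden pden qden) ε μθ)
    (ψ : 𝒴 → ℝ) (hscore : SSM.ScoreBound p Θ (SSM.rden pden qden) ψ)
    (Φ : 𝒴 → 𝒳 → ℝ) (hdom : SSM.Dominated Θ μ (SSM.rden pden qden) Φ)
    (π : Measure 𝒳) (δ K₀ : ℝ) (herg : SSM.GeometricallyErgodic P π δ K₀)
    (φ : 𝒴 → ℝ) (hlog : SSM.LogMassBound Θ μθ φ)
    (M₀ : ℝ) (hmom : SSM.MomentBound p Q φ ψ M₀) :
    -- the average log-likelihood is well defined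
    (∀ θ ∈ Θ, ∀ lam : Measure 𝒳, IsProbabilityMeasure lam → ∀ n : ℕ, 1 ≤ n →
      (∀ y : Fin n → 𝒴,
        0 < SSM.likelihood μ (SSM.rden pden qden θ) lam n y ∧
        SSM.likelihood μ (SSM.rden pden qden θ) lam n y < ∞) ∧
      Integrable (SSM.normLogLikelihood μ (SSM.rden pden qden θ) Y lam n) Pr) ∧
    -- and it converges to a `p`-times differentiable limit which does not depend on `lam`
    ∃ l : SSM.Euc d → ℝ, SSM.TimesDifferentiableOn p l Θ ∧
      ∀ θ ∈ Θ, ∀ lam : Measure 𝒳, IsProbabilityMeasure lam →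
        Tendsto (fun n : ℕ => SSM.avgLogLikelihood Pr μ (SSM.rden pden qden θ) Y lam n)
          atTop (𝓝 (l θ)) := by 
  -- A sample point supplies the default observation `Y 0 ω` and the reference state `X 0 ω`.
  have hne : Nonempty Ω := by
    by_contra hempty
    rw [not_nonempty_iff] at hempty
    exact IsProbabilityMeasure.ne_zero Pr (Measure.eq_zero_of_isEmpty Pr)
  obtain ⟨ω⟩ := hne
  have h := SSM.isRegularFamily_rden hΘ hfam hmix hscore hdom hlog (Y 0 ω)
  have hm := SSM.hasUniformMoments_of_momentBound hscore hlog hmom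
  refine ⟨fun θ hθ lam hlam n _ => ⟨fun y => ?_,
    h.integrable_normLogLikelihood hm hXY hθ lam (X 0 ω) n⟩, ?_⟩
  · rw [h.likelihood_eq hθ lam n y]
    exact ⟨ENNReal.ofReal_pos.2 (h.integral_condLik_pos hθ lam _ (X 0 ω)),
      ENNReal.ofReal_lt_top⟩
  · obtain ⟨l, hl, hlim⟩ := h.exists_limit_expectation_logIncr hm hXY herg (Y 0 ω) (X 0 ω)
    exact ⟨l, hl.timesDifferentiableOn hΘ, fun θ hθ lam hlam =>
      h.tendsto_avgLogLikelihood hm hXY hθ lam (X 0 ω) (hlim θ hθ)⟩
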